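/- **Setting.** Let $(I,\cdot)$ be a bar-consistent super Cartan datum of anisotropic type: $I=I_{\bar 0}\sqcup I_{\bar 1}$ is a finite set with parity $p:I\to\{0,1\}$, and $\cdot$ is a symmetric $\mathbb Z$-valued bilinear form on $\mathbb Z[I]$ such that $d_i=\frac{i\cdot i}{2}\in\mathbb Z_{>0}$, $a_{ij}=\frac{2\,i\cdot j}{i\cdot i}\in\mathbb Z_{\le 0}$ for $i\ne j$, $a_{ij}\in 2\mathbb Z$ if $p(i)=1$, and $d_i\equiv p(i) \pmod 2$. Let $(Y,X,\langle\cdot,\cdot\rangle)$ be an associated root datum: $Y,X$ are finitely generated free abelian groups with a perfect pairing $Y\times X\to\mathbb Z$, together with linearly independent families $(i)_{i\in I}$ in $Y$ and $(i')_{i\in I}$ in $X$ such that $\langle i,j'\rangle=a_{ij}$. Put $X^+=\{\lambda\in X\mid \langle i,\lambda\rangle\ge 0\ \forall i\in I\}$, $b_{ij}=1-a_{ij}$, $\mathbb Q(v)^\pi=\mathbb Q(v)[\pi]/(\pi^2-1)$, $v_i=v^{d_i}$, $\pi_i=\pi^{d_i}$ and $$\begin{bmatrix}n\\k\end{bmatrix}_{v,\pi}=\prod_{l=n-k+1}^{n}\big((\pi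 v)^l-v^{-l}\big)\Big/\prod_{l=1}^{k}\big((\pi v)^l-v^{-l}\big).$$ The covering quantum group $\mathbf U$ is the unital $\mathbb Q(v)^\pi$-algebra generated by $E_i,F_i,K_\mu,J_\mu$ ($i\in I$, $\mu\in Y$) with relations $J_\mu J_\nu=J_{\mu+\nu}$, $K_\mu K_\nu=K_{\mu+\nu}$, $K_0=J_0=J_\nu^2=1$, $J_\mu K_\nu=K_\nu J_\mu$; $J_\mu E_i=\pi^{\langle\mu,i'\rangle}E_iJ_\mu$, $J_\mu F_i=\pi^{-\langle\mu,i'\rangle}F_iJ_\mu$, $K_\mu E_i=v^{\langle\mu,i'\rangle}E_iK_\mu$, $K_\mu F_i=v^{-\langle\mu,i'\rangle}F_iK_\mu$; $$E_iF_j-\pi^{p(i)p(j)}F_jE_i=\delta_{ij}\frac{J_{d_i i}K_{d_i i}-K_{-d_i i}}{\pi_iv_i-v_i^{-1}};$$ $$\sum_{k=0}^{b_{ij}}(-1)^k\pi^{\binom k2p(i)+kp(i)p(j)}\begin{bmatrix}b_{ij}\\k\end{bmatrix}_{v_i,\pi_i}x_i^{b_{ij}-k}x_jx_i^k=0\qquad(i\ne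 j,\ x=E\text{ or }x=F).$$ For $\varepsilon=\pm1$, $\mathbf U|_{\pi=\varepsilon}$ is the $\mathbb Q(v)$-algebra obtained by specializing $\pi$ to $\varepsilon$, and $\mathbf U[\mathbf t]|_{\pi=\varepsilon}=\mathbb Q(v,\mathbf t)\otimes_{\mathbb Q(v)}\mathbf U|_{\pi=\varepsilon}$, where $\mathbf t^2=-1$. A module $M$ over either algebra is a *weight module* if $M=\bigoplus_{\lambda\in X}M_\lambda$, where $$M_\lambda=\{m\in M\mid K_\nu m=v^{\langle\nu,\lambda\rangle}m,\ J_\nu m=\varepsilon^{\langle\nu,\lambda\rangle}m\ \ \forall\nu\in Y\}.$$ Let $\mathcal C^{\mathbf t}_{\pi=\varepsilon}$ be the category of weight modules over $\mathbf U[\mathbf t]|_{\pi=\varepsilon}$ (morphisms: all module homomorphisms). For $\lambda\in X$ let $V(\lambda)_{\pi=\varepsilon}$ be the simple highest weight $\mathbf U|_{\pi=\varepsilon}$-module (over $\mathbb Q(v)$) of highest weight $\lambda$, that is, the quotient of the Verma module by the sum of its proper submodules; here the Verma module is the quotient of $\mathbf U|_{\pi=\varepsilon}$ by the left ideal generated by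 all $E_i$, $K_\nu-v^{\langle\nu,\lambda\rangle}$ and $J_\nu-\varepsilon^{\langle\nu,\lambda\rangle}$. **Proposition.** (1) The categories $\mathcal C^{\mathbf t}_{\pi=1}$ and $\mathcal C^{\mathbf t}_{\pi=-1}$ are equivalent, and an equivalence is induced by the twistor of the modified covering quantum group, as follows. Fix a total order on $I$ and a transversal $C\subset X$ of $X/\mathbb Z[I]$. Let $\phi$ be the bilinear form on $\mathbb Z[I]$ with $\phi(i,j)=d_ia_{ij}$ if $j<i$, $\phi(i,i)=d_i$, and $\phi(i,j)=-2p(i)p(j)$ if $j>i$, and put $\dot\phi(\nu,\mu'+c)=\phi(\nu,\mu)$ for $\nu,\mu\in\mathbb Z[I]$ and $c\in C$. Then there are a field automorphism $\sigma$ of $\mathbb Q(v,\mathbf t)$ with $\sigma(v)=\mathbf t^{-1}v$ and $\sigma(\mathbf t)=\mathbf t$, an equivalence $\Theta:\mathcal C^{\mathbf t}_{\pi=1}\to\mathcal C^{\mathbf t}_{\pi=-1}$, and additive bijections $f_M:M\to\Theta(M)$, natural in $M$, such that for all $M$, all $i\in I$, $\lambda\in X$ and $c\in\mathbb Q(v,\mathbf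 t)$: $f_M(cm)=\sigma(c)f_M(m)$ for $m\in M$; $f_M(M_\lambda)=\Theta(M)_\lambda$; and, for $m\in M_\lambda$, $$f_M(E_im)=\mathbf t^{\,d_i\langle i,\lambda\rangle-\dot\phi(i,\lambda)}E_if_M(m),\qquad f_M(F_im)=\mathbf t^{\,\dot\phi(i,\lambda)}F_if_M(m).$$ (2) For each $\lambda\in X^+$ and $\varepsilon=\pm1$, $V(\lambda)_{\pi=\varepsilon}$ is a weight module with finite-dimensional weight spaces, and the characters of $V(\lambda)_{\pi=-1}$ and $V(\lambda)_{\pi=1}$ coincide: $\dim_{\mathbb Q(v)}(V(\lambda)_{\pi=-1})_\mu=\dim_{\mathbb Q(v)}(V(\lambda)_{\pi=1})_\mu$ for all $\mu\in X$. -/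

import Mathlib

open Polynomial TensorProduct CategoryTheory

namespace CoveringQG

universe w u₁ u₂ u₃ u₄

/-! ### Scalars -/

/-- The field `ℚ(v)`. -/
abbrev Qv : Type := RatFunc ℚ

/-- The ring `ℚ(v)^π = ℚ(v)[π]/(π² - 1)`. -/
def QvPi : Type := AdjoinRoot (X ^ 2 - 1 : Qv[X])

noncomputable instance : CommRing QvPi := inferInstanceAs (CommRing (AdjoinRoot _))

noncomputable instance : Algebra Qv QvPi := inferInstanceAs (Algebra Qv (AdjoinRoot _))

/-- The field `ℚ(v, 𝐭) = ℚ(v)[𝐭]/(𝐭² + 1)`. -/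
def Qvt : Type := AdjoinRoot (X ^ 2 + 1 : Qv[X])

noncomputable instance : CommRing Qvt := inferInstanceAs (CommRing (AdjoinRoot _))

noncomputable instance : Algebra Qv Qvt := inferInstanceAs (Algebra Qv (AdjoinRoot _))

/-- The quantum parameter `v`, an invertible element of every `ℚ(v)`-algebra. -/
noncomputable def vUnit (R : Type*) [CommRing R] [Algebra Qv R] : Rˣ :=
  Units.map (algebraMap Qv R).toMonoidHom (Units.mk0 (RatFunc.X : Qv) RatFunc.X_ne_zero)

theorem root_pi_sq : (AdjoinRoot.root (X ^ 2 - 1 : Qv[X])) ^ 2 = 1 := by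
  have h := AdjoinRoot.eval₂_root (X ^ 2 - 1 : Qv[X])
  simp only [eval₂_sub, eval₂_pow, eval₂_X, eval₂_one] at h
  exact sub_eq_zero.mp h

theorem root_t_sq : (AdjoinRoot.root (X ^ 2 + 1 : Qv[X])) ^ 2 = -1 := by
  have h := AdjoinRoot.eval₂_root (X ^ 2 + 1 : Qv[X])
  simp only [eval₂_add, eval₂_pow, eval₂_X, eval₂_one] at h
  exact eq_neg_of_add_eq_zero_left h

/-- The element `π` of `ℚ(v)^π`, which is its own inverse. -/
noncomputable def piUnit : QvPiˣ where
  val := AdjoinRoot.root (X ^ 2 - 1 : Qv[X])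
  inv := AdjoinRoot.root (X ^ 2 - 1 : Qv[X])
  val_inv := (sq _).symm.trans root_pi_sq
  inv_val := (sq _).symm.trans root_pi_sq

/-- The element `𝐭` of `ℚ(v, 𝐭)`, with inverse `-𝐭`. -/
noncomputable def tUnit : Qvtˣ where
  val := AdjoinRoot.root (X ^ 2 + 1 : Qv[X])
  inv := -AdjoinRoot.root (X ^ 2 + 1 : Qv[X])
  val_inv := (mul_neg _ _).trans (neg_eq_iff_eq_neg.mpr ((sq _).symm.trans root_t_sq))
  inv_val := (neg_mul _ _).trans (neg_eq_iff_eq_neg.mpr ((sq _).symm.trans root_t_sq))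

/-- For a sign `ε` and a `ℚ(v)`-algebra `R`, the ring `R` regarded as a `ℚ(v)^π`-algebra
on which `π` acts as `ε`. -/
def SpecAt (_ε : ℤˣ) (R : Type*) : Type _ := R

namespace SpecAt

variable (ε : ℤˣ) (R : Type*)

instance [CommRing R] : CommRing (SpecAt ε R) := inferInstanceAs (CommRing R)

/-- The identity map `R → SpecAt ε R`. -/
def of [CommRing R] : R ≃+* SpecAt ε R := RingEquiv.refl R

/-- The specialization homomorphism `ℚ(v)^π → R`, `π ↦ ε`. -/
noncomputable def specHom [CommRing R] [Algebra Qv R] : QvPi →+* SpecAt ε R :=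
  AdjoinRoot.lift ((of ε R).toRingHom.comp (algebraMap Qv R)) (((ε : ℤ) : SpecAt ε R)) (by
    have h : ((ε : ℤ) : SpecAt ε R) ^ 2 = 1 := by
      rcases Int.units_eq_one_or ε with h | h <;> subst h <;> simp
    simp [h])

noncomputable instance [CommRing R] [Algebra Qv R] : Algebra QvPi (SpecAt ε R) :=
  (specHom ε R).toAlgebra

end SpecAt

/-! ### Super Cartan data and root data -/

/-- A bar-consistent super Cartan datum of anisotropic type on the set `I`: the symmetric bilinear
form on `ℤ[I]` is given by its values on `I`, and `p i ∈ {0, 1}` is the parity of `i`. The numbers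
`d i = (i · i) / 2` and `a i j = 2 (i · j) / (i · i)` are determined by the form. -/
structure SuperCartanDatum (I : Type u₁) where
  form : I → I → ℤ
  form_symm : ∀ i j, form i j = form j i
  d : I → ℕ
  d_pos : ∀ i, 0 < d i
  form_self : ∀ i, form i i = 2 * (d i : ℤ)
  a : I → I → ℤ
  form_mul_a : ∀ i j, form i i * a i j = 2 * form i j
  a_nonpos : ∀ i j, i ≠ j → a i j ≤ 0
  p : I → Fin 2
  a_even : ∀ i j, p i = 1 → Even (a i j)
  bar_consistent : ∀ i, d i ≡ (p i : ℕ) [MOD 2]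

/-- A super root datum `(Y, X, I, ·)` which is both `X`-regular and `Y`-regular. The lattices are
meant to be finitely generated free abelian groups. -/
structure SuperRootDatum (I : Type u₁) (Y : Type u₂) (X : Type u₃)
    [AddCommGroup Y] [AddCommGroup X] extends SuperCartanDatum I where
  pairing : Y →ₗ[ℤ] X →ₗ[ℤ] ℤ
  perfect : pairing.IsPerfPair
  coroot : I → Y
  root : I → X
  coroot_linearIndependent : LinearIndependent ℤ coroot
  root_linearIndependent : LinearIndependent ℤ root
  pairing_coroot_root : ∀ i j, pairing (coroot i) (root j) = a i j

/-! ### Quantum binomial coefficients -/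

/-- The difference `(πv)ˡ - v⁻ˡ`, where `π` is the first and `v` the second argument. -/
def qDiff {A : Type*} [CommRing A] (q v : Aˣ) (l : ℤ) : A :=
  (((q * v) ^ l : Aˣ) : A) - ((v ^ (-l) : Aˣ) : A)

/-- The quantum binomial coefficient
`∏_{l = n-k+1}^{n} ((πv)ˡ - v⁻ˡ) / ∏_{l = 1}^{k} ((πv)ˡ - v⁻ˡ)`. -/
noncomputable def qBinom {A : Type*} [CommRing A] (q v : Aˣ) (n : ℤ) (k : ℕ) : A :=
  (∏ l ∈ Finset.Icc (n - k + 1) n, qDiff q v l) *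
    Ring.inverse (∏ l ∈ Finset.Icc (1 : ℤ) k, qDiff q v l)

section Algebra

variable {I : Type u₁} {Y : Type u₂} {X : Type u₃} [AddCommGroup Y] [AddCommGroup X]
variable (D : SuperRootDatum I Y X)

namespace SuperRootDatum

/-- `b_{ij} = 1 - a_{ij}`, a positive integer for `i ≠ j`. -/
def b (i j : I) : ℕ := (1 - D.a i j).toNat

/-- `v_i = v^{d_i}` in `ℚ(v)^π`. -/
noncomputable def vi (i : I) : QvPiˣ := vUnit QvPi ^ D.d i

/-- `π_i = π^{d_i}` in `ℚ(v)^π`. -/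
noncomputable def pii (i : I) : QvPiˣ := piUnit ^ D.d i

end SuperRootDatum

/-! ### The covering quantum group -/

/-- The symbols `E_i`, `F_i`, `K_μ`, `J_μ`. -/
inductive Gen (I : Type u₁) (Y : Type u₂) : Type (max u₁ u₂)
  | E (i : I)
  | F (i : I)
  | K (μ : Y)
  | J (μ : Y)

/-- The free `ℚ(v)^π`-algebra on the symbols. -/
abbrev FreeAlg (I : Type u₁) (Y : Type u₂) : Type (max u₁ u₂) := FreeAlgebra QvPi (Gen I Y)

/-- A symbol as an element of the free algebra. -/
noncomputable def gen (x : Gen I Y) : FreeAlg I Y := FreeAlgebra.ι QvPi x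

/-- The quantum Serre expression in `x_i` and `x_j` (`x = E` or `x = F`):
`∑_{k=0}^{b_ij} (-1)^k π^{binom(k,2) p(i) + k p(i) p(j)} [b_ij choose k]_{v_i,π_i}
x_i^{b_ij - k} x_j x_i^k`. -/
noncomputable def serre (i j : I) {A : Type*} [Ring A] [Algebra QvPi A] (xi xj : A) : A :=
  ∑ k ∈ Finset.range (D.b i j + 1),
    ((-1 : QvPi) ^ k *
      (piUnit : QvPi) ^ (k.choose 2 * (D.p i : ℕ) + k * (D.p i : ℕ) * (D.p j : ℕ)) *
      qBinom (D.pii i) (D.vi i) (D.b i j) k) • (xi ^ (D.b i j - k) * xj * xi ^ k)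

open Gen in
/-- The defining relations of the covering quantum group. -/
inductive Rel : FreeAlg I Y → FreeAlg I Y → Prop
  | J_mul (μ ν : Y) : Rel (gen (J μ) * gen (J ν)) (gen (J (μ + ν)))
  | K_mul (μ ν : Y) : Rel (gen (K μ) * gen (K ν)) (gen (K (μ + ν)))
  | K_zero : Rel (gen (K 0)) 1
  | J_zero : Rel (gen (J 0)) 1
  | J_sq (ν : Y) : Rel (gen (J ν) ^ 2) 1
  | J_K (μ ν : Y) : Rel (gen (J μ) * gen (K ν)) (gen (K ν) * gen (J μ))
  | J_E (μ : Y) (i : I) : Rel (gen (J μ) * gen (E i))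
      (((piUnit ^ D.pairing μ (D.root i) : QvPiˣ) : QvPi) • (gen (E i) * gen (J μ)))
  | J_F (μ : Y) (i : I) : Rel (gen (J μ) * gen (F i))
      (((piUnit ^ (-D.pairing μ (D.root i)) : QvPiˣ) : QvPi) • (gen (F i) * gen (J μ)))
  | K_E (μ : Y) (i : I) : Rel (gen (K μ) * gen (E i))
      (((vUnit QvPi ^ D.pairing μ (D.root i) : QvPiˣ) : QvPi) • (gen (E i) * gen (K μ)))
  | K_F (μ : Y) (i : I) : Rel (gen (K μ) * gen (F i))
      (((vUnit QvPi ^ (-D.pairing μ (D.root i)) : QvPiˣ) : QvPi) • (gen (F i) * gen (K μ)))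
  | E_F_same (i : I) : Rel
      (gen (E i) * gen (F i) -
        (piUnit : QvPi) ^ ((D.p i : ℕ) * (D.p i : ℕ)) • (gen (F i) * gen (E i)))
      (Ring.inverse (qDiff (D.pii i) (D.vi i) 1) •
        (gen (J (D.d i • D.coroot i)) * gen (K (D.d i • D.coroot i)) -
          gen (K (-(D.d i • D.coroot i)))))
  | E_F_ne (i j : I) (hij : i ≠ j) : Rel
      (gen (E i) * gen (F j) -
        (piUnit : QvPi) ^ ((D.p i : ℕ) * (D.p j : ℕ)) • (gen (F j) * gen (E i))) 0
  | serre_E (i j : I) (hij : i ≠ j) : Rel (serre D i j (gen (E i)) (gen (E j))) 0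
  | serre_F (i j : I) (hij : i ≠ j) : Rel (serre D i j (gen (F i)) (gen (F j))) 0

/-- The covering quantum group `𝐔`, a `ℚ(v)^π`-algebra. -/
def CovU : Type (max u₁ u₂) := RingQuot (Rel D)

noncomputable instance : Ring (CovU D) := inferInstanceAs (Ring (RingQuot (Rel D)))

noncomputable instance : Algebra QvPi (CovU D) :=
  inferInstanceAs (Algebra QvPi (RingQuot (Rel D)))

/-- The image of a symbol in `𝐔`. -/
noncomputable def CovU.of (x : Gen I Y) : CovU D := RingQuot.mkAlgHom QvPi (Rel D) (gen x)

/-- The specialization at `π = ε` with scalars extended from `ℚ(v)` to the `ℚ(v)`-algebra `R`: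
`R_ε ⊗_{ℚ(v)^π} 𝐔`. For `R = ℚ(v)` this is `𝐔|_{π = ε}` and for `R = ℚ(v, 𝐭)` it is
`𝐔[𝐭]|_{π = ε}`. -/
def SpecU (ε : ℤˣ) (R : Type u₄) [CommRing R] [Algebra Qv R] : Type (max u₄ (max u₁ u₂)) :=
  SpecAt ε R ⊗[QvPi] CovU D

variable (ε : ℤˣ) (R : Type u₄) [CommRing R] [Algebra Qv R]

noncomputable instance : Ring (SpecU D ε R) := inferInstanceAs (Ring (SpecAt ε R ⊗[QvPi] CovU D))

noncomputable instance : Algebra (SpecAt ε R) (SpecU D ε R) :=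
  inferInstanceAs (Algebra (SpecAt ε R) (SpecAt ε R ⊗[QvPi] CovU D))

noncomputable instance : Algebra QvPi (SpecU D ε R) :=
  inferInstanceAs (Algebra QvPi (SpecAt ε R ⊗[QvPi] CovU D))

instance : IsScalarTower QvPi (SpecAt ε R) (SpecU D ε R) :=
  inferInstanceAs (IsScalarTower QvPi (SpecAt ε R) (SpecAt ε R ⊗[QvPi] CovU D))

/-- The image of a symbol in the specialization. -/
noncomputable def SpecU.of (x : Gen I Y) : SpecU D ε R :=
  (1 : SpecAt ε R) ⊗ₜ[QvPi] CovU.of D x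

/-- The scalars `R` inside the specialization. -/
noncomputable def SpecU.scalar (c : R) : SpecU D ε R :=
  algebraMap (SpecAt ε R) (SpecU D ε R) (SpecAt.of ε R c)

/-! ### Weight modules -/

section Weight

variable (M : Type w) [AddCommGroup M] [Module (SpecU D ε R) M]

/-- The weight space `M_lam = {m | K_ν m = v^⟨ν,lam⟩ m, J_ν m = π^⟨ν,lam⟩ m for all ν ∈ Y}`. The
scalars `v` and `π` act through `ℚ(v)^π`. -/
def weightSpace (lam : X) : AddSubgroup M where
  carrier := {m | ∀ ν : Y,
    SpecU.of D ε R (.K ν) • m =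
      algebraMap QvPi (SpecU D ε R) ((vUnit QvPi ^ D.pairing ν lam : QvPiˣ) : QvPi) • m ∧
    SpecU.of D ε R (.J ν) • m =
      algebraMap QvPi (SpecU D ε R) ((piUnit ^ D.pairing ν lam : QvPiˣ) : QvPi) • m}
  zero_mem' := fun ν => by simp
  add_mem' := fun {a b} ha hb ν => by
    simp only [smul_add, (ha ν).1, (ha ν).2, (hb ν).1, (hb ν).2, and_self]
  neg_mem' := fun {a} ha ν => by
    simp only [smul_neg, (ha ν).1, (ha ν).2, and_self]

open Classical in
/-- `M` is a weight module: it is the direct sum of its weight spaces. -/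
def IsWeightModule : Prop := DirectSum.IsInternal (weightSpace D ε R M)

end Weight

/-- The category of weight modules over `R_ε ⊗ 𝐔`: all weight modules, all module homomorphisms. -/
abbrev WeightModCat : Type (max u₁ u₂ u₄ (w + 1)) :=
  ObjectProperty.FullSubcategory
    (fun M : ModuleCat.{w} (SpecU D ε R) => IsWeightModule D ε R M)

/-! ### Highest weight modules -/

/-- The left ideal generated by all `E_i`, `K_ν - v^⟨ν,lam⟩` and `J_ν - π^⟨ν,lam⟩`. -/
noncomputable def vermaIdeal (lam : X) : Submodule (SpecU D ε R) (SpecU D ε R) :=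
  Submodule.span (SpecU D ε R)
    (Set.range (fun i : I => SpecU.of D ε R (.E i)) ∪
      Set.range (fun ν : Y => SpecU.of D ε R (.K ν) -
        algebraMap QvPi (SpecU D ε R) ((vUnit QvPi ^ D.pairing ν lam : QvPiˣ) : QvPi)) ∪
      Set.range (fun ν : Y => SpecU.of D ε R (.J ν) -
        algebraMap QvPi (SpecU D ε R) ((piUnit ^ D.pairing ν lam : QvPiˣ) : QvPi)))

/-- The Verma module of highest weight `lam`. -/
abbrev Verma (lam : X) : Type (max u₁ u₂ u₄) := SpecU D ε R ⧸ vermaIdeal D ε R lam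

/-- The sum of all proper submodules of the Verma module, which is its largest proper submodule. -/
noncomputable def vermaRadical (lam : X) : Submodule (SpecU D ε R) (Verma D ε R lam) :=
  sSup {N | N ≠ ⊤}

/-- The module `V(lam)_{π = ε}` over `𝐔|_{π = ε}` (with scalars `ℚ(v)`): the simple highest weight
module of highest weight `lam`. -/
abbrev SimpleV (lam : X) : Type (max u₁ u₂) := Verma D ε Qv lam ⧸ vermaRadical D ε Qv lam

/-- The weight space `V(lam)_μ` as a `ℚ(v)`-subspace of `V(lam)_{π = ε}`. -/
noncomputable def simpleVWeightSpace (lam μ : X) :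
    Submodule (SpecAt ε Qv) (SimpleV D ε lam) where
  toAddSubmonoid := (weightSpace D ε Qv (SimpleV D ε lam) μ).toAddSubmonoid
  smul_mem' := fun c m hm ν => by
    have h := hm ν
    have key : ∀ (a : SpecU D ε Qv) (x : SimpleV D ε lam), a • c • x = c • a • x :=
      fun a x => by
        rw [← algebraMap_smul (SpecU D ε Qv) c x, ← algebraMap_smul (SpecU D ε Qv) c (a • x),
          ← mul_smul, ← mul_smul, Algebra.commutes]
    exact ⟨by rw [key, key, h.1], by rw [key, key, h.2]⟩

/-- The character of `V(lam)_{π = ε}`, as the function `μ ↦ dim_{ℚ(v)} V(lam)_μ`. -/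
noncomputable def character (lam : X) : X → ℕ :=
  fun μ => Module.finrank (SpecAt ε Qv) (simpleVWeightSpace D ε lam μ)

/-- The dominant weights. -/
def SuperRootDatum.dominant : Set X := {lam | ∀ i, 0 ≤ D.pairing (D.coroot i) lam}

end Algebra

/-! ### The twistor -/

section Twistor

variable {I : Type u₁} {Y : Type u₂} {X : Type u₃} [AddCommGroup Y] [AddCommGroup X]
variable (D : SuperRootDatum I Y X)

/-- `φ(i, j)` for `i, j ∈ I`, relative to a total order on `I`. -/
def phi [LinearOrder I] (i j : I) : ℤ :=
  if j < i then D.d i * D.a i j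
  else if j = i then D.d i
  else -2 * (D.p i : ℕ) * (D.p j : ℕ)

/-- `C ⊆ X` is a transversal for the cosets of the subgroup `ℤ[I] ⊆ X`: every element of `X` is
`ν' + c` for exactly one `ν ∈ ℤ[I]` and one `c ∈ C`. -/
def IsTransversal (C : Set X) : Prop :=
  Function.Bijective (fun x : (I →₀ ℤ) × C => Finsupp.linearCombination ℤ D.root x.1 + (x.2 : X))

/-- `φ̇(i, lam)`, which for `lam = ν' + c` with `ν ∈ ℤ[I]`, `c ∈ C` equals `φ(i, ν)`
(`φ` extended bilinearly). -/
noncomputable def phiDot [LinearOrder I] {C : Set X} (hC : IsTransversal D C) (i : I) (lam : X) :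
    ℤ :=
  ((Equiv.ofBijective _ hC).symm lam).1.sum fun j n => n * phi D i j

/-- The equivalence `Θ` between the categories of weight modules over `𝐔[𝐭]|_{π=1}` and
`𝐔[𝐭]|_{π=-1}` is given by the twistor of the modified covering quantum group, that is, by
`1_lam ↦ 1_lam`, `E_i 1_lam ↦ 𝐭^(d_i ⟨i,lam⟩ - φ̇(i,lam)) E_i 1_lam`,
`F_i 1_lam ↦ 𝐭^φ̇(i,lam) F_i 1_lam`, `v ↦ 𝐭⁻¹ v`, `𝐭 ↦ 𝐭`, `π ↦ -π`: there are natural additive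
bijections `f : M → Θ M` which preserve the weight spaces and carry the action of each of these
elements to the action of its image. -/
def IsInducedByTwistor [LinearOrder I] {C : Set X} (hC : IsTransversal D C)
    (Θ : WeightModCat.{w} D 1 Qvt ≌ WeightModCat.{w} D (-1) Qvt) : Prop :=
  ∃ (σ : Qvt ≃+* Qvt) (f : ∀ M : WeightModCat.{w} D 1 Qvt, M.obj ≃+ (Θ.functor.obj M).obj),
    σ (vUnit Qvt : Qvt) = ((tUnit⁻¹ * vUnit Qvt : Qvtˣ) : Qvt) ∧
    σ (tUnit : Qvt) = tUnit ∧
    (∀ (M N : WeightModCat.{w} D 1 Qvt) (g : M ⟶ N) (m : M.obj),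
      f N (g.hom m) = (Θ.functor.map g).hom (f M m)) ∧
    ∀ M : WeightModCat.{w} D 1 Qvt,
      (∀ (c : Qvt) (m : M.obj),
        f M (SpecU.scalar D 1 Qvt c • m) = SpecU.scalar D (-1) Qvt (σ c) • f M m) ∧
      (∀ (lam : X) (m : M.obj),
        m ∈ weightSpace D 1 Qvt M.obj lam ↔
          f M m ∈ weightSpace D (-1) Qvt (Θ.functor.obj M).obj lam) ∧
      (∀ (i : I) (lam : X), ∀ m ∈ weightSpace D 1 Qvt M.obj lam,
        f M (SpecU.of D 1 Qvt (.E i) • m) =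
          SpecU.scalar D (-1) Qvt
            ((tUnit ^ (D.d i * D.pairing (D.coroot i) lam - phiDot D hC i lam) : Qvtˣ) : Qvt) •
              SpecU.of D (-1) Qvt (.E i) • f M m) ∧
      (∀ (i : I) (lam : X), ∀ m ∈ weightSpace D 1 Qvt M.obj lam,
        f M (SpecU.of D 1 Qvt (.F i) • m) =
          SpecU.scalar D (-1) Qvt ((tUnit ^ phiDot D hC i lam : Qvtˣ) : Qvt) •
            SpecU.of D (-1) Qvt (.F i) • f M m)

end Twistor

end CoveringQG

universe w u₁ u₂ u₃

open CoveringQG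

namespace CoveringQG

universe u₄

/-! ### Scalars -/

/-! Since `𝐭² = -1`, passing from `(v, π)` to `(𝐭v, -π)` is a substitution `v ↦ s v`, `π ↦ s²π` with
`s⁴ = 1`. Under it `(πv)ˡ - v⁻ˡ` is only multiplied by `s⁻ˡ`, because `s³ = s⁻¹`; hence quantum
binomials and all coefficients of the defining relations change only by powers of `s`. These powers
can be absorbed into the generators: on a weight module at `π = ε`, let `E_i` and `F_i` act on the
weight space of `lam` with an extra factor `s ^ expE i lam`, respectively `s ^ expF i lam`. The
relations at `π = -ε` then become congruences modulo 4 between exponents. They hold if `φ i` changes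
by a constant `c i j` under translation by the root of `j`, where `c i i = d i` and `c i j - c j i`
is prescribed modulo 4 for `i ≠ j` (`TwistDatum`, `twistGen_covRel`). Bar-consistency and the
evenness of `a i j` for odd `i` make `phi` such a choice.

So the additive group of a weight module at `ε` carries a module structure at `-ε`, with scalars
acting through `v ↦ s v` and with the same weight spaces. Twisting by `s` and then by `s⁻¹` restores
the original action, which gives the equivalence.

For the characters, the simple modules live over `ℚ(v)`, where there is no `𝐭`, so they must be
compared through `K = ℚ(v, 𝐭)`. Let `V` be the simple module at `ε` and twist `K ⊗ V`. Its highest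
weight vector gives a map from the Verma module at `-ε` over `ℚ(v)`. A proper submodule of that
Verma module has no component of weight `lam`, hence neither has the `K`-span of its image.
Untwisting that span gives a submodule of `K ⊗ V` without component of weight `lam`. Taking
coordinates along a basis of `K` reduces to `V`, where such a submodule vanishes. The map therefore
factors through the simple module at `-ε`, and its image spans the twist over `K`. This bounds each
weight multiplicity at `ε` by the one at `-ε`, and the two signs play symmetric roles.

Finiteness of the multiplicities comes from the spanning words `F_{i₁} ⋯ F_{iₙ} x`: linear
independence of the roots makes the weight determine the length of the word. -/

theorem Qv.ringHom_ext {A : Type*} [CommRing A] {f g : Qv →+* A}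
    (h : f RatFunc.X = g RatFunc.X) : f = g := by
  refine IsLocalization.ringHom_ext (nonZeroDivisors ℚ[X]) (Polynomial.ringHom_ext' ?_ ?_)
  · exact Subsingleton.elim _ _
  · simpa using h

theorem QvPi.ringHom_ext {A : Type*} [CommRing A] {f g : QvPi →+* A}
    (hv : f (vUnit QvPi : QvPi) = g (vUnit QvPi : QvPi))
    (hp : f (piUnit : QvPi) = g (piUnit : QvPi)) : f = g := by
  refine AdjoinRoot.ringHom_ext (R := Qv) ?_ hp
  exact Qv.ringHom_ext hv

theorem Qvt.ringHom_ext {A : Type*} [CommRing A] {f g : Qvt →+* A}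
    (hv : f (vUnit Qvt : Qvt) = g (vUnit Qvt : Qvt))
    (ht : f (tUnit : Qvt) = g (tUnit : Qvt)) : f = g := by
  refine AdjoinRoot.ringHom_ext (R := Qv) ?_ ht
  exact Qv.ringHom_ext hv

theorem vUnit_val (R : Type*) [CommRing R] [Algebra Qv R] :
    (vUnit R : R) = algebraMap Qv R RatFunc.X := rfl

/-- The specialization `ℚ(v)^π → R`, `π ↦ ε`. -/
noncomputable def spec (ε : ℤˣ) (R : Type*) [CommRing R] [Algebra Qv R] : QvPi →+* R :=
  (SpecAt.of ε R).symm.toRingHom.comp (SpecAt.specHom ε R)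

theorem eval₂_X_sq_sub_one (ε : ℤˣ) {R : Type*} [CommRing R] (i : Qv →+* R) :
    eval₂ i ((ε : ℤ) : R) (X ^ 2 - 1) = 0 := by
  have h : ((ε : ℤ) : R) ^ 2 = 1 := by
    rcases Int.units_eq_one_or ε with h | h <;> subst h <;> simp
  simp [h]

theorem spec_algebraMap (ε : ℤˣ) (R : Type*) [CommRing R] [Algebra Qv R] (q : Qv) :
    spec ε R (algebraMap Qv QvPi q) = algebraMap Qv R q := by
  exact AdjoinRoot.lift_of (eval₂_X_sq_sub_one ε (R := SpecAt ε R) _)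

theorem map_spec_vUnit (ε : ℤˣ) (R : Type*) [CommRing R] [Algebra Qv R] :
    Units.map (spec ε R).toMonoidHom (vUnit QvPi) = vUnit R :=
  Units.ext (spec_algebraMap ε R _)

theorem map_spec_piUnit (ε : ℤˣ) (R : Type*) [CommRing R] [Algebra Qv R] :
    Units.map (spec ε R).toMonoidHom piUnit = Units.map (Int.castRingHom R).toMonoidHom ε := by
  ext
  exact AdjoinRoot.lift_root (eval₂_X_sq_sub_one ε (R := SpecAt ε R) _)

theorem spec_comp (ε : ℤˣ) {R S : Type*} [CommRing R] [Algebra Qv R] [CommRing S] [Algebra Qv S]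
    (f : R →+* S) (hf : f.comp (algebraMap Qv R) = algebraMap Qv S) :
    f.comp (spec ε R) = spec ε S := by
  apply QvPi.ringHom_ext
  · exact (congrArg f (spec_algebraMap ε R _)).trans
      ((RingHom.congr_fun hf _).trans (spec_algebraMap ε S _).symm)
  · refine (congrArg f (congrArg Units.val (map_spec_piUnit ε R))).trans
      (Eq.trans ?_ (congrArg Units.val (map_spec_piUnit ε S)).symm)
    simp

/-! ### Quantum binomial coefficients -/

theorem map_qDiff {A B : Type*} [CommRing A] [CommRing B] (f : A →+* B) (q v : Aˣ) (l : ℤ) :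
    f (qDiff q v l) = qDiff (Units.map f.toMonoidHom q) (Units.map f.toMonoidHom v) l := by
  simp only [qDiff, map_sub, ← map_mul, ← map_zpow, Units.coe_map]
  rfl

/-- The substitution turns `πv` into `s³πv` and `v⁻¹` into `s⁻¹v⁻¹`. As `s³ = s⁻¹`, both terms of
the difference acquire the same factor. -/
theorem qDiff_twist {B : Type*} [CommRing B] {s : Bˣ} (hs : s ^ 4 = 1) (q v : Bˣ) (d : ℕ) (l : ℤ) :
    qDiff ((s ^ 2 * q) ^ d) ((s * v) ^ d) l =
      ((s ^ (-(d * l)) : Bˣ) : B) * qDiff (q ^ d) (v ^ d) l := by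
  have h4 : s ^ (4 * (d * l)) = 1 := by
    rw [zpow_mul]; norm_cast; simp [hs]
  have h3 : ((s ^ 2) ^ d * s ^ d) ^ l = s ^ (-(d * l)) := by
    have : ((s ^ 2) ^ d * s ^ d) ^ l = s ^ (4 * (d * l)) * s ^ (-(d * l)) := by
      rw [← pow_mul, ← pow_add, ← zpow_natCast, ← zpow_mul, ← zpow_add]
      congr 1; push_cast; ring
    rw [this, h4, one_mul]
  have h5 : (s ^ d) ^ (-l) = s ^ (-(d * l)) := by
    rw [← zpow_natCast, ← zpow_mul]; congr 1; ring
  simp only [qDiff, mul_sub, ← Units.val_mul]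
  congr 2
  · rw [← h3]
    simp only [mul_pow, mul_zpow]
    rw [mul_mul_mul_comm]
  · rw [mul_pow, mul_zpow, h5]

theorem RatFunc.X_pow_ne {n : ℤ} (hn : n ≠ 0) : (RatFunc.X : Qv) ^ n ≠ 1 := by
  wlog h : 0 < n generalizing n
  · intro h1
    refine this (n := -n) (by omega) (by omega) ?_
    rw [zpow_neg, h1, inv_one]
  obtain ⟨m, rfl⟩ := Int.eq_ofNat_of_zero_le h.le
  intro h1
  have h2 : algebraMap ℚ[X] Qv (X ^ m) = algebraMap ℚ[X] Qv 1 := by simpa using h1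
  have h3 := congrArg natDegree (RatFunc.algebraMap_injective ℚ h2)
  simp at h3
  omega

theorem isUnit_algebraMap_X_pow_sub (A : Type*) [CommRing A] [Algebra Qv A] {m n : ℤ} (h : m ≠ n) :
    IsUnit (((vUnit A ^ m : Aˣ) : A) - ((vUnit A ^ n : Aˣ) : A)) := by
  have h1 : ((vUnit A ^ m : Aˣ) : A) - ((vUnit A ^ n : Aˣ) : A) =
      algebraMap Qv A (RatFunc.X ^ m - RatFunc.X ^ n) := by
    simp [vUnit, ← map_zpow]
  rw [h1]
  refine IsUnit.map _ (IsUnit.mk0 _ fun h0 => ?_)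
  refine RatFunc.X_pow_ne (sub_ne_zero.mpr h) ?_
  rw [zpow_sub₀ RatFunc.X_ne_zero, sub_eq_zero.mp h0, div_self (zpow_ne_zero _ RatFunc.X_ne_zero)]

theorem piUnit_sq : piUnit ^ 2 = 1 := Units.ext root_pi_sq

/-- Multiplying by the sum with the conjugate sign removes `π`, since `π² = 1`, and leaves `v^(2dl)
- v^(-2dl)`, a nonzero element of the field `ℚ(v)`. An argument by nonvanishing alone would fail, as
`ℚ(v)^π` has zero divisors. -/
theorem isUnit_qDiff {d : ℕ} (hd : 0 < d) {l : ℤ} (hl : l ≠ 0) :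
    IsUnit (qDiff (piUnit ^ d) (vUnit QvPi ^ d) l) := by
  have key : qDiff (piUnit ^ d) (vUnit QvPi ^ d) l *
      ((((piUnit ^ d * vUnit QvPi ^ d) ^ l : QvPiˣ) : QvPi) +
        (((vUnit QvPi ^ d) ^ (-l) : QvPiˣ) : QvPi)) =
      ((vUnit QvPi ^ (2 * (d * l)) : QvPiˣ) : QvPi) -
        ((vUnit QvPi ^ (-(2 * (d * l))) : QvPiˣ) : QvPi) := by
    rw [qDiff, mul_comm, ← sq_sub_sq, ← Units.val_pow_eq_pow_val, ← Units.val_pow_eq_pow_val]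
    congr 2
    · have : ((piUnit ^ d * vUnit QvPi ^ d) ^ l) ^ 2 =
        ((piUnit ^ 2) ^ d) ^ l * vUnit QvPi ^ (2 * (d * l)) := by
        have e : vUnit QvPi ^ (2 * (d * l)) = ((vUnit QvPi ^ d) ^ l) ^ 2 := by
          rw [← zpow_natCast, ← zpow_natCast, ← zpow_mul, ← zpow_mul]; congr 1; push_cast; ring
        rw [e, mul_zpow, mul_pow, ← pow_mul, mul_comm 2 d, pow_mul]
        congr 1
        rw [← zpow_natCast, ← zpow_mul, mul_comm, zpow_mul, zpow_natCast]
      rw [this, piUnit_sq]; simp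
    · rw [← zpow_natCast, ← zpow_natCast, ← zpow_mul, ← zpow_mul]; congr 1; push_cast; ring
  refine isUnit_of_mul_isUnit_left (y := _) (key ▸ isUnit_algebraMap_X_pow_sub QvPi ?_)
  have : (d : ℤ) * l ≠ 0 := mul_ne_zero (by exact_mod_cast hd.ne') hl
  omega

theorem sum_Icc_shift (n : ℤ) (k : ℕ) :
    ∑ l ∈ Finset.Icc (n - k + 1) n, l = (∑ l ∈ Finset.Icc (1 : ℤ) k, l) + k * (n - k) := by
  have h : Finset.Icc (n - k + 1) n = (Finset.Icc (1 : ℤ) k).map (addRightEmbedding (n - k)) := by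
    rw [Finset.map_add_right_Icc]; congr 1 <;> ring
  rw [h, Finset.sum_map]
  simp [Finset.sum_add_distrib, mul_sub]

/-! ### Effect of the substitution `v ↦ s v`, `π ↦ s²π` on quantum binomials -/

section Twist

variable {B : Type*} [CommRing B] {f f' : QvPi →+* B} {s : Bˣ}

/-- The homomorphism `f'` is obtained from `f` by the substitution `v ↦ s v`, `π ↦ s² π`, where
`s⁴ = 1`. -/
structure IsTwistOf (f' f : QvPi →+* B) (s : Bˣ) : Prop where
  pow_four : s ^ 4 = 1
  map_v : Units.map f'.toMonoidHom (vUnit QvPi) = s * Units.map f.toMonoidHom (vUnit QvPi)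
  map_pi : Units.map f'.toMonoidHom piUnit = s ^ 2 * Units.map f.toMonoidHom piUnit

theorem IsTwistOf.qDiff (h : IsTwistOf f' f s) (d : ℕ) (l : ℤ) :
    f' (qDiff (piUnit ^ d) (vUnit QvPi ^ d) l) =
      ((s ^ (-(d * l)) : Bˣ) : B) * f (qDiff (piUnit ^ d) (vUnit QvPi ^ d) l) := by
  rw [map_qDiff, map_qDiff, map_pow, map_pow, map_pow, map_pow, h.map_v, h.map_pi,
    qDiff_twist h.pow_four]

theorem IsTwistOf.prod_qDiff (h : IsTwistOf f' f s) (d : ℕ) (t : Finset ℤ) :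
    f' (∏ l ∈ t, CoveringQG.qDiff (piUnit ^ d) (vUnit QvPi ^ d) l) =
      ((s ^ (-(d * ∑ l ∈ t, l)) : Bˣ) : B) *
        f (∏ l ∈ t, CoveringQG.qDiff (piUnit ^ d) (vUnit QvPi ^ d) l) := by
  rw [map_prod, map_prod, Finset.prod_congr rfl fun l _ => h.qDiff d l, Finset.prod_mul_distrib,
    ← Units.coe_prod]
  congr 2
  rw [Finset.mul_sum, ← Finset.sum_neg_distrib]
  induction t using Finset.cons_induction with
  | empty => simp
  | cons a t ha ih => rw [Finset.prod_cons, Finset.sum_cons, zpow_add, ih]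

/-- Invertibility matters: `Ring.inverse` is `0` off the units and need not commute with ring
homomorphisms there. -/
theorem IsTwistOf.inverse (_ : IsTwistOf f' f s) {x : QvPi} (hx : IsUnit x) {n : ℤ}
    (hn : f' x = ((s ^ n : Bˣ) : B) * f x) :
    f' (Ring.inverse x) = ((s ^ (-n) : Bˣ) : B) * f (Ring.inverse x) := by
  obtain ⟨u, rfl⟩ := hx
  have hu : Units.map f'.toMonoidHom u = s ^ n * Units.map f.toMonoidHom u := Units.ext hn
  have hi := congrArg (fun x => ((x⁻¹ : Bˣ) : B)) hu
  simp only [mul_inv, ← map_inv, ← zpow_neg] at hi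
  simpa using hi

/-- The `k` factors of the numerator have indices shifted by `n - k` from those of the denominator,
so the two exponents of `s` differ by `d k (n - k)`. -/
theorem IsTwistOf.qBinom (h : IsTwistOf f' f s) {d : ℕ} (hd : 0 < d) (n : ℤ) (k : ℕ) :
    f' (qBinom (piUnit ^ d) (vUnit QvPi ^ d) n k) =
      ((s ^ (-(d * (k * (n - k)))) : Bˣ) : B) * f (qBinom (piUnit ^ d) (vUnit QvPi ^ d) n k) := by
  have hu : IsUnit (∏ l ∈ Finset.Icc (1 : ℤ) k,
      CoveringQG.qDiff (piUnit ^ d) (vUnit QvPi ^ d) l) := by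
    rw [IsUnit.prod_iff]
    intro l hl
    exact isUnit_qDiff hd (by have := (Finset.mem_Icc.mp hl).1; omega)
  rw [CoveringQG.qBinom, map_mul, map_mul, h.prod_qDiff, h.inverse hu (h.prod_qDiff d _),
    sum_Icc_shift, mul_mul_mul_comm, ← Units.val_mul, ← zpow_add]
  congr 3
  ring

end Twist

/-! ### The field `ℚ(v, 𝐭)` -/

/-- A root `num / denom` in `ℚ(v)` would give `num² + denom² = 0` in `ℚ[X]`. Comparing leading
coefficients makes the negative of a nonzero rational square a rational square. -/
theorem irreducible_X_sq_add_one : Irreducible (X ^ 2 + 1 : Qv[X]) := by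
  have hd : (X ^ 2 + 1 : Qv[X]).natDegree = 2 := by compute_degree!
  rw [Polynomial.irreducible_iff_roots_eq_zero_of_degree_le_three (by omega) (by omega)]
  rw [Multiset.eq_zero_iff_forall_notMem]
  intro r hr
  have h0 : r ^ 2 + 1 = 0 := by
    have := (mem_roots'.mp hr).2
    simpa [IsRoot] using this
  have hne : algebraMap ℚ[X] Qv r.denom ≠ 0 := by
    simpa using r.denom_ne_zero
  have h1 : algebraMap ℚ[X] Qv (r.num ^ 2 + r.denom ^ 2) = 0 := by
    rw [← RatFunc.num_div_denom r] at h0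
    field_simp at h0
    simpa using h0
  have h2 : r.num ^ 2 + r.denom ^ 2 = 0 := by
    rwa [map_eq_zero_iff _ (RatFunc.algebraMap_injective ℚ)] at h1
  have h3 := congrArg leadingCoeff (eq_neg_of_add_eq_zero_left h2)
  rw [leadingCoeff_neg, leadingCoeff_pow, leadingCoeff_pow] at h3
  have h4 : r.denom.leadingCoeff ≠ 0 := by simpa using r.denom_ne_zero
  have := sq_pos_of_ne_zero h4
  nlinarith [sq_nonneg r.num.leadingCoeff]

instance : Fact (Irreducible (X ^ 2 + 1 : Qv[X])) := ⟨irreducible_X_sq_add_one⟩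

theorem Qvt.isField : IsField Qvt :=
  Field.toIsField (AdjoinRoot (X ^ 2 + 1 : Qv[X]))

instance : IsDomain Qvt := Qvt.isField.isDomain

theorem Qvt.isUnit_of_ne_zero {c : Qvt} (hc : c ≠ 0) : IsUnit c :=
  let ⟨_, h⟩ := Qvt.isField.mul_inv_cancel hc
  IsUnit.of_mul_eq_one _ h

theorem tUnit_sq : tUnit ^ 2 = -1 := Units.ext root_t_sq

theorem tUnit_inv_sq : (tUnit⁻¹) ^ 2 = -1 := by rw [inv_pow, tUnit_sq, inv_neg, inv_one]

/-- The factor `s` is algebraic over `ℚ`, so if `s v` were algebraic then `v = s⁻¹ (s v)` would be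
too. This is what lets `v ↦ s v` extend from polynomials to rational functions. -/
theorem transcendental_mul_vUnit {s : Qvtˣ} (hs : s ^ 2 = -1) :
    letI := ((algebraMap Qv Qvt).comp (algebraMap ℚ Qv)).toAlgebra
    Transcendental ℚ ((s * vUnit Qvt : Qvtˣ) : Qvt) := by
  let := ((algebraMap Qv Qvt).comp (algebraMap ℚ Qv)).toAlgebra
  intro h
  have hsa : IsAlgebraic ℚ ((s⁻¹ : Qvtˣ) : Qvt) := by
    refine ⟨X ^ 2 + 1, (by monicity! : (X ^ 2 + 1 : ℚ[X]).Monic).ne_zero, ?_⟩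
    have : (s⁻¹) ^ 2 = -1 := by rw [inv_pow, hs, inv_neg, inv_one]
    have h2 := congrArg Units.val this
    rw [Units.val_pow_eq_pow_val] at h2
    rw [map_add, map_pow, aeval_X, map_one, h2]
    simp
  have hv := hsa.mul h
  rw [← Units.val_mul, inv_mul_cancel_left, vUnit_val] at hv
  obtain ⟨p, hp, h0⟩ := hv
  have he : eval₂RingHom (algebraMap ℚ Qvt) (algebraMap Qv Qvt RatFunc.X) =
      (algebraMap Qv Qvt).comp (algebraMap ℚ[X] Qv) :=
    Polynomial.ringHom_ext' (Subsingleton.elim _ _) (by simp)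
  have h1 := (RingHom.congr_fun he p).symm.trans h0
  rw [RingHom.comp_apply, map_eq_zero] at h1
  exact hp ((map_eq_zero_iff _ (RatFunc.algebraMap_injective ℚ)).mp h1)

/-- The homomorphism `ℚ(v) → ℚ(v, 𝐭)` with `v ↦ s v`, where `s² = -1`. -/
noncomputable def rescaleBase (s : Qvtˣ) (hs : s ^ 2 = -1) : Qv →+* Qvt :=
  IsLocalization.lift (M := nonZeroDivisors ℚ[X]) (S := Qv)
    (g := eval₂RingHom ((algebraMap Qv Qvt).comp (algebraMap ℚ Qv)) ((s * vUnit Qvt : Qvtˣ) : Qvt))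
    (fun p => Qvt.isUnit_of_ne_zero fun h => nonZeroDivisors.ne_zero p.2 <| by
      let := ((algebraMap Qv Qvt).comp (algebraMap ℚ Qv)).toAlgebra
      exact (transcendental_iff.mp (transcendental_mul_vUnit hs)) _ h)

/-- The endomorphism of `ℚ(v, 𝐭)` with `v ↦ s v` and `𝐭 ↦ 𝐭`, where `s² = -1`. -/
noncomputable def rescale (s : Qvtˣ) (hs : s ^ 2 = -1) : Qvt →+* Qvt :=
  AdjoinRoot.lift (rescaleBase s hs) (tUnit : Qvt) (by
    have h := root_t_sq
    rw [eval₂_add, eval₂_pow, eval₂_X, eval₂_one]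
    exact (congrArg (· + (1 : Qvt)) h).trans (neg_add_cancel (1 : Qvt)))

theorem rescale_t (s : Qvtˣ) (hs : s ^ 2 = -1) : rescale s hs (tUnit : Qvt) = tUnit :=
  AdjoinRoot.lift_root _

theorem rescale_v (s : Qvtˣ) (hs : s ^ 2 = -1) :
    rescale s hs (vUnit Qvt : Qvt) = ((s * vUnit Qvt : Qvtˣ) : Qvt) := by
  refine (AdjoinRoot.lift_of _).trans ?_
  change rescaleBase s hs RatFunc.X = _
  rw [rescaleBase, ← RatFunc.algebraMap_X, IsLocalization.lift_eq]
  simp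

theorem map_rescale_v (s : Qvtˣ) (hs : s ^ 2 = -1) :
    Units.map (rescale s hs).toMonoidHom (vUnit Qvt) = s * vUnit Qvt :=
  Units.ext (rescale_v s hs)

theorem map_rescale_t (s : Qvtˣ) (hs : s ^ 2 = -1) :
    Units.map (rescale s hs).toMonoidHom tUnit = tUnit :=
  Units.ext (rescale_t s hs)

/-- The passage from `π = ε` to `π = -ε` is exactly multiplication of `π` by `s² = -1`. -/
theorem isTwistOf_rescale (ε : ℤˣ) (s : Qvtˣ) (hs : s ^ 2 = -1) :
    IsTwistOf ((rescale s hs).comp (spec (-ε) Qvt)) (spec ε Qvt) s where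
  pow_four := by rw [show 4 = 2 * 2 from rfl, pow_mul, hs]; simp
  map_v := by
    rw [map_spec_vUnit, ← map_rescale_v s hs]
    exact congrArg (Units.map (rescale s hs).toMonoidHom) (map_spec_vUnit (-ε) Qvt)
  map_pi := by
    rw [map_spec_piUnit, hs]
    have h := congrArg (Units.map (rescale s hs).toMonoidHom) (map_spec_piUnit (-ε) Qvt)
    refine Eq.trans ?_ (h.trans ?_)
    · rfl
    · ext; simp

variable {I : Type u₁} {Y : Type u₂} {X : Type u₃} [AddCommGroup Y] [AddCommGroup X]
variable (D : SuperRootDatum I Y X)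

/-! ### Representations of the defining relations -/

/-- The coefficients of the quantum Serre relations. -/
noncomputable def serreCoeff (i j : I) (k : ℕ) : QvPi :=
  (-1 : QvPi) ^ k *
    (piUnit : QvPi) ^ (k.choose 2 * (D.p i : ℕ) + k * (D.p i : ℕ) * (D.p j : ℕ)) *
    qBinom (D.pii i) (D.vi i) (D.b i j) k

open Gen in
/-- The elements `x g` satisfy the defining relations of the covering quantum group, where the
scalars act through the homomorphism `f`. -/
structure CovRel {A : Type*} [Ring A] (f : QvPi →+* A) (x : Gen I Y → A) : Prop where
  J_mul (μ ν : Y) : x (J μ) * x (J ν) = x (J (μ + ν))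
  K_mul (μ ν : Y) : x (K μ) * x (K ν) = x (K (μ + ν))
  K_zero : x (K 0) = 1
  J_zero : x (J 0) = 1
  J_sq (ν : Y) : x (J ν) ^ 2 = 1
  J_K (μ ν : Y) : x (J μ) * x (K ν) = x (K ν) * x (J μ)
  J_E (μ : Y) (i : I) : x (J μ) * x (E i) =
    f ((piUnit ^ D.pairing μ (D.root i) : QvPiˣ) : QvPi) * (x (E i) * x (J μ))
  J_F (μ : Y) (i : I) : x (J μ) * x (F i) =
    f ((piUnit ^ (-D.pairing μ (D.root i)) : QvPiˣ) : QvPi) * (x (F i) * x (J μ))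
  K_E (μ : Y) (i : I) : x (K μ) * x (E i) =
    f ((vUnit QvPi ^ D.pairing μ (D.root i) : QvPiˣ) : QvPi) * (x (E i) * x (K μ))
  K_F (μ : Y) (i : I) : x (K μ) * x (F i) =
    f ((vUnit QvPi ^ (-D.pairing μ (D.root i)) : QvPiˣ) : QvPi) * (x (F i) * x (K μ))
  E_F_same (i : I) :
    x (E i) * x (F i) - f ((piUnit : QvPi) ^ ((D.p i : ℕ) * (D.p i : ℕ))) * (x (F i) * x (E i)) =
      f (Ring.inverse (qDiff (D.pii i) (D.vi i) 1)) *
        (x (J (D.d i • D.coroot i)) * x (K (D.d i • D.coroot i)) -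
          x (K (-(D.d i • D.coroot i))))
  E_F_ne (i j : I) (hij : i ≠ j) :
    x (E i) * x (F j) -
      f ((piUnit : QvPi) ^ ((D.p i : ℕ) * (D.p j : ℕ))) * (x (F j) * x (E i)) = 0
  serre_E (i j : I) (hij : i ≠ j) : ∑ k ∈ Finset.range (D.b i j + 1),
    f (serreCoeff D i j k) * (x (E i) ^ (D.b i j - k) * x (E j) * x (E i) ^ k) = 0
  serre_F (i j : I) (hij : i ≠ j) : ∑ k ∈ Finset.range (D.b i j + 1),
    f (serreCoeff D i j k) * (x (F i) ^ (D.b i j - k) * x (F j) * x (F i) ^ k) = 0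

variable {D} in
theorem CovRel.map {A B : Type*} [Ring A] [Ring B] {f : QvPi →+* A} {x : Gen I Y → A}
    (h : CovRel D f x) (g : A →+* B) : CovRel D (g.comp f) (fun y => g (x y)) where
  J_mul μ ν := by simpa using congrArg g (h.J_mul μ ν)
  K_mul μ ν := by simpa using congrArg g (h.K_mul μ ν)
  K_zero := by simpa using congrArg g h.K_zero
  J_zero := by simpa using congrArg g h.J_zero
  J_sq ν := by simpa using congrArg g (h.J_sq ν)
  J_K μ ν := by simpa using congrArg g (h.J_K μ ν)
  J_E μ i := by simpa only [RingHom.comp_apply, map_mul] using congrArg g (h.J_E μ i)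
  J_F μ i := by simpa only [RingHom.comp_apply, map_mul] using congrArg g (h.J_F μ i)
  K_E μ i := by simpa only [RingHom.comp_apply, map_mul] using congrArg g (h.K_E μ i)
  K_F μ i := by simpa only [RingHom.comp_apply, map_mul] using congrArg g (h.K_F μ i)
  E_F_same i := by simpa only [RingHom.comp_apply, map_mul, map_sub] using congrArg g (h.E_F_same i)
  E_F_ne i j hij := by
    simpa only [RingHom.comp_apply, map_mul, map_sub, map_zero] using congrArg g (h.E_F_ne i j hij)
  serre_E i j hij := by
    simpa only [RingHom.comp_apply, map_mul, map_sum, map_pow, map_zero] using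
      congrArg g (h.serre_E i j hij)
  serre_F i j hij := by
    simpa only [RingHom.comp_apply, map_mul, map_sum, map_pow, map_zero] using
      congrArg g (h.serre_F i j hij)

/-- The quotient map from the free algebra. -/
noncomputable def CovU.mk : FreeAlg I Y →ₐ[QvPi] CovU D := RingQuot.mkAlgHom QvPi (Rel D)

theorem CovU.mk_gen (y : Gen I Y) : CovU.mk D (gen y) = CovU.of D y := rfl

theorem CovU.mk_eq {a b : FreeAlg I Y} (h : Rel D a b) : CovU.mk D a = CovU.mk D b :=
  RingQuot.mkAlgHom_rel QvPi h

theorem CovU.mk_surjective : Function.Surjective (CovU.mk D) :=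
  RingQuot.mkAlgHom_surjective QvPi (Rel D)

theorem map_serre {A B : Type*} [Ring A] [Algebra QvPi A] [Ring B] [Algebra QvPi B]
    (g : A →ₐ[QvPi] B) (i j : I) (x y : A) :
    g (serre D i j x y) = ∑ k ∈ Finset.range (D.b i j + 1),
      algebraMap QvPi B (serreCoeff D i j k) * (g x ^ (D.b i j - k) * g y * g x ^ k) := by
  simp only [serre, map_sum, map_smul, map_mul, map_pow]
  simp only [Algebra.smul_def, serreCoeff]

theorem CovU.covRel : CovRel D (algebraMap QvPi (CovU D)) (CovU.of D) := by
  have h := fun {a b : FreeAlg I Y} (h : Rel D a b) => CovU.mk_eq D h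
  constructor
  case J_mul => intro μ ν; simpa only [CovU.mk_gen, map_mul] using h (.J_mul μ ν)
  case K_mul => intro μ ν; simpa only [CovU.mk_gen, map_mul] using h (.K_mul μ ν)
  case K_zero => simpa only [CovU.mk_gen, map_one] using h .K_zero
  case J_zero => simpa only [CovU.mk_gen, map_one] using h .J_zero
  case J_sq => intro ν; simpa only [CovU.mk_gen, map_one, map_pow] using h (.J_sq ν)
  case J_K => intro μ ν; simpa only [CovU.mk_gen, map_mul] using h (.J_K μ ν)
  case J_E =>
    intro μ i
    simpa only [CovU.mk_gen, map_mul, map_smul, Algebra.smul_def, AlgHom.commutes] using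
      h (.J_E μ i)
  case J_F =>
    intro μ i
    simpa only [CovU.mk_gen, map_mul, map_smul, Algebra.smul_def, AlgHom.commutes] using
      h (.J_F μ i)
  case K_E =>
    intro μ i
    simpa only [CovU.mk_gen, map_mul, map_smul, Algebra.smul_def, AlgHom.commutes] using
      h (.K_E μ i)
  case K_F =>
    intro μ i
    simpa only [CovU.mk_gen, map_mul, map_smul, Algebra.smul_def, AlgHom.commutes] using
      h (.K_F μ i)
  case E_F_same =>
    intro i
    simpa only [CovU.mk_gen, map_mul, map_sub, map_smul, Algebra.smul_def, AlgHom.commutes] using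
      h (.E_F_same i)
  case E_F_ne =>
    intro i j hij
    simpa only [CovU.mk_gen, map_mul, map_sub, map_smul, map_zero, Algebra.smul_def, AlgHom.commutes] using
      h (.E_F_ne i j hij)
  case serre_E =>
    intro i j hij
    have := h (.serre_E i j hij)
    rwa [map_serre, map_zero, CovU.mk_gen, CovU.mk_gen] at this
  case serre_F =>
    intro i j hij
    have := h (.serre_F i j hij)
    rwa [map_serre, map_zero, CovU.mk_gen, CovU.mk_gen] at this

variable {D} in
theorem CovRel.lift_eq {A : Type*} [Ring A] [Algebra QvPi A] {x : Gen I Y → A}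
    (h : CovRel D (algebraMap QvPi A) x) {a b : FreeAlg I Y} (hab : Rel D a b) :
    FreeAlgebra.lift QvPi x a = FreeAlgebra.lift QvPi x b := by
  have hg : ∀ y, FreeAlgebra.lift QvPi x (gen y) = x y := fun y => FreeAlgebra.lift_ι_apply x y
  cases hab with
  | J_mul μ ν => simpa only [map_mul, hg] using h.J_mul μ ν
  | K_mul μ ν => simpa only [map_mul, hg] using h.K_mul μ ν
  | K_zero => simpa only [map_one, hg] using h.K_zero
  | J_zero => simpa only [map_one, hg] using h.J_zero
  | J_sq ν => simpa only [map_one, map_pow, hg] using h.J_sq ν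
  | J_K μ ν => simpa only [map_mul, hg] using h.J_K μ ν
  | J_E μ i => simpa only [map_mul, map_smul, hg, Algebra.smul_def, AlgHom.commutes] using h.J_E μ i
  | J_F μ i => simpa only [map_mul, map_smul, hg, Algebra.smul_def, AlgHom.commutes] using h.J_F μ i
  | K_E μ i => simpa only [map_mul, map_smul, hg, Algebra.smul_def, AlgHom.commutes] using h.K_E μ i
  | K_F μ i => simpa only [map_mul, map_smul, hg, Algebra.smul_def, AlgHom.commutes] using h.K_F μ i
  | E_F_same i =>
    simpa only [map_mul, map_sub, map_smul, hg, Algebra.smul_def, AlgHom.commutes] using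
      h.E_F_same i
  | E_F_ne i j hij =>
    simpa only [map_mul, map_sub, map_smul, map_zero, hg, Algebra.smul_def, AlgHom.commutes] using
      h.E_F_ne i j hij
  | serre_E i j hij => simpa only [map_serre, map_zero, hg] using h.serre_E i j hij
  | serre_F i j hij => simpa only [map_serre, map_zero, hg] using h.serre_F i j hij

variable {D} in
/-- The homomorphism `𝐔 → A` given by elements of a `ℚ(v)^π`-algebra which satisfy the defining
relations. -/
noncomputable def CovRel.lift {A : Type*} [Ring A] [Algebra QvPi A] {x : Gen I Y → A}
    (h : CovRel D (algebraMap QvPi A) x) : CovU D →ₐ[QvPi] A :=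
  RingQuot.liftAlgHom QvPi ⟨FreeAlgebra.lift QvPi x, fun _ _ hab => h.lift_eq hab⟩

variable {D} in
theorem CovRel.lift_of {A : Type*} [Ring A] [Algebra QvPi A] {x : Gen I Y → A}
    (h : CovRel D (algebraMap QvPi A) x) (y : Gen I Y) : h.lift (CovU.of D y) = x y := by
  refine (RingQuot.liftAlgHom_mkAlgHom_apply QvPi _ _ _).trans (FreeAlgebra.lift_ι_apply x y)

/-! ### Generators and the universal property of the specialized algebra -/

section Spec

variable (ε : ℤˣ) (R : Type u₄) [CommRing R] [Algebra Qv R]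

/-- The scalars as a ring homomorphism. -/
noncomputable def SpecU.scalarHom : R →+* SpecU D ε R :=
  (algebraMap (SpecAt ε R) (SpecU D ε R)).comp (SpecAt.of ε R).toRingHom

theorem SpecU.scalarHom_apply (c : R) : SpecU.scalarHom D ε R c = SpecU.scalar D ε R c := rfl

theorem SpecU.algebraMap_eq (a : QvPi) :
    algebraMap QvPi (SpecU D ε R) a = SpecU.scalar D ε R (spec ε R a) := by
  rw [IsScalarTower.algebraMap_apply QvPi (SpecAt ε R) (SpecU D ε R)]
  rfl

theorem SpecU.scalar_commute (c : R) (u : SpecU D ε R) : Commute (SpecU.scalar D ε R c) u :=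
  Algebra.commutes _ _

/-- The inclusion of `𝐔`. -/
noncomputable def SpecU.ofCovU : CovU D →+* SpecU D ε R :=
  (Algebra.TensorProduct.includeRight :
    CovU D →ₐ[QvPi] SpecAt ε R ⊗[QvPi] CovU D).toRingHom

theorem SpecU.ofCovU_algebraMap (a : QvPi) :
    SpecU.ofCovU D ε R (algebraMap QvPi (CovU D) a) = algebraMap QvPi (SpecU D ε R) a :=
  (Algebra.TensorProduct.includeRight :
    CovU D →ₐ[QvPi] SpecAt ε R ⊗[QvPi] CovU D).commutes a

theorem SpecU.covRel : CovRel D (algebraMap QvPi (SpecU D ε R)) (SpecU.of D ε R) := by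
  have h := (CovU.covRel D).map (SpecU.ofCovU D ε R)
  have he : (SpecU.ofCovU D ε R).comp (algebraMap QvPi (CovU D)) =
      algebraMap QvPi (SpecU D ε R) := RingHom.ext fun a => SpecU.ofCovU_algebraMap D ε R a
  rwa [he] at h

variable {D ε R}

/-- As a ring, `R_ε ⊗ 𝐔` is generated by the scalars and the symbols. Linearity and stability
statements are thereby reduced to these. -/
theorem SpecU.induction {P : SpecU D ε R → Prop} (hs : ∀ c, P (SpecU.scalar D ε R c))
    (ho : ∀ y, P (SpecU.of D ε R y)) (ha : ∀ u u', P u → P u' → P (u + u'))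
    (hm : ∀ u u', P u → P u' → P (u * u')) (u : SpecU D ε R) : P u := by
  have hcov : ∀ a : CovU D, P (SpecU.ofCovU D ε R a) := by
    intro a
    obtain ⟨b, rfl⟩ := CovU.mk_surjective D a
    induction b using FreeAlgebra.induction with
    | grade0 r =>
      rw [AlgHom.commutes, SpecU.ofCovU_algebraMap, SpecU.algebraMap_eq]
      exact hs _
    | grade1 y => exact ho y
    | mul a b h1 h2 => rw [map_mul, map_mul]; exact hm _ _ h1 h2
    | add a b h1 h2 => rw [map_add, map_add]; exact ha _ _ h1 h2
  refine TensorProduct.induction_on (motive := P) u ?_ ?_ ha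
  · have := hs 0
    rwa [← SpecU.scalarHom_apply, map_zero] at this
  · intro c a
    have h := hm _ _ (hs ((SpecAt.of ε R).symm c)) (hcov a)
    have he : SpecU.scalar D ε R ((SpecAt.of ε R).symm c) * SpecU.ofCovU D ε R a =
        (c ⊗ₜ[QvPi] a : SpecAt ε R ⊗[QvPi] CovU D) := by
      refine (Algebra.TensorProduct.tmul_mul_tmul (R := QvPi) c 1 1 a).trans ?_
      rw [mul_one, one_mul]
    rwa [he] at h

section Lift

variable {A : Type*} [Ring A] {ρ : R →+* A} {x : Gen I Y → A}

theorem SpecU.exists_lift_of_algebra [Algebra (SpecAt ε R) A]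
    (h : CovRel D ((algebraMap (SpecAt ε R) A).comp (SpecAt.specHom ε R)) x) :
    ∃ g : SpecU D ε R →+* A, (∀ c, g (SpecU.scalar D ε R c) = algebraMap (SpecAt ε R) A c) ∧
      ∀ y, g (SpecU.of D ε R y) = x y := by
  let : Algebra QvPi A := Algebra.compHom A (SpecAt.specHom ε R)
  have : IsScalarTower QvPi (SpecAt ε R) A := .of_algebraMap_eq fun _ => rfl
  let g : SpecAt ε R ⊗[QvPi] CovU D →ₐ[SpecAt ε R] A :=
    Algebra.TensorProduct.lift (Algebra.ofId _ _) (CovRel.lift h) fun c _ => Algebra.commutes c _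
  refine ⟨g.toRingHom, fun c => g.commutes c, fun y => ?_⟩
  refine (Algebra.TensorProduct.lift_tmul _ _ _ _ _).trans ?_
  rw [map_one, one_mul]
  exact CovRel.lift_of h y

/-- The target need not be an `R`-algebra: `ρ` only has to commute with the chosen elements, as for
`AddMonoid.End` of a module. Everything happens inside the centralizer of the range of `ρ`, where
`ρ` becomes central and the tensor product can be mapped out of. -/
theorem SpecU.exists_lift (h : CovRel D (ρ.comp (spec ε R)) x)
    (hc : ∀ c y, Commute (ρ c) (x y)) :
    ∃ g : SpecU D ε R →+* A, (∀ c, g (SpecU.scalar D ε R c) = ρ c) ∧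
      ∀ y, g (SpecU.of D ε R y) = x y := by
  let C := Subring.centralizer (Set.range ρ)
  have hρ : ∀ c, ρ c ∈ C := by
    rintro c
    rw [Subring.mem_centralizer_iff]
    rintro _ ⟨c', rfl⟩
    rw [← map_mul, ← map_mul, mul_comm]
  have hx : ∀ y, x y ∈ C := by
    intro y
    rw [Subring.mem_centralizer_iff]
    rintro _ ⟨c', rfl⟩
    exact hc c' y
  let ρ' : SpecAt ε R →+* C := (ρ.comp (SpecAt.of ε R).symm.toRingHom).codRestrict C fun c => hρ c
  let : Algebra (SpecAt ε R) C := ρ'.toAlgebra' fun c a =>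
    Subtype.ext (Subring.mem_centralizer_iff.mp a.2 _ ⟨_, rfl⟩)
  have h' : CovRel D ((algebraMap (SpecAt ε R) C).comp (SpecAt.specHom ε R))
      (fun y => (⟨x y, hx y⟩ : C)) := by
    constructor
    case J_mul => intro μ ν; exact Subtype.ext (h.J_mul μ ν)
    case K_mul => intro μ ν; exact Subtype.ext (h.K_mul μ ν)
    case K_zero => exact Subtype.ext h.K_zero
    case J_zero => exact Subtype.ext h.J_zero
    case J_sq => intro ν; exact Subtype.ext (h.J_sq ν)
    case J_K => intro μ ν; exact Subtype.ext (h.J_K μ ν)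
    case J_E => intro μ i; exact Subtype.ext (h.J_E μ i)
    case J_F => intro μ i; exact Subtype.ext (h.J_F μ i)
    case K_E => intro μ i; exact Subtype.ext (h.K_E μ i)
    case K_F => intro μ i; exact Subtype.ext (h.K_F μ i)
    case E_F_same => intro i; exact Subtype.ext (h.E_F_same i)
    case E_F_ne => intro i j hij; exact Subtype.ext (h.E_F_ne i j hij)
    case serre_E =>
      intro i j hij
      apply Subtype.ext
      rw [AddSubmonoidClass.coe_finsetSum]
      exact h.serre_E i j hij
    case serre_F =>
      intro i j hij
      apply Subtype.ext
      rw [AddSubmonoidClass.coe_finsetSum]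
      exact h.serre_F i j hij
  obtain ⟨g, hg, hg'⟩ := SpecU.exists_lift_of_algebra h'
  exact ⟨C.subtype.comp g, fun c => congrArg Subtype.val (hg c),
    fun y => congrArg Subtype.val (hg' y)⟩

/-- The homomorphism from the specialization given by a homomorphism on scalars and elements which
satisfy the defining relations. -/
noncomputable def SpecU.lift (h : CovRel D (ρ.comp (spec ε R)) x)
    (hc : ∀ c y, Commute (ρ c) (x y)) : SpecU D ε R →+* A :=
  (SpecU.exists_lift h hc).choose

theorem SpecU.lift_scalar (h : CovRel D (ρ.comp (spec ε R)) x)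
    (hc : ∀ c y, Commute (ρ c) (x y)) (c : R) :
    SpecU.lift h hc (SpecU.scalar D ε R c) = ρ c :=
  (SpecU.exists_lift h hc).choose_spec.1 c

theorem SpecU.lift_of (h : CovRel D (ρ.comp (spec ε R)) x)
    (hc : ∀ c y, Commute (ρ c) (x y)) (y : Gen I Y) :
    SpecU.lift h hc (SpecU.of D ε R y) = x y :=
  (SpecU.exists_lift h hc).choose_spec.2 y

end Lift

end Spec

/-! ### Weight spaces -/

section WeightTheory

variable {I : Type u₁} {Y : Type u₂} {X : Type u₃} [AddCommGroup Y] [AddCommGroup X]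
variable {D : SuperRootDatum I Y X} {ε : ℤˣ} {R : Type u₄} [CommRing R] [Algebra Qv R]
variable {M : Type*} [AddCommGroup M] [Module (SpecU D ε R) M]
variable {N : Type*} [AddCommGroup N] [Module (SpecU D ε R) N]

theorem scalar_smul_smul (c c' : R) (m : M) :
    SpecU.scalar D ε R c • SpecU.scalar D ε R c' • m = SpecU.scalar D ε R (c * c') • m := by
  rw [smul_smul, ← SpecU.scalarHom_apply, ← SpecU.scalarHom_apply, ← map_mul,
    SpecU.scalarHom_apply]

theorem smul_scalar_smul (u : SpecU D ε R) (c : R) (m : M) :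
    u • SpecU.scalar D ε R c • m = SpecU.scalar D ε R c • u • m := by
  rw [smul_smul, smul_smul, (SpecU.scalar_commute D ε R c u).eq]

theorem scalar_one_smul (m : M) : SpecU.scalar D ε R 1 • m = m := by
  rw [← SpecU.scalarHom_apply, map_one, one_smul]

theorem scalar_zero_smul (m : M) : SpecU.scalar D ε R 0 • m = 0 := by
  rw [← SpecU.scalarHom_apply, map_zero, zero_smul]

theorem scalar_smul_mem {lam : X} {m : M} (c : R) (hm : m ∈ weightSpace D ε R M lam) :
    SpecU.scalar D ε R c • m ∈ weightSpace D ε R M lam := fun ν => by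
  have h := hm ν
  constructor
  · rw [smul_scalar_smul, h.1, smul_scalar_smul]
  · rw [smul_scalar_smul, h.2, smul_scalar_smul]

theorem algebraMap_smul_smul (u : SpecU D ε R) (a b : QvPi) (m : M) :
    algebraMap QvPi (SpecU D ε R) a • u • algebraMap QvPi (SpecU D ε R) b • m =
      algebraMap QvPi (SpecU D ε R) (b * a) • u • m := by
  rw [mul_comm, map_mul, mul_smul, SpecU.algebraMap_eq D ε R b, smul_scalar_smul]

theorem E_smul_mem {lam : X} {m : M} (i : I) (hm : m ∈ weightSpace D ε R M lam) :
    SpecU.of D ε R (.E i) • m ∈ weightSpace D ε R M (lam + D.root i) := fun ν => by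
  have h := hm ν
  have hK := congrArg (· • m) ((SpecU.covRel D ε R).K_E ν i)
  have hJ := congrArg (· • m) ((SpecU.covRel D ε R).J_E ν i)
  simp only [mul_smul, h.1, h.2] at hK hJ
  rw [hK, hJ, map_add, zpow_add, zpow_add]
  simp only [algebraMap_smul_smul, Units.val_mul, and_self]

theorem F_smul_mem {lam : X} {m : M} (i : I) (hm : m ∈ weightSpace D ε R M lam) :
    SpecU.of D ε R (.F i) • m ∈ weightSpace D ε R M (lam - D.root i) := fun ν => by
  have h := hm ν
  have hK := congrArg (· • m) ((SpecU.covRel D ε R).K_F ν i)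
  have hJ := congrArg (· • m) ((SpecU.covRel D ε R).J_F ν i)
  simp only [mul_smul, h.1, h.2] at hK hJ
  rw [hK, hJ, sub_eq_add_neg, map_add, map_neg, zpow_add, zpow_add]
  simp only [algebraMap_smul_smul, Units.val_mul, and_self]

theorem map_mem_weightSpace (g : M →ₗ[SpecU D ε R] N) {lam : X} {m : M}
    (hm : m ∈ weightSpace D ε R M lam) : g m ∈ weightSpace D ε R N lam := fun ν => by
  have h := hm ν
  exact ⟨by rw [← map_smul, h.1, map_smul], by rw [← map_smul, h.2, map_smul]⟩

theorem SuperRootDatum.pairing_ext (D : SuperRootDatum I Y X) {lam μ : X}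
    (h : ∀ ν, D.pairing ν lam = D.pairing ν μ) : lam = μ := by
  have := D.perfect
  refine (LinearMap.IsPerfPair.bijective_right D.pairing).1 (LinearMap.ext fun ν => ?_)
  exact h ν

-- The operators `K_ν` already separate weights. They commute and are `ℚ(v)`-linear, and `M_lam`
-- lies in their joint eigenspace for `ν ↦ v^⟨ν,lam⟩`. These characters are distinct because the
-- pairing is perfect and `v` is not a root of unity. Working over the field `ℚ(v)` makes the result
-- valid for every coefficient ring `R`.
variable (D ε R M) in
theorem iSupIndep_weightSpace : iSupIndep (weightSpace D ε R M) := by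
  let φ : Qv →+* SpecU D ε R := (algebraMap QvPi (SpecU D ε R)).comp (algebraMap Qv QvPi)
  let : Module Qv M := Module.compHom M φ
  have hφ : ∀ (c : Qv) (m : M), c • m = algebraMap QvPi (SpecU D ε R) (algebraMap Qv QvPi c) • m :=
    fun _ _ => rfl
  let k : Y → Module.End Qv M := fun ν =>
    { toFun := fun m => SpecU.of D ε R (.K ν) • m
      map_add' := smul_add _
      map_smul' := fun c m => by
        simp only [hφ, SpecU.algebraMap_eq, smul_scalar_smul, RingHom.id_apply] }
  have hk : ∀ ν ν', Commute (k ν) (k ν') := fun ν ν' => by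
    ext m
    have h1 := (SpecU.covRel D ε R).K_mul ν ν'
    have h2 := (SpecU.covRel D ε R).K_mul ν' ν
    rw [add_comm, ← h1] at h2
    have h3 := congrArg (· • m) h2.symm
    simp only [mul_smul] at h3
    exact h3
  have hind := Module.End.independent_iInf_maxGenEigenspace_of_forall_mapsTo k
    fun i j μ => Module.End.mapsTo_maxGenEigenspace_of_comm (hk j i) μ
  let χ : X → Y → Qv := fun lam ν => RatFunc.X ^ D.pairing ν lam
  have hχ : Function.Injective χ := by
    intro lam μ h
    refine D.pairing_ext fun ν => ?_
    by_contra hne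
    refine RatFunc.X_pow_ne (sub_ne_zero.mpr hne) ?_
    have h' : (RatFunc.X : Qv) ^ D.pairing ν lam = RatFunc.X ^ D.pairing ν μ := congrFun h ν
    rw [zpow_sub₀ RatFunc.X_ne_zero, h', div_self (zpow_ne_zero _ RatFunc.X_ne_zero)]
  have hind' := hind.comp hχ
  have hle : ∀ lam, weightSpace D ε R M lam ≤
      (⨅ ν, (k ν).maxGenEigenspace (χ lam ν)).toAddSubgroup := by
    intro lam m hm
    change m ∈ ⨅ ν, (k ν).maxGenEigenspace (χ lam ν)
    rw [Submodule.mem_iInf]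
    intro ν
    rw [Module.End.mem_maxGenEigenspace]
    refine ⟨1, ?_⟩
    rw [pow_one, LinearMap.sub_apply, sub_eq_zero]
    refine (hm ν).1.trans ?_
    change _ = χ lam ν • m
    rw [hφ]
    congr 2
    simp only [vUnit, χ, ← map_zpow, Units.coe_map, Units.val_zpow_eq_zpow_val, Units.val_mk0]
    rfl
  have h3 : iSupIndep fun lam => (⨅ ν, (k ν).maxGenEigenspace (χ lam ν)).toAddSubgroup := by
    classical
    rw [iSupIndep_iff_dfinsuppSumAddHom_injective]
    exact hind'.dfinsupp_lsum_injective
  exact h3.mono hle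

/-- Independence of the weight spaces is automatic, so only spanning has to be checked. -/
theorem isWeightModule_iff : IsWeightModule D ε R M ↔ ⨆ lam, weightSpace D ε R M lam = ⊤ := by
  classical
  have hsup : ⨆ lam, weightSpace D ε R M lam =
      (DirectSum.coeAddMonoidHom (weightSpace D ε R M)).range := by
    refine le_antisymm (iSup_le fun lam m hm => ⟨_, DirectSum.coeAddMonoidHom_of _ lam ⟨m, hm⟩⟩) ?_
    rintro _ ⟨x, rfl⟩
    induction x using DirectSum.induction_on with
    | zero => rw [map_zero]; exact zero_mem _
    | of lam m =>
      rw [DirectSum.coeAddMonoidHom_of]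
      exact AddSubgroup.mem_iSup_of_mem lam m.2
    | add x y hx hy => rw [map_add]; exact add_mem hx hy
  rw [hsup, AddMonoidHom.range_eq_top]
  constructor
  · intro h; convert h.2
  · intro h
    have hi : Function.Injective (DirectSum.coeAddMonoidHom (weightSpace D ε R M)) :=
      (iSupIndep_weightSpace D ε R M).dfinsuppSumAddHom_injective
    have h' : DirectSum.IsInternal (weightSpace D ε R M) := ⟨hi, h⟩
    rw [IsWeightModule]
    convert h'

theorem IsWeightModule.induction (h : IsWeightModule D ε R M) {P : M → Prop} (h0 : P 0)
    (hw : ∀ lam, ∀ m ∈ weightSpace D ε R M lam, P m) (ha : ∀ m m', P m → P m' → P (m + m'))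
    (m : M) : P m := by
  have hm : m ∈ ⨆ lam, weightSpace D ε R M lam := by
    rw [isWeightModule_iff.mp h]; trivial
  exact AddSubgroup.iSup_induction (weightSpace D ε R M) (C := P) hm hw h0 ha

theorem IsWeightModule.hom_ext {A : Type*} [AddMonoid A] (h : IsWeightModule D ε R M)
    {f g : M →+ A} (hw : ∀ lam, ∀ m ∈ weightSpace D ε R M lam, f m = g m) : f = g := by
  ext m
  induction m using h.induction with
  | h0 => rw [map_zero, map_zero]
  | hw lam m hm => exact hw lam m hm
  | ha m m' h h' => rw [map_add, map_add, h, h']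

theorem IsWeightModule.of_surjective (h : IsWeightModule D ε R M) {g : M →ₗ[SpecU D ε R] N}
    (hg : Function.Surjective g) : IsWeightModule D ε R N := by
  rw [isWeightModule_iff, eq_top_iff]
  rintro n -
  obtain ⟨m, rfl⟩ := hg n
  induction m using h.induction with
  | h0 => rw [map_zero]; exact zero_mem _
  | hw lam m hm => exact AddSubgroup.mem_iSup_of_mem lam (map_mem_weightSpace g hm)
  | ha m m' h h' => rw [map_add]; exact add_mem h h'

/-! ### Diagonal operators -/

theorem IsWeightModule.exists_diag (h : IsWeightModule D ε R M) (χ : X → R) :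
    ∃ T : M →+ M, ∀ lam, ∀ m ∈ weightSpace D ε R M lam, T m = SpecU.scalar D ε R (χ lam) • m := by
  classical
  have h' : DirectSum.IsInternal (weightSpace D ε R M) := by
    rw [IsWeightModule] at h; convert h
  let e := AddEquiv.ofBijective _ h'
  refine ⟨(DirectSum.toAddMonoid fun lam =>
    (DistribSMul.toAddMonoidHom M (SpecU.scalar D ε R (χ lam))).comp
      (weightSpace D ε R M lam).subtype).comp e.symm.toAddMonoidHom, fun lam m hm => ?_⟩
  have he : e.symm m = DirectSum.of (fun lam => weightSpace D ε R M lam) lam ⟨m, hm⟩ := by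
    rw [AddEquiv.symm_apply_eq]
    exact (DirectSum.coeAddMonoidHom_of (weightSpace D ε R M) lam ⟨m, hm⟩).symm
  change DirectSum.toAddMonoid _ (e.symm m) = _
  rw [he, DirectSum.toAddMonoid_of]
  rfl

variable (D ε R M) in
open Classical in
/-- The operator on a weight module which acts on the weight space `M_lam` as the scalar `χ lam`
(and `0` on a module which is not a weight module). -/
noncomputable def diag (χ : X → R) : M →+ M :=
  if h : IsWeightModule D ε R M then (h.exists_diag χ).choose else 0

theorem IsWeightModule.diag_apply (h : IsWeightModule D ε R M) (χ : X → R) {lam : X} {m : M}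
    (hm : m ∈ weightSpace D ε R M lam) :
    diag D ε R M χ m = SpecU.scalar D ε R (χ lam) • m := by
  rw [diag, dif_pos h]
  exact (h.exists_diag χ).choose_spec lam m hm

/-- Both sides are additive, so it suffices to compare them on weight vectors. Allowing different
algebras on the two sides makes this serve linear maps, the twist, base change and coordinate maps
alike. -/
theorem IsWeightModule.map_diag {ε' : ℤˣ} {R' : Type*} [CommRing R'] [Algebra Qv R'] {M' : Type*}
    [AddCommGroup M'] [Module (SpecU D ε' R') M'] (h : IsWeightModule D ε R M)
    (h' : IsWeightModule D ε' R' M') (g : M →+ M')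
    (hg : ∀ lam, ∀ m ∈ weightSpace D ε R M lam, g m ∈ weightSpace D ε' R' M' lam)
    {χ : X → R} {χ' : X → R'} (hχ : ∀ lam, ∀ m ∈ weightSpace D ε R M lam,
      g (SpecU.scalar D ε R (χ lam) • m) = SpecU.scalar D ε' R' (χ' lam) • g m) (m : M) :
    g (diag D ε R M χ m) = diag D ε' R' M' χ' (g m) := by
  have : g.comp (diag D ε R M χ) = (diag D ε' R' M' χ').comp g := h.hom_ext fun lam m hm => by
    simp only [AddMonoidHom.comp_apply]
    rw [h.diag_apply χ hm, h'.diag_apply χ' (hg lam m hm), hχ lam m hm]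
  exact DFunLike.congr_fun this m

theorem IsWeightModule.linearMap_diag (h : IsWeightModule D ε R M) (h' : IsWeightModule D ε R N)
    (g : M →ₗ[SpecU D ε R] N) (χ : X → R) (m : M) :
    g (diag D ε R M χ m) = diag D ε R N χ (g m) :=
  h.map_diag h' g.toAddMonoidHom (fun _ _ hm => map_mem_weightSpace g hm)
    (fun _ _ _ => map_smul g _ _) m

theorem IsWeightModule.scalar_diag (h : IsWeightModule D ε R M) (c : R) (χ : X → R) (m : M) :
    SpecU.scalar D ε R c • diag D ε R M χ m = diag D ε R M χ (SpecU.scalar D ε R c • m) :=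
  h.map_diag h (DistribSMul.toAddMonoidHom M (SpecU.scalar D ε R c))
    (fun _ _ hm => scalar_smul_mem c hm) (fun _ _ _ => smul_scalar_smul _ _ _) m

/-- The quotient by `P` is again a weight module, and the quotient map commutes with diagonal
operators. In particular a submodule contains the weight components of its elements. -/
theorem IsWeightModule.diag_mem (h : IsWeightModule D ε R M) (P : Submodule (SpecU D ε R) M)
    (χ : X → R) {m : M} (hm : m ∈ P) : diag D ε R M χ m ∈ P := by
  rw [← Submodule.Quotient.mk_eq_zero] at hm ⊢
  have h' : IsWeightModule D ε R (M ⧸ P) := h.of_surjective P.mkQ_surjective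
  have := h.linearMap_diag h' P.mkQ χ m
  rw [Submodule.mkQ_apply, Submodule.mkQ_apply, hm, map_zero] at this
  exact this

variable (D ε R M) in
open Classical in
/-- The projection of a weight module onto the weight space `M_lam`. -/
noncomputable def weightProj (lam : X) : M →+ M := diag D ε R M (Pi.single lam 1)

theorem IsWeightModule.weightProj_apply_self (h : IsWeightModule D ε R M) {lam : X} {m : M}
    (hm : m ∈ weightSpace D ε R M lam) : weightProj D ε R M lam m = m := by
  classical
  rw [weightProj, h.diag_apply _ hm, Pi.single_eq_same, scalar_one_smul]

theorem IsWeightModule.weightProj_apply_ne (h : IsWeightModule D ε R M) {lam μ : X} (hne : μ ≠ lam)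
    {m : M} (hm : m ∈ weightSpace D ε R M μ) : weightProj D ε R M lam m = 0 := by
  classical
  rw [weightProj, h.diag_apply _ hm, Pi.single_eq_of_ne hne, scalar_zero_smul]

theorem IsWeightModule.weightProj_mem (h : IsWeightModule D ε R M) (lam : X) (m : M) :
    weightProj D ε R M lam m ∈ weightSpace D ε R M lam := by
  induction m using h.induction with
  | h0 => rw [map_zero]; exact zero_mem _
  | hw μ m hm =>
    by_cases hne : μ = lam
    · subst hne; rwa [h.weightProj_apply_self hm]
    · rw [h.weightProj_apply_ne hne hm]; exact zero_mem _
  | ha m m' h h' => rw [map_add]; exact add_mem h h'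

end WeightTheory

/-! ### Arithmetic of super Cartan data -/

section Arithmetic

variable {I : Type u₁} (D : SuperCartanDatum I)

theorem SuperCartanDatum.d_mul_a (i j : I) : (D.d i : ℤ) * D.a i j = D.form i j := by
  have h := D.form_mul_a i j
  rw [D.form_self] at h
  linarith

theorem SuperCartanDatum.d_mul_a_symm (i j : I) : (D.d i : ℤ) * D.a i j = D.d j * D.a j i := by
  rw [D.d_mul_a, D.d_mul_a, D.form_symm]

theorem SuperCartanDatum.a_self (i : I) : D.a i i = 2 := by
  have h := D.d_mul_a i i
  rw [D.form_self, mul_comm 2] at h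
  exact mul_left_cancel₀ (by exact_mod_cast (D.d_pos i).ne') h

theorem SuperCartanDatum.exists_d_eq (i : I) : ∃ m : ℤ, (D.d i : ℤ) = (D.p i : ℕ) + 2 * m := by
  have h := (Nat.modEq_iff_dvd.mp (D.bar_consistent i).symm)
  obtain ⟨m, hm⟩ := h
  exact ⟨m, by push_cast at hm; linarith⟩

theorem SuperCartanDatum.p_sq (i : I) : ((D.p i : ℕ) : ℤ) * (D.p i : ℕ) = (D.p i : ℕ) := by
  generalize D.p i = x
  fin_cases x <;> simp

/-- For odd `i` the factor `a i j` is even; for even `i` bar-consistency makes `d i` even. -/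
theorem SuperCartanDatum.two_dvd_d_mul_a (i j : I) : (2 : ℤ) ∣ D.d i * D.a i j := by
  obtain ⟨m, hm⟩ := D.exists_d_eq i
  by_cases hp : D.p i = 1
  · exact (D.a_even i j hp).two_dvd.mul_left _
  · have : D.p i = 0 := by
      revert hp; generalize D.p i = x; fin_cases x <;> simp
    rw [this] at hm
    exact Dvd.dvd.mul_right ⟨m, by simpa using hm⟩ _

end Arithmetic

theorem two_mul_choose_two (n : ℕ) : 2 * (n.choose 2 : ℤ) = n * (n - 1) := by
  induction n with
  | zero => simp
  | succ n ih =>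
    rw [Nat.choose_succ_succ' n 1, Nat.choose_one_right]
    push_cast
    linarith

section Arithmetic

variable {I : Type u₁} {Y : Type u₂} {X : Type u₃} [AddCommGroup Y] [AddCommGroup X]
variable (D : SuperRootDatum I Y X)

theorem SuperRootDatum.b_eq {i j : I} (hij : i ≠ j) : (D.b i j : ℤ) = 1 - D.a i j := by
  have := D.a_nonpos i j hij
  rw [b, Int.toNat_of_nonneg (by omega)]

theorem SuperRootDatum.pairing_coroot_smul (i : I) (lam : X) :
    D.pairing (D.d i • D.coroot i) lam = D.d i * D.pairing (D.coroot i) lam := by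
  rw [map_nsmul, LinearMap.smul_apply, nsmul_eq_mul]

theorem IsTwistOf.serreCoeff {B : Type*} [CommRing B] {f f' : QvPi →+* B} {s : Bˣ}
    (h : IsTwistOf f' f s) (i j : I) (k : ℕ) :
    f' (serreCoeff D i j k) =
      ((s ^ (2 * (k.choose 2 * (D.p i : ℕ) + k * (D.p i : ℕ) * (D.p j : ℕ) : ℕ) -
        (D.d i * (k * (D.b i j - k)) : ℤ)) : Bˣ) : B) * f (serreCoeff D i j k) := by
  have hp : f' (piUnit : QvPi) = ((s ^ 2 : Bˣ) : B) * f (piUnit : QvPi) :=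
    congrArg Units.val h.map_pi
  have hs : ∀ n : ℕ, f' ((piUnit : QvPi) ^ n) =
      ((s ^ (2 * n : ℤ) : Bˣ) : B) * f ((piUnit : QvPi) ^ n) := fun n => by
    rw [map_pow, map_pow, hp, mul_pow, ← Units.val_pow_eq_pow_val, ← pow_mul]
    norm_cast
  have h1 : ∀ g : QvPi →+* B, g ((-1) ^ k) = (-1) ^ k := fun g => by simp
  rw [CoveringQG.serreCoeff, map_mul, map_mul, map_mul, map_mul, hs, SuperRootDatum.pii,
    SuperRootDatum.vi, h.qBinom (D.d_pos i), sub_eq_add_neg (2 * _), zpow_add,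
      Units.val_mul, h1, h1]
  ring

end Arithmetic

theorem zpow_eq_of_four_dvd {G : Type*} [Group G] {s : G} (hs : s ^ 4 = 1) {m n : ℤ}
    (h : 4 ∣ m - n) : s ^ m = s ^ n := by
  obtain ⟨k, hk⟩ := h
  rw [← sub_add_cancel m n, hk, zpow_add, zpow_mul]
  norm_cast
  rw [hs]
  simp

/-! ### Twisting representations -/

section Twist

variable {I : Type u₁} {Y : Type u₂} {X : Type u₃} [AddCommGroup Y] [AddCommGroup X]

/-- A family of functions on the weight lattice which are translation equivariant with respect
to the root lattice, with the values of the twistor modulo `4`. -/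
structure TwistDatum (D : SuperRootDatum I Y X) where
  φ : I → X → ℤ
  c : I → I → ℤ
  φ_add : ∀ i j lam, φ i (lam + D.root j) = φ i lam + c i j
  c_self : ∀ i, c i i = D.d i
  c_ne : ∀ i j, i ≠ j → 4 ∣ D.d i * D.a i j - c i j + c j i - 2 * (D.p i : ℕ) * (D.p j : ℕ)

variable {D : SuperRootDatum I Y X} (T : TwistDatum D)

theorem TwistDatum.φ_sub (i j : I) (lam : X) : T.φ i (lam - D.root j) = T.φ i lam - T.c i j := by
  have := T.φ_add i j (lam - D.root j)
  rw [sub_add_cancel] at this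
  linarith

/-- The exponents for the operators `E_i`. -/
def TwistDatum.expE (i : I) (lam : X) : ℤ :=
  -(D.d i * D.pairing (D.coroot i) lam - T.φ i lam)

/-- The exponents for the operators `F_i`. -/
def TwistDatum.expF (i : I) (lam : X) : ℤ := -T.φ i lam

theorem TwistDatum.expE_add (i j : I) (lam : X) :
    T.expE i (lam + D.root j) = T.expE i lam + (T.c i j - D.d i * D.a i j) := by
  rw [expE, expE, map_add, D.pairing_coroot_root, T.φ_add]; ring

theorem TwistDatum.expE_sub (i j : I) (lam : X) :
    T.expE i (lam - D.root j) = T.expE i lam - (T.c i j - D.d i * D.a i j) := by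
  rw [expE, expE, map_sub, D.pairing_coroot_root, T.φ_sub]; ring

theorem TwistDatum.expF_add (i j : I) (lam : X) :
    T.expF i (lam + D.root j) = T.expF i lam - T.c i j := by
  rw [expF, expF, T.φ_add]; ring

theorem TwistDatum.expF_sub (i j : I) (lam : X) :
    T.expF i (lam + -D.root j) = T.expF i lam + T.c i j := by
  rw [← sub_eq_add_neg, expF, expF, T.φ_sub]; ring

variable {ε : ℤˣ} {R : Type u₄} [CommRing R] [Algebra Qv R]
variable {M : Type w} [AddCommGroup M] [Module (SpecU D ε R) M]

theorem AddMonoidEnd.mul_apply (f g : AddMonoid.End M) (m : M) : (f * g) m = f (g m) := rfl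

theorem AddMonoidEnd.pow_succ_apply (f : AddMonoid.End M) (n : ℕ) (m : M) :
    (f ^ (n + 1)) m = f ((f ^ n) m) := by rw [pow_succ']; rfl

/-- The scalar `sⁿ` as an element of the specialized algebra. -/
noncomputable def unitScalar (D : SuperRootDatum I Y X) (ε : ℤˣ) (s : Rˣ) (n : ℤ) : SpecU D ε R :=
  SpecU.scalar D ε R ((s ^ n : Rˣ) : R)

theorem unitScalar_smul_smul (s : Rˣ) (n n' : ℤ) (m : M) :
    unitScalar D ε s n • unitScalar D ε s n' • m = unitScalar D ε s (n + n') • m := by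
  rw [unitScalar, unitScalar, unitScalar, scalar_smul_smul, ← Units.val_mul, zpow_add]

theorem unitScalar_smul_mem (s : Rˣ) (n : ℤ) {lam : X} {m : M}
    (hm : m ∈ weightSpace D ε R M lam) : unitScalar D ε s n • m ∈ weightSpace D ε R M lam :=
  scalar_smul_mem _ hm

theorem smul_unitScalar_smul (s : Rˣ) (u : SpecU D ε R) (n : ℤ) (m : M) :
    u • unitScalar D ε s n • m = unitScalar D ε s n • u • m :=
  smul_scalar_smul u _ m

/-! ### Serre relations for rescaled operators -/

section Words

variable {s : Rˣ} {α : I → X} {e : I → X → ℤ} {κ : I → I → ℤ}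
  (he : ∀ i j lam, e i (lam + α j) = e i lam + κ i j)
  {u : I → SpecU D ε R}
  (hu : ∀ i lam, ∀ m ∈ weightSpace D ε R M lam, u i • m ∈ weightSpace D ε R M (lam + α i))
  {y : I → AddMonoid.End M}
  (hy : ∀ i lam, ∀ m ∈ weightSpace D ε R M lam, y i m = unitScalar D ε s (e i lam) • u i • m)

include hu in
theorem pow_smul_mem (i : I) (k : ℕ) {lam : X} {m : M} (hm : m ∈ weightSpace D ε R M lam) :
    u i ^ k • m ∈ weightSpace D ε R M (lam + k • α i) := by
  induction k with
  | zero => simpa using hm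
  | succ k ih =>
    rw [pow_succ', mul_smul, succ_nsmul, ← add_assoc]
    exact hu i _ _ ih

include he in
theorem exponent_add_nsmul (i j : I) (k : ℕ) (lam : X) :
    e i (lam + k • α j) = e i lam + k * κ i j := by
  induction k with
  | zero => simp
  | succ k ih =>
    rw [succ_nsmul, ← add_assoc, he, ih]
    push_cast
    ring

include he hu hy in
theorem pow_apply_eq (i : I) (k : ℕ) {lam : X} {m : M} (hm : m ∈ weightSpace D ε R M lam) :
    (y i ^ k) m = unitScalar D ε s (k * e i lam + k.choose 2 * κ i i) • u i ^ k • m := by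
  induction k with
  | zero => simp [unitScalar, scalar_one_smul]
  | succ k ih =>
    have hmem := pow_smul_mem hu i k hm
    rw [AddMonoidEnd.pow_succ_apply, ih, hy i _ _ (unitScalar_smul_mem _ _ hmem), pow_succ',
      mul_smul, smul_unitScalar_smul, unitScalar_smul_smul,
      exponent_add_nsmul he, Nat.choose_succ_succ' k 1, Nat.choose_one_right]
    congr 2
    push_cast
    ring

include he hu hy in
-- The point is the dependence on `k`: up to a factor common to all words of the Serre sum, the
-- exponent is linear in `k` with slope `κ j i - κ i j`.
theorem serre_word_apply (i j : I) (b k : ℕ) (hk : k ≤ b) {lam : X} {m : M}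
    (hm : m ∈ weightSpace D ε R M lam) :
    (y i ^ (b - k) * y j * y i ^ k) m =
      unitScalar D ε s (b * e i lam + b.choose 2 * κ i i + e j lam + b * κ i j +
        k * (κ j i - κ i j)) • (u i ^ (b - k) * u j * u i ^ k) • m := by
  have h1 := pow_smul_mem hu i k hm
  have h2 := hu j _ _ h1
  rw [AddMonoidEnd.mul_apply, AddMonoidEnd.mul_apply, pow_apply_eq he hu hy i k hm,
    hy j _ _ (unitScalar_smul_mem _ _ h1), smul_unitScalar_smul, unitScalar_smul_smul,
    pow_apply_eq he hu hy i (b - k) (unitScalar_smul_mem _ _ h2), smul_unitScalar_smul,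
    unitScalar_smul_smul, he, exponent_add_nsmul he, exponent_add_nsmul he, mul_smul, mul_smul]
  congr 2
  have e1 := two_mul_choose_two k
  have e2 := two_mul_choose_two (b - k)
  have e3 := two_mul_choose_two b
  push_cast [Nat.cast_sub hk] at e2 ⊢
  -- The quadratic contributions of the two powers of `u i` and their interaction add up to
  -- `binom(b, 2)`, so `κ i i` enters independently of `k`.
  have e4 : ((k.choose 2 : ℤ) + (b - k).choose 2 + k * (b - k)) = b.choose 2 := by linarith
  rw [← e4]
  ring

include he hu hy in
-- The change of the coefficient and the change of the word compensate modulo 4, up to a factor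
-- common to all `k`. Thus the new sum on a weight vector is a power of `s` times the old one. The
-- abstract form covers both the `E_i`, with shifts by roots, and the `F_i`, with shifts by negative
-- roots.
theorem serre_twist {f' : QvPi →+* R} (hf : IsTwistOf f' (spec ε R) s) {i j : I} (hij : i ≠ j)
    (hκ : 4 ∣ κ j i - κ i j + D.d i * D.a i j - 2 * (D.p i : ℕ) * (D.p j : ℕ))
    (hserre : ∑ k ∈ Finset.range (D.b i j + 1), algebraMap QvPi (SpecU D ε R) (serreCoeff D i j k) *
      (u i ^ (D.b i j - k) * u j * u i ^ k) = 0)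
    {lam : X} {m : M} (hm : m ∈ weightSpace D ε R M lam) :
    ∑ k ∈ Finset.range (D.b i j + 1), SpecU.scalar D ε R (f' (serreCoeff D i j k)) •
      (y i ^ (D.b i j - k) * y j * y i ^ k) m = 0 := by
  set b := D.b i j with hb
  have h := congrArg (· • m) hserre
  simp only [Finset.sum_smul, zero_smul] at h
  have h' := congrArg (fun z => unitScalar D ε s (b * e i lam + b.choose 2 * κ i i + e j lam +
    b * κ i j) • z) h
  simp only [smul_zero, Finset.smul_sum] at h'
  rw [← h']
  refine Finset.sum_congr rfl fun k hk => ?_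
  have hkb : k ≤ b := Nat.lt_succ_iff.mp (Finset.mem_range.mp hk)
  rw [serre_word_apply he hu hy i j b k hkb hm, hf.serreCoeff, SpecU.algebraMap_eq,
    mul_comm (((s ^ _ : Rˣ) : R)), ← scalar_smul_smul, ← unitScalar, unitScalar_smul_smul,
    mul_smul (SpecU.scalar D ε R _), 
    smul_unitScalar_smul s (SpecU.scalar D ε R (spec ε R (serreCoeff D i j k)))]
  congr 1
  rw [unitScalar, unitScalar, zpow_eq_of_four_dvd hf.pow_four]
  obtain ⟨t, ht⟩ := hκ
  obtain ⟨r, hr⟩ := D.exists_d_eq i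
  have ek := two_mul_choose_two k
  have hb' := D.b_eq hij
  rw [← hb] at hb'
  rw [← hb, hb']
  push_cast
  -- Inserting the congruence for `κ` cancels the terms with `a i j`. What is left besides multiples
  -- of 4 is `2 binom(k,2) (p i + d i)`, and `p i + d i` is even by bar-consistency.
  have : 2 * (k.choose 2 * ((D.p i : ℕ) : ℤ) + k * (D.p i : ℕ) * (D.p j : ℕ)) -
      D.d i * (k * (1 - D.a i j - k)) + k * (κ j i - κ i j) = 
      4 * (k * t) + 4 * (k * (D.p i : ℕ) * (D.p j : ℕ)) + 2 * (k.choose 2 : ℤ) * (D.p i : ℕ) +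
      D.d i * (k * (k - 1)) := by
    linear_combination (k : ℤ) * ht
  rw [← ek, hr] at this
  refine ⟨k * t + k * (D.p i : ℕ) * (D.p j : ℕ) + k.choose 2 * ((D.p i : ℕ) + r), ?_⟩
  linear_combination this - (k * (1 - D.a i j - k) : ℤ) * hr

end Words

end Twist

/-! ### The twisted operators satisfy the relations of the other specialization -/

section TwistedGenerators

variable {I : Type u₁} {Y : Type u₂} {X : Type u₃} [AddCommGroup Y] [AddCommGroup X]
variable {D : SuperRootDatum I Y X} (T : TwistDatum D)
variable {ε : ℤˣ} {R : Type u₄} [CommRing R] [Algebra Qv R]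
variable {M : Type w} [AddCommGroup M] [Module (SpecU D ε R) M]

theorem IsWeightModule.end_ext (h : IsWeightModule D ε R M) {f g : AddMonoid.End M}
    (hw : ∀ lam, ∀ m ∈ weightSpace D ε R M lam, f m = g m) : f = g :=
  h.hom_ext hw

theorem AddMonoidEnd.sum_apply {ι : Type*} (t : Finset ι) (f : ι → AddMonoid.End M) (m : M) :
    (∑ k ∈ t, f k) m = ∑ k ∈ t, f k m :=
  AddMonoidHom.finsetSum_apply f t m

variable (ε M) in
/-- The operators on a weight module by which the twistor lets the generators act. Here `f'` is
the new action of the scalars in `ℚ(v)^π`. -/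
noncomputable def twistGen (f' : QvPi →+* R) (s : Rˣ) : Gen I Y → AddMonoid.End M
  | .E i => (DistribSMul.toAddMonoidHom M (SpecU.of D ε R (.E i))).comp
      (diag D ε R M fun lam => ((s ^ T.expE i lam : Rˣ) : R))
  | .F i => (DistribSMul.toAddMonoidHom M (SpecU.of D ε R (.F i))).comp
      (diag D ε R M fun lam => ((s ^ T.expF i lam : Rˣ) : R))
  | .K ν => diag D ε R M fun lam => f' ((vUnit QvPi ^ D.pairing ν lam : QvPiˣ) : QvPi)
  | .J ν => diag D ε R M fun lam => f' ((piUnit ^ D.pairing ν lam : QvPiˣ) : QvPi)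

variable {T} (h : IsWeightModule D ε R M) {f' : QvPi →+* R} {s : Rˣ} {lam : X} {m : M}

include h

theorem twistGen_E (i : I) (hm : m ∈ weightSpace D ε R M lam) :
    twistGen T ε M f' s (.E i) m = unitScalar D ε s (T.expE i lam) • SpecU.of D ε R (.E i) • m := by
  refine (congrArg (SpecU.of D ε R (.E i) • ·) (h.diag_apply _ hm)).trans ?_
  exact smul_scalar_smul _ _ _

theorem twistGen_F (i : I) (hm : m ∈ weightSpace D ε R M lam) :
    twistGen T ε M f' s (.F i) m = unitScalar D ε s (T.expF i lam) • SpecU.of D ε R (.F i) • m := by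
  refine (congrArg (SpecU.of D ε R (.F i) • ·) (h.diag_apply _ hm)).trans ?_
  exact smul_scalar_smul _ _ _

theorem twistGen_K (ν : Y) (hm : m ∈ weightSpace D ε R M lam) :
    twistGen T ε M f' s (.K ν) m =
      SpecU.scalar D ε R (f' ((vUnit QvPi ^ D.pairing ν lam : QvPiˣ) : QvPi)) • m :=
  h.diag_apply _ hm

theorem twistGen_J (ν : Y) (hm : m ∈ weightSpace D ε R M lam) :
    twistGen T ε M f' s (.J ν) m =
      SpecU.scalar D ε R (f' ((piUnit ^ D.pairing ν lam : QvPiˣ) : QvPi)) • m :=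
  h.diag_apply _ hm

theorem twistGen_E_mem (i : I) (hm : m ∈ weightSpace D ε R M lam) :
    twistGen T ε M f' s (.E i) m ∈ weightSpace D ε R M (lam + D.root i) := by
  rw [twistGen_E h i hm]
  exact unitScalar_smul_mem _ _ (E_smul_mem i hm)

theorem twistGen_F_mem (i : I) (hm : m ∈ weightSpace D ε R M lam) :
    twistGen T ε M f' s (.F i) m ∈ weightSpace D ε R M (lam - D.root i) := by
  rw [twistGen_F h i hm]
  exact unitScalar_smul_mem _ _ (F_smul_mem i hm)

theorem twistGen_scalar_smul (y : Gen I Y) (c : R) (m : M) :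
    twistGen T ε M f' s y (SpecU.scalar D ε R c • m) =
      SpecU.scalar D ε R c • twistGen T ε M f' s y m := by
  cases y with
  | E i =>
    refine Eq.trans ?_ (smul_scalar_smul (SpecU.of D ε R (.E i)) c _)
    exact congrArg (SpecU.of D ε R (.E i) • ·) (h.scalar_diag c _ m).symm
  | F i =>
    refine Eq.trans ?_ (smul_scalar_smul (SpecU.of D ε R (.F i)) c _)
    exact congrArg (SpecU.of D ε R (.F i) • ·) (h.scalar_diag c _ m).symm
  | K ν => exact (h.scalar_diag c _ m).symm
  | J ν => exact (h.scalar_diag c _ m).symm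

omit h in
theorem J_mul_K_sub_K_smul (i : I) (hm : m ∈ weightSpace D ε R M lam) :
    (SpecU.of D ε R (.J (D.d i • D.coroot i)) * SpecU.of D ε R (.K (D.d i • D.coroot i)) -
      SpecU.of D ε R (.K (-(D.d i • D.coroot i)))) • m =
    algebraMap QvPi (SpecU D ε R) (qDiff (D.pii i) (D.vi i) (D.pairing (D.coroot i) lam)) • m := by
  rw [sub_smul, mul_smul, (hm _).1, (hm _).1, SpecU.algebraMap_eq, smul_scalar_smul, (hm _).2,
    ← SpecU.algebraMap_eq, smul_smul, ← map_mul, ← sub_smul, ← map_sub]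
  congr 2
  simp only [qDiff, map_neg, LinearMap.neg_apply, D.pairing_coroot_smul, SuperRootDatum.pii,
    SuperRootDatum.vi]
  rw [← Units.val_mul, ← zpow_natCast, ← zpow_natCast, mul_zpow, ← zpow_mul, ← zpow_mul,
    ← zpow_mul, mul_comm (vUnit QvPi ^ _), mul_neg]

/-- The scalars of the specialized algebra as operators on a module. -/
noncomputable abbrev scalarEnd (D : SuperRootDatum I Y X) (ε : ℤˣ) (R : Type u₄) [CommRing R]
    [Algebra Qv R] (M : Type w) [AddCommGroup M] [Module (SpecU D ε R) M] :
    R →+* AddMonoid.End M :=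
  (Module.toAddMonoidEnd (SpecU D ε R) M).comp (SpecU.scalarHom D ε R)

omit h in
theorem scalarEnd_apply (c : R) (m : M) :
    scalarEnd D ε R M c m = SpecU.scalar D ε R c • m := rfl

omit h in
theorem scalar_map_unit_add (u : QvPiˣ) (a b : ℤ) (m : M) :
    SpecU.scalar D ε R (f' ((u ^ a : QvPiˣ) : QvPi)) •
      SpecU.scalar D ε R (f' ((u ^ b : QvPiˣ) : QvPi)) • m =
    SpecU.scalar D ε R (f' ((u ^ (a + b) : QvPiˣ) : QvPi)) • m := by
  rw [scalar_smul_smul, ← map_mul, ← Units.val_mul, zpow_add]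

omit h in
theorem IsTwistOf.pi_pow (hf : IsTwistOf f' (spec ε R) s) (n : ℕ) :
    f' ((piUnit : QvPi) ^ n) =
      ((s ^ (2 * n : ℤ) : Rˣ) : R) * spec ε R ((piUnit : QvPi) ^ n) := by
  have hp : f' (piUnit : QvPi) = ((s ^ 2 : Rˣ) : R) * spec ε R (piUnit : QvPi) :=
    congrArg Units.val hf.map_pi
  rw [map_pow, map_pow, hp, mul_pow, ← Units.val_pow_eq_pow_val, ← pow_mul]
  norm_cast

omit h in
theorem scalar_map_smul {a : QvPi} {n : ℤ} (ha : f' a = ((s ^ n : Rˣ) : R) * spec ε R a) (m : M) :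
    SpecU.scalar D ε R (f' a) • m =
      unitScalar D ε s n • algebraMap QvPi (SpecU D ε R) a • m := by
  rw [ha, ← scalar_smul_smul, SpecU.algebraMap_eq]
  rfl

/-- With `n = ⟨i, lam⟩`, the exponents of `E_i` and `F_i` at `lam` add up to `-d_i n`, which is the
power of `s` picked up by the numerator `(π_i v_i)ⁿ - v_i⁻ⁿ`. The normalization `c i i = d i` then
gives all three terms the common factor `s^(-d_i n + d_i)`, the last `d_i` matching the denominator
on the right. -/
theorem twistGen_E_F_same (hf : IsTwistOf f' (spec ε R) s) (i : I)
    (hm : m ∈ weightSpace D ε R M lam) :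
    twistGen T ε M f' s (.E i) (twistGen T ε M f' s (.F i) m) -
      SpecU.scalar D ε R (f' ((piUnit : QvPi) ^ ((D.p i : ℕ) * (D.p i : ℕ)))) •
        twistGen T ε M f' s (.F i) (twistGen T ε M f' s (.E i) m) =
    SpecU.scalar D ε R (f' (Ring.inverse (qDiff (D.pii i) (D.vi i) 1))) •
      (twistGen T ε M f' s (.J (D.d i • D.coroot i))
          (twistGen T ε M f' s (.K (D.d i • D.coroot i)) m) -
        twistGen T ε M f' s (.K (-(D.d i • D.coroot i))) m) := by
  set n := D.pairing (D.coroot i) lam with hn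
  have hJK : twistGen T ε M f' s (.J (D.d i • D.coroot i))
          (twistGen T ε M f' s (.K (D.d i • D.coroot i)) m) -
        twistGen T ε M f' s (.K (-(D.d i • D.coroot i))) m =
      SpecU.scalar D ε R (f' (qDiff (D.pii i) (D.vi i) n)) • m := by
    rw [twistGen_K h _ hm, twistGen_K h _ hm, twistGen_scalar_smul h, twistGen_J h _ hm,
      scalar_smul_smul, ← map_mul, ← SpecU.scalarHom_apply, ← SpecU.scalarHom_apply, ← sub_smul,
      ← map_sub, ← map_sub, SpecU.scalarHom_apply]
    congr 3
    simp only [qDiff, map_neg, LinearMap.neg_apply, D.pairing_coroot_smul, SuperRootDatum.pii,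
      SuperRootDatum.vi]
    rw [← Units.val_mul, ← zpow_natCast, ← zpow_natCast, mul_zpow, ← zpow_mul, ← zpow_mul,
      ← zpow_mul, mul_comm (vUnit QvPi ^ _), mul_neg]
  have hold := congrArg (· • m) ((SpecU.covRel D ε R).E_F_same i)
  rw [sub_smul, mul_smul, mul_smul, mul_smul, mul_smul, J_mul_K_sub_K_smul i hm] at hold
  have hF := twistGen_F (T := T) (f' := f') (s := s) h i hm
  have hE := twistGen_E (T := T) (f' := f') (s := s) h i hm
  have e1 := T.expE_sub i i lam
  have e2 := T.expF_add i i lam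
  rw [T.c_self, D.a_self] at e1
  rw [T.c_self] at e2
  have hinv := hf.inverse (isUnit_qDiff (D.d_pos i) one_ne_zero) (hf.qDiff (D.d i) 1)
  -- Since `p(i)² = p(i) ≡ d_i` modulo 2, the exponents `2 p(i)²` and `2 d_i` agree modulo 4.
  have hpp : f' ((piUnit : QvPi) ^ ((D.p i : ℕ) * (D.p i : ℕ))) =
      ((s ^ (2 * (D.d i : ℤ)) : Rˣ) : R) *
        spec ε R ((piUnit : QvPi) ^ ((D.p i : ℕ) * (D.p i : ℕ))) := by
    rw [hf.pi_pow, zpow_eq_of_four_dvd hf.pow_four]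
    obtain ⟨r, hr⟩ := D.exists_d_eq i
    have := D.p_sq i
    exact ⟨-r, by push_cast; linarith⟩
  rw [hJK, hF, twistGen_E h i (unitScalar_smul_mem _ _ (F_smul_mem i hm)), hE,
    twistGen_F h i (unitScalar_smul_mem _ _ (E_smul_mem i hm)),
    smul_unitScalar_smul s (SpecU.of D ε R (.E i)), smul_unitScalar_smul s (SpecU.of D ε R (.F i)),
    unitScalar_smul_smul, unitScalar_smul_smul, scalar_map_smul hpp,
    smul_unitScalar_smul s (algebraMap _ _ _), unitScalar_smul_smul, SuperRootDatum.pii,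
    SuperRootDatum.vi, scalar_map_smul hinv, scalar_map_smul (hf.qDiff _ _),
    smul_unitScalar_smul s (algebraMap _ _ _), unitScalar_smul_smul]
  have hexp : T.expE i lam + T.expF i lam = -(D.d i * n) := by
    rw [TwistDatum.expE, TwistDatum.expF]; ring
  rw [show T.expE i (lam - D.root i) + T.expF i lam = -(D.d i * n) + D.d i by linarith,
    show 2 * (D.d i : ℤ) + (T.expF i (lam + D.root i) + T.expE i lam) = -(D.d i * n) + D.d i by
      linarith,
    show -(-((D.d i : ℤ) * 1)) + -(D.d i * n) = -(D.d i * n) + D.d i by ring, ← smul_sub, hold]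
  rfl

/-- The exponents of the two products differ by the quantity in `c_ne`. The same congruence thus
governs this relation and both Serre relations. -/
theorem twistGen_E_F_ne (hf : IsTwistOf f' (spec ε R) s) {i j : I} (hij : i ≠ j)
    (hm : m ∈ weightSpace D ε R M lam) :
    twistGen T ε M f' s (.E i) (twistGen T ε M f' s (.F j) m) -
      SpecU.scalar D ε R (f' ((piUnit : QvPi) ^ ((D.p i : ℕ) * (D.p j : ℕ)))) •
        twistGen T ε M f' s (.F j) (twistGen T ε M f' s (.E i) m) = 0 := by
  have hold := congrArg (· • m) ((SpecU.covRel D ε R).E_F_ne i j hij)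
  rw [sub_smul, mul_smul, mul_smul, mul_smul, zero_smul] at hold
  have hF := twistGen_F (T := T) (f' := f') (s := s) h j hm
  have hE := twistGen_E (T := T) (f' := f') (s := s) h i hm
  have e1 := T.expE_sub i j lam
  have e2 := T.expF_add j i lam
  rw [hF, twistGen_E h i (unitScalar_smul_mem _ _ (F_smul_mem j hm)), hE,
    twistGen_F h j (unitScalar_smul_mem _ _ (E_smul_mem i hm)),
    smul_unitScalar_smul s (SpecU.of D ε R (.E i)), smul_unitScalar_smul s (SpecU.of D ε R (.F j)),
    unitScalar_smul_smul, unitScalar_smul_smul, scalar_map_smul (hf.pi_pow _),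
    smul_unitScalar_smul s (algebraMap _ _ _), unitScalar_smul_smul]
  have hexp : unitScalar D ε s (2 * ((D.p i : ℕ) * (D.p j : ℕ) : ℕ) +
      (T.expF j (lam + D.root i) + T.expE i lam)) =
      unitScalar D ε s (T.expE i (lam - D.root j) + T.expF j lam) := by
    rw [unitScalar, unitScalar, zpow_eq_of_four_dvd hf.pow_four]
    obtain ⟨t, ht⟩ := T.c_ne i j hij
    exact ⟨-t, by push_cast; linarith⟩
  rw [hexp, ← smul_sub, hold, smul_zero]

theorem twistGen_covRel (hf : IsTwistOf f' (spec ε R) s) :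
    CovRel D ((scalarEnd D ε R M).comp f') (twistGen T ε M f' s) := by
  have hK0 : ∀ m : M, SpecU.scalar D ε R (f' ((1 : QvPiˣ) : QvPi)) • m = m := fun m => by
    rw [Units.val_one, map_one, scalar_one_smul]
  constructor
  case J_mul =>
    refine fun μ ν => h.end_ext fun lam m hm => ?_
    rw [AddMonoidEnd.mul_apply, twistGen_J h _ hm, twistGen_scalar_smul h, twistGen_J h _ hm,
      twistGen_J h _ hm, scalar_map_unit_add, map_add, LinearMap.add_apply, add_comm]
  case K_mul =>
    refine fun μ ν => h.end_ext fun lam m hm => ?_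
    rw [AddMonoidEnd.mul_apply, twistGen_K h _ hm, twistGen_scalar_smul h, twistGen_K h _ hm,
      twistGen_K h _ hm, scalar_map_unit_add, map_add, LinearMap.add_apply, add_comm]
  case K_zero =>
    refine h.end_ext fun lam m hm => ?_
    rw [twistGen_K h _ hm, map_zero, LinearMap.zero_apply, zpow_zero, hK0]; rfl
  case J_zero =>
    refine h.end_ext fun lam m hm => ?_
    rw [twistGen_J h _ hm, map_zero, LinearMap.zero_apply, zpow_zero, hK0]; rfl
  case J_sq =>
    refine fun ν => h.end_ext fun lam m hm => ?_
    rw [pow_two, AddMonoidEnd.mul_apply, twistGen_J h _ hm, twistGen_scalar_smul h,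
      twistGen_J h _ hm, scalar_map_unit_add, ← two_mul, zpow_mul]
    norm_cast
    rw [piUnit_sq, one_zpow, hK0]; rfl
  case J_K =>
    refine fun μ ν => h.end_ext fun lam m hm => ?_
    rw [AddMonoidEnd.mul_apply, AddMonoidEnd.mul_apply, twistGen_J h _ hm, twistGen_K h _ hm,
      twistGen_scalar_smul h, twistGen_scalar_smul h, twistGen_J h _ hm, twistGen_K h _ hm,
      scalar_smul_smul, scalar_smul_smul, mul_comm]
  case J_E =>
    refine fun μ i => h.end_ext fun lam m hm => ?_
    rw [AddMonoidEnd.mul_apply, twistGen_J h _ (twistGen_E_mem h i hm), AddMonoidEnd.mul_apply,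
      RingHom.comp_apply, scalarEnd_apply, AddMonoidEnd.mul_apply, twistGen_J h _ hm,
      twistGen_scalar_smul h, scalar_map_unit_add, map_add, add_comm]
  case J_F =>
    refine fun μ i => h.end_ext fun lam m hm => ?_
    rw [AddMonoidEnd.mul_apply, twistGen_J h _ (twistGen_F_mem h i hm), AddMonoidEnd.mul_apply,
      RingHom.comp_apply, scalarEnd_apply, AddMonoidEnd.mul_apply, twistGen_J h _ hm,
      twistGen_scalar_smul h, scalar_map_unit_add, map_sub, neg_add_eq_sub]
  case K_E =>
    refine fun μ i => h.end_ext fun lam m hm => ?_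
    rw [AddMonoidEnd.mul_apply, twistGen_K h _ (twistGen_E_mem h i hm), AddMonoidEnd.mul_apply,
      RingHom.comp_apply, scalarEnd_apply, AddMonoidEnd.mul_apply, twistGen_K h _ hm,
      twistGen_scalar_smul h, scalar_map_unit_add, map_add, add_comm]
  case K_F =>
    refine fun μ i => h.end_ext fun lam m hm => ?_
    rw [AddMonoidEnd.mul_apply, twistGen_K h _ (twistGen_F_mem h i hm), AddMonoidEnd.mul_apply,
      RingHom.comp_apply, scalarEnd_apply, AddMonoidEnd.mul_apply, twistGen_K h _ hm,
      twistGen_scalar_smul h, scalar_map_unit_add, map_sub, neg_add_eq_sub]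
  case E_F_same =>
    refine fun i => h.end_ext fun lam m hm => ?_
    exact twistGen_E_F_same h hf i hm
  case E_F_ne =>
    refine fun i j hij => h.end_ext fun lam m hm => ?_
    exact twistGen_E_F_ne h hf hij hm
  case serre_E =>
    refine fun i j hij => h.end_ext fun lam m hm => ?_
    rw [AddMonoidEnd.sum_apply]
    refine serre_twist (e := T.expE) (α := D.root) (u := fun i => SpecU.of D ε R (.E i))
      (y := fun i => twistGen T ε M f' s (.E i)) T.expE_add (fun i _ _ hm => E_smul_mem i hm)
      (fun i _ _ hm => twistGen_E h i hm) hf hij ?_ ((SpecU.covRel D ε R).serre_E i j hij) hm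
    -- For the `E_i` the slope involves `c i j - d i * a i j`; the symmetry `d i * a i j = d j * a j
    -- i` cancels the extra terms.
    convert T.c_ne i j hij using 1
    rw [← D.d_mul_a_symm i j]
    ring
  case serre_F =>
    refine fun i j hij => h.end_ext fun lam m hm => ?_
    rw [AddMonoidEnd.sum_apply]
    refine serre_twist (e := T.expF) (α := fun i => -D.root i)
      (u := fun i => SpecU.of D ε R (.F i))
      (y := fun i => twistGen T ε M f' s (.F i)) T.expF_sub
      (fun i lam _ hm => sub_eq_add_neg lam (D.root i) ▸ F_smul_mem i hm)
      (fun i _ _ hm => twistGen_F h i hm) hf hij ?_ ((SpecU.covRel D ε R).serre_F i j hij) hm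
    convert T.c_ne i j hij using 1
    ring

end TwistedGenerators

/-! ### The twisted module -/

section Linear

variable {I : Type u₁} {Y : Type u₂} {X : Type u₃} [AddCommGroup Y] [AddCommGroup X]
variable {D : SuperRootDatum I Y X} {ε : ℤˣ} {R : Type u₄} [CommRing R] [Algebra Qv R]
variable {M : Type*} [AddCommGroup M] [Module (SpecU D ε R) M]
variable {N : Type*} [AddCommGroup N] [Module (SpecU D ε R) N]

theorem map_smul_of_generators (g : M →+ N)
    (hs : ∀ c m, g (SpecU.scalar D ε R c • m) = SpecU.scalar D ε R c • g m)
    (ho : ∀ y m, g (SpecU.of D ε R y • m) = SpecU.of D ε R y • g m) (u : SpecU D ε R) (m : M) :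
    g (u • m) = u • g m := by
  induction u using SpecU.induction generalizing m with
  | hs c => exact hs c m
  | ho y => exact ho y m
  | ha u u' h h' => rw [add_smul, add_smul, map_add, h, h']
  | hm u u' h h' => rw [mul_smul, mul_smul, h, h']

/-- Preserving weights already forces compatibility with every `K_ν` and `J_ν`, so only the scalars,
the `E_i` and the `F_i` remain. -/
theorem IsWeightModule.map_smul_of_weights (h : IsWeightModule D ε R M) (g : M →+ N)
    (hs : ∀ c m, g (SpecU.scalar D ε R c • m) = SpecU.scalar D ε R c • g m)
    (hw : ∀ lam, ∀ m ∈ weightSpace D ε R M lam, g m ∈ weightSpace D ε R N lam)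
    (hE : ∀ i lam, ∀ m ∈ weightSpace D ε R M lam,
      g (SpecU.of D ε R (.E i) • m) = SpecU.of D ε R (.E i) • g m)
    (hF : ∀ i lam, ∀ m ∈ weightSpace D ε R M lam,
      g (SpecU.of D ε R (.F i) • m) = SpecU.of D ε R (.F i) • g m) (u : SpecU D ε R) (m : M) :
    g (u • m) = u • g m := by
  refine map_smul_of_generators g hs (fun y m => ?_) u m
  have key : g.comp (DistribSMul.toAddMonoidHom M (SpecU.of D ε R y)) =
      (DistribSMul.toAddMonoidHom N (SpecU.of D ε R y)).comp g := by
    refine h.hom_ext fun lam m hm => ?_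
    change g (SpecU.of D ε R y • m) = SpecU.of D ε R y • g m
    cases y with
    | E i => exact hE i lam m hm
    | F i => exact hF i lam m hm
    | K ν => rw [(hm ν).1, ((hw lam m hm) ν).1, SpecU.algebraMap_eq, hs]
    | J ν => rw [(hm ν).2, ((hw lam m hm) ν).2, SpecU.algebraMap_eq, hs]
  exact DFunLike.congr_fun key m

end Linear

section TwistMod

variable {I : Type u₁} {Y : Type u₂} {X : Type u₃} [AddCommGroup Y] [AddCommGroup X]
variable {D : SuperRootDatum I Y X} (T : TwistDatum D)
variable {ε ε' : ℤˣ} (hε : ε' = -ε) {s : Qvtˣ} (hs : s ^ 2 = -1)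
variable {M : Type w} [AddCommGroup M] [Module (SpecU D ε Qvt) M]

/-- The twist of a weight module at `π = ε` by the twistor, a module at `π = -ε`. -/
def TwistMod (_T : TwistDatum D) (_hε : ε' = -ε) (_hs : s ^ 2 = -1)
    (_h : IsWeightModule D ε Qvt M) : Type w := M

instance (h : IsWeightModule D ε Qvt M) : AddCommGroup (TwistMod T hε hs h) :=
  inferInstanceAs (AddCommGroup M)

/-- The identity map from a module to its twist. -/
def toTwist (h : IsWeightModule D ε Qvt M) : M ≃+ TwistMod T hε hs h := AddEquiv.refl M

include hε in
theorem isTwistOf_rescale' : IsTwistOf ((rescale s hs).comp (spec ε' Qvt)) (spec ε Qvt) s := by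
  subst hε
  exact isTwistOf_rescale ε s hs

include hε in
theorem twist_covRel (h : IsWeightModule D ε Qvt M) :
    CovRel D (((scalarEnd D ε Qvt M).comp (rescale s hs)).comp (spec ε' Qvt))
      (twistGen T ε M ((rescale s hs).comp (spec ε' Qvt)) s) := by
  rw [RingHom.comp_assoc]
  exact twistGen_covRel h (isTwistOf_rescale' hε hs)

theorem twist_commute (h : IsWeightModule D ε Qvt M) (f' : QvPi →+* Qvt) (c : Qvt) (y : Gen I Y) :
    Commute ((scalarEnd D ε Qvt M).comp (rescale s hs) c) (twistGen T ε M f' s y) :=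
  h.end_ext fun _ m _ => (twistGen_scalar_smul h y _ m).symm

/-- The action of the algebra at `π = -ε` on the twist. -/
noncomputable def twistHom (h : IsWeightModule D ε Qvt M) :
    SpecU D ε' Qvt →+* AddMonoid.End M :=
  SpecU.lift (twist_covRel T hε hs h) (twist_commute T hs h _)

noncomputable instance (h : IsWeightModule D ε Qvt M) :
    Module (SpecU D ε' Qvt) (TwistMod T hε hs h) :=
  Module.compHom M (twistHom T hε hs h)

variable {T hε hs} (h : IsWeightModule D ε Qvt M)

theorem toTwist_scalar_smul (c : Qvt) (m : M) :
    SpecU.scalar D ε' Qvt c • toTwist T hε hs h m =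
      toTwist T hε hs h (SpecU.scalar D ε Qvt (rescale s hs c) • m) :=
  DFunLike.congr_fun (SpecU.lift_scalar (twist_covRel T hε hs h) (twist_commute T hs h _) c) m

theorem toTwist_of_smul (y : Gen I Y) (m : M) :
    SpecU.of D ε' Qvt y • toTwist T hε hs h m =
      toTwist T hε hs h (twistGen T ε M ((rescale s hs).comp (spec ε' Qvt)) s y m) :=
  DFunLike.congr_fun (SpecU.lift_of (twist_covRel T hε hs h) (twist_commute T hs h _) y) m

theorem toTwist_E_smul (i : I) {lam : X} {m : M} (hm : m ∈ weightSpace D ε Qvt M lam) :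
    SpecU.of D ε' Qvt (.E i) • toTwist T hε hs h m =
      toTwist T hε hs h (unitScalar D ε s (T.expE i lam) • SpecU.of D ε Qvt (.E i) • m) := by
  rw [toTwist_of_smul, twistGen_E h i hm]

theorem toTwist_F_smul (i : I) {lam : X} {m : M} (hm : m ∈ weightSpace D ε Qvt M lam) :
    SpecU.of D ε' Qvt (.F i) • toTwist T hε hs h m =
      toTwist T hε hs h (unitScalar D ε s (T.expF i lam) • SpecU.of D ε Qvt (.F i) • m) := by
  rw [toTwist_of_smul, twistGen_F h i hm]

theorem toTwist_mem {lam : X} {m : M} (hm : m ∈ weightSpace D ε Qvt M lam) :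
    toTwist T hε hs h m ∈ weightSpace D ε' Qvt (TwistMod T hε hs h) lam := fun ν => by
  rw [toTwist_of_smul, toTwist_of_smul, twistGen_K h ν hm, twistGen_J h ν hm,
    SpecU.algebraMap_eq, SpecU.algebraMap_eq, toTwist_scalar_smul, toTwist_scalar_smul]
  exact ⟨rfl, rfl⟩

theorem isWeightModule_twist : IsWeightModule D ε' Qvt (TwistMod T hε hs h) := by
  rw [isWeightModule_iff, eq_top_iff]
  rintro m -
  obtain ⟨m, rfl⟩ := (toTwist T hε hs h).surjective m
  induction m using h.induction with
  | h0 => rw [map_zero]; exact zero_mem _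
  | hw lam m hm => exact AddSubgroup.mem_iSup_of_mem lam (toTwist_mem h hm)
  | ha m m' h1 h2 => rw [map_add]; exact add_mem h1 h2

theorem toTwist_diag {χ χ' : X → Qvt} (hχ : ∀ lam, rescale s hs (χ' lam) = χ lam) (m : M) :
    toTwist T hε hs h (diag D ε Qvt M χ m) =
      diag D ε' Qvt (TwistMod T hε hs h) χ' (toTwist T hε hs h m) :=
  h.map_diag (isWeightModule_twist h) (toTwist T hε hs h).toAddMonoidHom
    (fun _ _ hm => toTwist_mem h hm)
    (fun lam m _ => by
      refine Eq.trans ?_ (toTwist_scalar_smul h _ _).symm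
      rw [hχ]; rfl) m

theorem toTwist_weightProj (lam : X) (m : M) :
    toTwist T hε hs h (weightProj D ε Qvt M lam m) =
      weightProj D ε' Qvt (TwistMod T hε hs h) lam (toTwist T hε hs h m) := by
  classical
  refine toTwist_diag h (fun μ => ?_) m
  by_cases hμ : μ = lam
  · subst hμ; rw [Pi.single_eq_same, map_one]
  · rw [Pi.single_eq_of_ne hμ, map_zero]

/-- For the converse, the identity map commutes with the weight projections on both sides, so a
vector fixed by the projection of the twist is fixed by that of `M`. -/
theorem toTwist_mem_iff {lam : X} {m : M} :
    toTwist T hε hs h m ∈ weightSpace D ε' Qvt (TwistMod T hε hs h) lam ↔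
      m ∈ weightSpace D ε Qvt M lam := by
  refine ⟨fun hm => ?_, toTwist_mem h⟩
  have h1 := (isWeightModule_twist h).weightProj_apply_self hm
  rw [← toTwist_weightProj] at h1
  rw [← (toTwist T hε hs h).injective h1]
  exact h.weightProj_mem lam m

variable {N : Type w} [AddCommGroup N] [Module (SpecU D ε Qvt) N] (h' : IsWeightModule D ε Qvt N)

/-- The functoriality of the twist. -/
noncomputable def twistMap (g : M →ₗ[SpecU D ε Qvt] N) :
    TwistMod T hε hs h →ₗ[SpecU D ε' Qvt] TwistMod T hε hs h' where
  toFun m := toTwist T hε hs h' (g ((toTwist T hε hs h).symm m))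
  map_add' m m' := by rw [map_add, map_add, map_add]
  map_smul' u m := by
    let g' : TwistMod T hε hs h →+ TwistMod T hε hs h' :=
      ((toTwist T hε hs h').toAddMonoidHom.comp g.toAddMonoidHom).comp
        (toTwist T hε hs h).symm.toAddMonoidHom
    have hg : ∀ m, g' (toTwist T hε hs h m) = toTwist T hε hs h' (g m) := fun _ => rfl
    refine (isWeightModule_twist h).map_smul_of_weights g' ?_ ?_ ?_ ?_ u m
    · intro c m
      obtain ⟨m, rfl⟩ := (toTwist T hε hs h).surjective m
      rw [toTwist_scalar_smul, hg, hg, toTwist_scalar_smul, map_smul]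
    · intro lam m hm
      obtain ⟨m, rfl⟩ := (toTwist T hε hs h).surjective m
      rw [toTwist_mem_iff] at hm
      exact toTwist_mem h' (map_mem_weightSpace g hm)
    · intro i lam m hm
      obtain ⟨m, rfl⟩ := (toTwist T hε hs h).surjective m
      rw [toTwist_mem_iff] at hm
      rw [toTwist_E_smul h i hm, hg, hg, toTwist_E_smul h' i (map_mem_weightSpace g hm), map_smul g,
        map_smul g]
    · intro i lam m hm
      obtain ⟨m, rfl⟩ := (toTwist T hε hs h).surjective m
      rw [toTwist_mem_iff] at hm
      rw [toTwist_F_smul h i hm, hg, hg, toTwist_F_smul h' i (map_mem_weightSpace g hm), map_smul g,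
        map_smul g]

variable (T hε hs) in
/-- The twist as a functor. -/
noncomputable def twistFunctor : WeightModCat.{w} D ε Qvt ⥤ WeightModCat.{w} D ε' Qvt where
  obj M := ⟨ModuleCat.of _ (TwistMod T hε hs M.property), isWeightModule_twist M.property⟩
  map {M N} g := ObjectProperty.homMk (ModuleCat.ofHom (twistMap M.property N.property g.hom.hom))

theorem rescale_zpow {s' : Qvtˣ} (hs' : rescale s hs s' = s') (n : ℤ) :
    rescale s hs ((s' ^ n : Qvtˣ) : Qvt) = ((s' ^ n : Qvtˣ) : Qvt) := by
  have : Units.map (rescale s hs).toMonoidHom s' = s' := Units.ext hs'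
  have h2 := congrArg Units.val (congrArg (· ^ n) this)
  rw [← map_zpow] at h2
  exact h2

/-- The double twist multiplies `E_i` and `F_i` on a weight space by `sⁿ` and `s'ⁿ` with the same
`n`, because weights are preserved; these cancel as `s s' = 1`. On scalars the two rescalings
compose to the identity. -/
theorem twistTwist_smul (h2 : IsWeightModule D ε' Qvt (TwistMod T hε hs h)) (hε' : ε = -ε')
    {s' : Qvtˣ} (hs' : s' ^ 2 = -1) (hss : s * s' = 1)
    (hr : ∀ c, rescale s hs (rescale s' hs' c) = c) (hf : rescale s hs s' = s')
    (u : SpecU D ε Qvt) (m : M) :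
    toTwist T hε' hs' h2 (toTwist T hε hs h (u • m)) =
      u • toTwist T hε' hs' h2 (toTwist T hε hs h m) := by
  have hexp : ∀ (n : ℤ) (m : M), SpecU.scalar D ε Qvt (rescale s hs ((s' ^ n : Qvtˣ) : Qvt)) •
      unitScalar D ε s n • m = m := fun n m => by
    rw [rescale_zpow hf, unitScalar, scalar_smul_smul, ← Units.val_mul, ← mul_zpow, mul_comm s',
      hss, one_zpow, Units.val_one, scalar_one_smul]
  refine h.map_smul_of_weights
    ((toTwist T hε' hs' h2).toAddMonoidHom.comp (toTwist T hε hs h).toAddMonoidHom) ?_ ?_ ?_ ?_ u m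
  all_goals simp only [AddMonoidHom.comp_apply, AddEquiv.coe_toAddMonoidHom]
  · intro c m
    rw [toTwist_scalar_smul h2, toTwist_scalar_smul h, hr]
  · intro lam m hm
    exact toTwist_mem h2 (toTwist_mem h hm)
  · intro i lam m hm
    rw [toTwist_E_smul h2 i (toTwist_mem h hm), toTwist_E_smul h i hm, unitScalar,
      toTwist_scalar_smul, hexp]
  · intro i lam m hm
    rw [toTwist_F_smul h2 i (toTwist_mem h hm), toTwist_F_smul h i hm, unitScalar,
      toTwist_scalar_smul, hexp]

/-- Twisting forth and back gives the original module. -/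
noncomputable def twistTwist (h2 : IsWeightModule D ε' Qvt (TwistMod T hε hs h)) (hε' : ε = -ε')
    {s' : Qvtˣ} (hs' : s' ^ 2 = -1) (hss : s * s' = 1)
    (hr : ∀ c, rescale s hs (rescale s' hs' c) = c) (hf : rescale s hs s' = s') :
    M ≃ₗ[SpecU D ε Qvt] TwistMod T hε' hs' h2 :=
  ((toTwist T hε hs h).trans (toTwist T hε' hs' h2)).toLinearEquiv
    (twistTwist_smul h h2 hε' hs' hss hr hf)

variable (T hε hs) in
/-- Twisting forth and back is isomorphic to the identity functor. -/
noncomputable def twistTwistIso (hε' : ε = -ε') {s' : Qvtˣ} (hs' : s' ^ 2 = -1) (hss : s * s' = 1)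
    (hr : ∀ c, rescale s hs (rescale s' hs' c) = c) (hf : rescale s hs s' = s') :
    𝟭 (WeightModCat.{w} D ε Qvt) ≅ twistFunctor T hε hs ⋙ twistFunctor T hε' hs' :=
  NatIso.ofComponents (fun M => ObjectProperty.isoMk _ (LinearEquiv.toModuleIso
      (twistTwist M.property (isWeightModule_twist M.property) hε' hs' hss hr hf)))
    (fun g => by
      apply ObjectProperty.hom_ext
      apply ModuleCat.hom_ext
      apply LinearMap.ext
      intro m
      rfl)

end TwistMod

/-! ### The equivalence and the twist datum of an order and a transversal -/

section Equivalence

theorem rescale_rescale {s s' : Qvtˣ} (hs : s ^ 2 = -1) (hs' : s' ^ 2 = -1) (hss : s * s' = 1)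
    (hf : rescale s hs s' = s') (c : Qvt) : rescale s hs (rescale s' hs' c) = c := by
  have : (rescale s hs).comp (rescale s' hs') = RingHom.id Qvt := by
    apply Qvt.ringHom_ext
    · rw [RingHom.comp_apply, rescale_v, Units.val_mul, map_mul, hf, rescale_v, ← Units.val_mul,
        ← mul_assoc, mul_comm s', hss, one_mul, RingHom.id_apply]
    · rw [RingHom.comp_apply, rescale_t, rescale_t, RingHom.id_apply]
  exact RingHom.congr_fun this c

theorem rescale_t_inv (s : Qvtˣ) (hs : s ^ 2 = -1) :
    rescale s hs ((tUnit⁻¹ : Qvtˣ) : Qvt) = ((tUnit⁻¹ : Qvtˣ) : Qvt) := by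
  have h := congrArg (fun u => ((u⁻¹ : Qvtˣ) : Qvt)) (map_rescale_t s hs)
  simp only [← map_inv] at h
  exact h

variable {I : Type u₁} {Y : Type u₂} {X : Type u₃} [AddCommGroup Y] [AddCommGroup X]
variable {D : SuperRootDatum I Y X} (T : TwistDatum D)

/-- The equivalence between the categories of weight modules induced by the twistor. -/
noncomputable def twistEquivalence : WeightModCat.{w} D 1 Qvt ≌ WeightModCat.{w} D (-1) Qvt :=
  CategoryTheory.Equivalence.mk
    (twistFunctor T rfl tUnit_sq) (twistFunctor T (neg_neg 1).symm tUnit_inv_sq)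
    (twistTwistIso T rfl tUnit_sq (neg_neg 1).symm tUnit_inv_sq
        (mul_inv_cancel _) (rescale_rescale _ _ (mul_inv_cancel _) (rescale_t_inv _ _))
        (rescale_t_inv _ _))
    -- The counit comes from the same construction with the two signs and `𝐭`, `𝐭⁻¹` exchanged.
    (twistTwistIso T (neg_neg 1).symm tUnit_inv_sq rfl tUnit_sq
        (inv_mul_cancel _) (rescale_rescale _ _ (inv_mul_cancel _) (rescale_t _ _))
        (rescale_t _ _)).symm

/-- The automorphism `v ↦ 𝐭⁻¹ v`, `𝐭 ↦ 𝐭` of `ℚ(v, 𝐭)`. -/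
noncomputable def twistorAut : Qvt ≃+* Qvt :=
  RingEquiv.ofRingHom (rescale tUnit⁻¹ tUnit_inv_sq) (rescale tUnit tUnit_sq)
    (RingHom.ext (rescale_rescale _ _ (inv_mul_cancel _) (rescale_t _ _)))
    (RingHom.ext (rescale_rescale _ _ (mul_inv_cancel _) (rescale_t_inv _ _)))

/-- Adding a root changes the `ℤ[I]`-component by one basis vector and leaves the representative in
`C` fixed. -/
theorem phiDot_add [LinearOrder I] {C : Set X} (hC : IsTransversal D C) (i j : I) (lam : X) :
    phiDot D hC i (lam + D.root j) = phiDot D hC i lam + phi D i j := by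
  set e := Equiv.ofBijective _ hC with he
  have h : e.symm (lam + D.root j) = ((e.symm lam).1 + Finsupp.single j 1, (e.symm lam).2) := by
    rw [Equiv.symm_apply_eq]
    have h1 : Finsupp.linearCombination ℤ D.root (e.symm lam).1 + ((e.symm lam).2 : X) = lam :=
      e.apply_symm_apply lam
    change _ = Finsupp.linearCombination ℤ D.root ((e.symm lam).1 + Finsupp.single j 1) +
      ((e.symm lam).2 : X)
    rw [map_add, Finsupp.linearCombination_single, one_smul, add_right_comm, h1]
  rw [phiDot, phiDot, ← he, h, Finsupp.sum_add_index' (by simp) (by intros; ring),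
    Finsupp.sum_single_index (by simp), one_mul]

/-- The twist datum given by a total order and a transversal. -/
noncomputable def twistDatum (D : SuperRootDatum I Y X) [LinearOrder I] {C : Set X}
    (hC : IsTransversal D C) : TwistDatum D where
  φ := phiDot D hC
  c := phi D
  φ_add i j lam := phiDot_add hC i j lam
  c_self i := by simp [phi]
  c_ne i j hij := by
    -- For `i < j` the expression is `2 d_i a_ij`, divisible by 4 since `d_i a_ij` is even. For `j <
    -- i` it is `-4 p(i) p(j)`.
    rcases lt_or_gt_of_ne hij with h | h
    · rw [phi, phi, if_neg h.not_gt, if_neg hij.symm, if_pos h, ← D.d_mul_a_symm i j]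
      obtain ⟨m, hm⟩ := D.two_dvd_d_mul_a i j
      exact ⟨m, by linarith⟩
    · rw [phi, phi, if_pos h, if_neg h.not_gt, if_neg hij]
      exact ⟨-((D.p i : ℕ) * (D.p j : ℕ)), by ring⟩

section

variable {T} {ε ε' : ℤˣ} {hε : ε' = -ε} {M : Type w} [AddCommGroup M] [Module (SpecU D ε Qvt) M]
variable (h : IsWeightModule D ε Qvt M)

/-- On the twist `c` acts as its image under `v ↦ 𝐭v` acts on `M`. The identity map is therefore
semilinear for the inverse automorphism, which is why `𝐭⁻¹` appears in `twistorAut`. -/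
theorem toTwist_scalar (c : Qvt) (m : M) :
    toTwist T hε tUnit_sq h (SpecU.scalar D ε Qvt c • m) =
      SpecU.scalar D ε' Qvt (twistorAut c) • toTwist T hε tUnit_sq h m := by
  rw [toTwist_scalar_smul, show rescale tUnit tUnit_sq (twistorAut c) = c from
    twistorAut.symm_apply_apply c]

theorem toTwist_E (i : I) {lam : X} {m : M} (hm : m ∈ weightSpace D ε Qvt M lam) :
    toTwist T hε tUnit_sq h (SpecU.of D ε Qvt (.E i) • m) =
      SpecU.scalar D ε' Qvt ((tUnit ^ (-T.expE i lam) : Qvtˣ) : Qvt) •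
        SpecU.of D ε' Qvt (.E i) • toTwist T hε tUnit_sq h m := by
  rw [toTwist_E_smul h i hm, toTwist_scalar_smul, rescale_zpow (rescale_t _ _), ← unitScalar,
    unitScalar_smul_smul, neg_add_cancel, unitScalar, zpow_zero, Units.val_one, scalar_one_smul]

theorem toTwist_F (i : I) {lam : X} {m : M} (hm : m ∈ weightSpace D ε Qvt M lam) :
    toTwist T hε tUnit_sq h (SpecU.of D ε Qvt (.F i) • m) =
      SpecU.scalar D ε' Qvt ((tUnit ^ (-T.expF i lam) : Qvtˣ) : Qvt) •
        SpecU.of D ε' Qvt (.F i) • toTwist T hε tUnit_sq h m := by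
  rw [toTwist_F_smul h i hm, toTwist_scalar_smul, rescale_zpow (rescale_t _ _), ← unitScalar,
    unitScalar_smul_smul, neg_add_cancel, unitScalar, zpow_zero, Units.val_one, scalar_one_smul]

end

theorem isInducedByTwistor_twistEquivalence [LinearOrder I] {C : Set X} (hC : IsTransversal D C) :
    IsInducedByTwistor D hC (twistEquivalence (twistDatum D hC)) := by
  refine ⟨twistorAut, fun M => toTwist (twistDatum D hC) rfl tUnit_sq M.property, ?_, ?_, ?_,
    fun M => ⟨?_, ?_, ?_, ?_⟩⟩
  · exact rescale_v _ _
  · exact rescale_t _ _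
  · exact fun M N g m => rfl
  · exact toTwist_scalar (hε := rfl) (T := twistDatum D hC) M.property
  · exact fun lam m => (toTwist_mem_iff (T := twistDatum D hC) M.property).symm
  · intro i lam m hm
    have h1 := toTwist_E (hε := rfl) (T := twistDatum D hC) M.property i hm
    have h2 : -(twistDatum D hC).expE i lam =
        D.d i * D.pairing (D.coroot i) lam - phiDot D hC i lam := neg_neg _
    rw [h2] at h1
    exact h1
  · intro i lam m hm
    have h1 := toTwist_F (hε := rfl) (T := twistDatum D hC) M.property i hm
    have h2 : -(twistDatum D hC).expF i lam = phiDot D hC i lam := neg_neg _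
    rw [h2] at h1
    exact h1

theorem exists_isTransversal (D : SuperRootDatum I Y X) : ∃ C : Set X, IsTransversal D C := by
  let S := LinearMap.range (Finsupp.linearCombination ℤ D.root)
  refine ⟨Set.range (Quotient.out : X ⧸ S → X), ?_, ?_⟩
  · rintro ⟨ν, _, q, rfl⟩ ⟨ν', _, q', rfl⟩ hx
    dsimp only at hx
    have hq : q = q' := by
      have h1 := congrArg (Submodule.Quotient.mk (p := S)) hx
      rw [Submodule.Quotient.mk_add, Submodule.Quotient.mk_add,
        (Submodule.Quotient.mk_eq_zero S).mpr ⟨ν, rfl⟩,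
        (Submodule.Quotient.mk_eq_zero S).mpr ⟨ν', rfl⟩, zero_add, zero_add] at h1
      exact (Quotient.out_eq q).symm.trans (h1.trans (Quotient.out_eq q'))
    subst hq
    have := D.root_linearIndependent (add_right_cancel hx)
    rw [this]
  · intro lam
    have h1 : lam - Quotient.out (Submodule.Quotient.mk lam : X ⧸ S) ∈ S := by
      rw [← Submodule.Quotient.mk_eq_zero, Submodule.Quotient.mk_sub, sub_eq_zero]
      exact (Quotient.out_eq _).symm
    obtain ⟨ν, hν⟩ := h1
    exact ⟨⟨ν, _, _, rfl⟩, by dsimp only; rw [hν, sub_add_cancel]⟩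

/-- Any order and any transversal will do where only the existence of some twist is needed, as for
the characters. -/
theorem nonempty_twistDatum (D : SuperRootDatum I Y X) : Nonempty (TwistDatum D) := by
  obtain ⟨C, hC⟩ := exists_isTransversal D
  classical
  let : LinearOrder I := linearOrderOfSTO WellOrderingRel
  exact ⟨twistDatum D hC⟩

end Equivalence

/-! ### Highest weight modules -/

section HighestWeight

variable {I : Type u₁} {Y : Type u₂} {X : Type u₃} [AddCommGroup Y] [AddCommGroup X]
variable {D : SuperRootDatum I Y X} {ε : ℤˣ} {R : Type u₄} [CommRing R] [Algebra Qv R]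
variable {V : Type*} [AddCommGroup V] [Module (SpecU D ε R) V]

variable (D ε R V) in
/-- The `R`-module structure on `V` is the restriction of the structure of a module over
`R_ε ⊗ 𝐔`. -/
class ScalarCompatible [Module R V] : Prop where
  scalar_smul (c : R) (v : V) : SpecU.scalar D ε R c • v = c • v

theorem scalar_smul [Module R V] [ScalarCompatible D ε R V] (c : R) (v : V) :
    SpecU.scalar D ε R c • v = c • v :=
  ScalarCompatible.scalar_smul c v

theorem mem_of_stable {W : Type*} [SetLike W V] [AddSubmonoidClass W V] (S : W)
    (hs : ∀ c, ∀ v ∈ S, SpecU.scalar D ε R c • v ∈ S) (ho : ∀ y, ∀ v ∈ S, SpecU.of D ε R y • v ∈ S)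
    (u : SpecU D ε R) {v : V} (hv : v ∈ S) : u • v ∈ S := by
  induction u using SpecU.induction generalizing v with
  | hs c => exact hs c v hv
  | ho y => exact ho y v hv
  | ha u u' h h' => rw [add_smul]; exact add_mem (h hv) (h' hv)
  | hm u u' h h' => rw [mul_smul]; exact h (h' hv)

variable (D ε R) in
/-- The vector `x` of weight `lam` is killed by all `E_i` and generates the module. -/
structure IsHighestWeight (lam : X) (x : V) : Prop where
  mem : x ∈ weightSpace D ε R V lam
  E_smul (i : I) : SpecU.of D ε R (.E i) • x = 0
  span_eq : Submodule.span (SpecU D ε R) {x} = ⊤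

variable (D ε R) in
/-- The vector `F_{i₁} ⋯ F_{iₙ} x`. -/
noncomputable def fWord (x : V) (l : List I) : V := l.foldr (fun i v => SpecU.of D ε R (.F i) • v) x

theorem fWord_nil (x : V) : fWord D ε R x [] = x := rfl

theorem fWord_cons (x : V) (i : I) (l : List I) :
    fWord D ε R x (i :: l) = SpecU.of D ε R (.F i) • fWord D ε R x l := rfl

theorem fWord_mem {lam : X} {x : V} (hx : x ∈ weightSpace D ε R V lam) (l : List I) :
    fWord D ε R x l ∈ weightSpace D ε R V (lam - (l.map D.root).sum) := by
  induction l with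
  | nil => simpa [fWord] using hx
  | cons i l ih =>
    have := F_smul_mem i ih
    rwa [sub_sub, add_comm _ (D.root i), ← List.sum_cons, ← List.map_cons] at this

theorem IsHighestWeight.eq_top_of_mem {lam : X} {x : V} (h : IsHighestWeight D ε R lam x)
    {N : Submodule (SpecU D ε R) V} (hx : x ∈ N) : N = ⊤ := by
  rw [eq_top_iff, ← h.span_eq, Submodule.span_singleton_le_iff_mem]
  exact hx

variable [Module R V] [ScalarCompatible D ε R V]

theorem algebraMap_smul_eq (a : QvPi) (v : V) :
    algebraMap QvPi (SpecU D ε R) a • v = spec ε R a • v := by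
  rw [SpecU.algebraMap_eq, scalar_smul]

theorem smul_smul_comm_scalar (u : SpecU D ε R) (c : R) (v : V) : u • c • v = c • u • v := by
  rw [← scalar_smul (D := D) (ε := ε), smul_scalar_smul, scalar_smul]

variable (D ε R V) in
/-- The weight space as an `R`-submodule. -/
def weightSubmodule (μ : X) : Submodule R V where
  __ := weightSpace D ε R V μ
  smul_mem' c v hv := by
    rw [← scalar_smul (D := D) (ε := ε)]
    exact scalar_smul_mem c hv

variable (D ε R) in
/-- The span of the vectors `F_{i₁} ⋯ F_{iₙ} x`. -/
def fSpan (x : V) : Submodule R V := Submodule.span R (Set.range (fWord D ε R x))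

theorem F_smul_mem_fSpan {x v : V} (i : I) (hv : v ∈ fSpan D ε R x) :
    SpecU.of D ε R (.F i) • v ∈ fSpan D ε R x := by
  induction hv using Submodule.span_induction with
  | mem v hv =>
    obtain ⟨l, rfl⟩ := hv
    exact Submodule.subset_span ⟨i :: l, rfl⟩
  | zero => rw [smul_zero]; exact zero_mem _
  | add v w _ _ h h' => rw [smul_add]; exact add_mem h h'
  | smul c v _ h => rw [smul_smul_comm_scalar]; exact Submodule.smul_mem _ _ h

theorem K_smul_fWord_mem {lam : X} {x : V} (hx : x ∈ weightSpace D ε R V lam) (ν : Y)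
    (l : List I) : SpecU.of D ε R (.K ν) • fWord D ε R x l ∈ fSpan D ε R x := by
  rw [(fWord_mem hx l ν).1, algebraMap_smul_eq]
  exact Submodule.smul_mem _ _ (Submodule.subset_span ⟨l, rfl⟩)

theorem J_smul_fWord_mem {lam : X} {x : V} (hx : x ∈ weightSpace D ε R V lam) (ν : Y)
    (l : List I) : SpecU.of D ε R (.J ν) • fWord D ε R x l ∈ fSpan D ε R x := by
  rw [(fWord_mem hx l ν).2, algebraMap_smul_eq]
  exact Submodule.smul_mem _ _ (Submodule.subset_span ⟨l, rfl⟩)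

theorem smul_mem_fSpan {x v : V} {y : Gen I Y}
    (h : ∀ l, SpecU.of D ε R y • fWord D ε R x l ∈ fSpan D ε R x) (hv : v ∈ fSpan D ε R x) :
    SpecU.of D ε R y • v ∈ fSpan D ε R x := by
  induction hv using Submodule.span_induction with
  | mem v hv =>
    obtain ⟨l, rfl⟩ := hv
    exact h l
  | zero => rw [smul_zero]; exact zero_mem _
  | add v w _ _ h h' => rw [smul_add]; exact add_mem h h'
  | smul c v _ h => rw [smul_smul_comm_scalar]; exact Submodule.smul_mem _ _ h

/-- `E_i` is moved to the right through the word until it kills `x`. The commutators only produce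
`J` and `K`, which act on words by scalars. -/
theorem E_smul_fWord_mem {lam : X} {x : V} (hx : x ∈ weightSpace D ε R V lam)
    (hE : ∀ i, SpecU.of D ε R (.E i) • x = 0) (i : I) (l : List I) :
    SpecU.of D ε R (.E i) • fWord D ε R x l ∈ fSpan D ε R x := by
  induction l with
  | nil => rw [fWord_nil, hE]; exact zero_mem _
  | cons j l ih =>
    rw [fWord_cons, smul_smul]
    by_cases hij : i = j
    · subst hij
      rw [eq_add_of_sub_eq ((SpecU.covRel D ε R).E_F_same i), add_smul, mul_smul, mul_smul,
        mul_smul, sub_smul, mul_smul, algebraMap_smul_eq, algebraMap_smul_eq]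
      exact add_mem (Submodule.smul_mem _ _ (sub_mem
        (smul_mem_fSpan (J_smul_fWord_mem hx _) (K_smul_fWord_mem hx _ l))
        (K_smul_fWord_mem hx _ l))) (Submodule.smul_mem _ _ (F_smul_mem_fSpan i ih))
    · rw [eq_add_of_sub_eq ((SpecU.covRel D ε R).E_F_ne i j hij), zero_add, mul_smul, mul_smul,
        algebraMap_smul_eq]
      exact Submodule.smul_mem _ _ (F_smul_mem_fSpan j ih)

/-- The span of the words contains `x` and is stable under all generators. This replaces a
triangular decomposition of the algebra. -/
theorem IsHighestWeight.fSpan_eq_top {lam : X} {x : V} (h : IsHighestWeight D ε R lam x) :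
    fSpan D ε R x = ⊤ := by
  rw [eq_top_iff]
  rintro v -
  have hv : v ∈ Submodule.span (SpecU D ε R) {x} := by rw [h.span_eq]; trivial
  obtain ⟨u, rfl⟩ := Submodule.mem_span_singleton.mp hv
  refine mem_of_stable (fSpan D ε R x) (fun c v hv => ?_) (fun y v hv => ?_) u
    (Submodule.subset_span ⟨[], rfl⟩)
  · rw [scalar_smul]; exact Submodule.smul_mem _ _ hv
  · refine smul_mem_fSpan (fun l => ?_) hv
    cases y with
    | E i => exact E_smul_fWord_mem h.mem h.E_smul i l
    | F i => exact Submodule.subset_span ⟨i :: l, rfl⟩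
    | K ν => exact K_smul_fWord_mem h.mem ν l
    | J ν => exact J_smul_fWord_mem h.mem ν l

theorem IsHighestWeight.isWeightModule {lam : X} {x : V} (h : IsHighestWeight D ε R lam x) :
    IsWeightModule D ε R V := by
  rw [isWeightModule_iff, eq_top_iff]
  rintro v -
  have hv : v ∈ fSpan D ε R x := by rw [h.fSpan_eq_top]; trivial
  induction hv using Submodule.span_induction with
  | mem v hv =>
    obtain ⟨l, rfl⟩ := hv
    exact AddSubgroup.mem_iSup_of_mem _ (fWord_mem h.mem l)
  | zero => exact zero_mem _
  | add v w _ _ h h' => exact add_mem h h'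
  | smul c v _ hv =>
    rw [← scalar_smul (D := D) (ε := ε)]
    refine AddSubgroup.iSup_induction (weightSpace D ε R V)
      (C := fun v => SpecU.scalar D ε R c • v ∈ ⨆ μ, weightSpace D ε R V μ) hv
      (fun μ v hv => AddSubgroup.mem_iSup_of_mem _ (scalar_smul_mem c hv)) ?_
      (fun v w h h' => ?_)
    · rw [smul_zero]; exact zero_mem _
    · rw [smul_add]; exact add_mem h h'

variable (D ε R V) in
/-- The projection onto a weight space, as a linear map. -/
noncomputable def weightProjₗ (h : IsWeightModule D ε R V) (μ : X) : V →ₗ[R] V where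
  __ := weightProj D ε R V μ
  map_smul' c v := by
    have : weightProj D ε R V μ (SpecU.scalar D ε R c • v) =
      SpecU.scalar D ε R c • weightProj D ε R V μ v := (h.scalar_diag c _ v).symm
    rw [scalar_smul, scalar_smul] at this
    exact this

/-- The weight projection fixes the words of weight `μ` and kills all others. -/
theorem IsHighestWeight.weightSubmodule_le {lam : X} {x : V} (h : IsHighestWeight D ε R lam x)
    (μ : X) : weightSubmodule D ε R V μ ≤
      Submodule.span R (fWord D ε R x '' {l | (l.map D.root).sum = lam - μ}) := by
  intro v hv
  rw [← h.isWeightModule.weightProj_apply_self hv]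
  have hv : v ∈ fSpan D ε R x := by rw [h.fSpan_eq_top]; trivial
  change weightProjₗ D ε R V h.isWeightModule μ v ∈ _
  have := Submodule.mem_map_of_mem (f := weightProjₗ D ε R V h.isWeightModule μ) hv
  rw [fSpan, Submodule.map_span] at this
  refine Submodule.span_le.mpr ?_ this
  rintro _ ⟨_, ⟨l, rfl⟩, rfl⟩
  change weightProj D ε R V μ _ ∈ _
  by_cases hl : lam - (l.map D.root).sum = μ
  · subst hl
    rw [h.isWeightModule.weightProj_apply_self (fWord_mem h.mem l)]
    exact Submodule.subset_span ⟨l, by simp, rfl⟩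
  · rw [h.isWeightModule.weightProj_apply_ne hl (fWord_mem h.mem l)]
    exact zero_mem _

/-- Linear independence of the roots recovers the element of `ℕ[I]` from its weight, and the length
is the sum of its coordinates. For finite `I` only finitely many words then have a given weight. -/
theorem SuperRootDatum.length_eq (D : SuperRootDatum I Y X) {l l' : List I}
    (h : (l.map D.root).sum = (l'.map D.root).sum) : l.length = l'.length := by
  have key : ∀ l : List I, (l.map D.root).sum =
      Finsupp.linearCombination ℤ D.root (l.map fun i => Finsupp.single i 1).sum := fun l => by
    rw [map_list_sum, List.map_map]
    congr 2
    ext i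
    simp
  have hlen : ∀ l : List I, Finsupp.linearCombination ℤ (fun _ : I => (1 : ℤ))
      (l.map fun i => Finsupp.single i 1).sum = l.length := fun l => by
    rw [map_list_sum, List.map_map]
    induction l with
    | nil => simp
    | cons i l ih => simp_all [add_comm]
  rw [key, key] at h
  have := congrArg (Finsupp.linearCombination ℤ (fun _ : I => (1 : ℤ))) (D.root_linearIndependent h)
  rw [hlen, hlen] at this
  exact_mod_cast this

theorem SuperRootDatum.finite_words [Finite I] (D : SuperRootDatum I Y X) (β : X) :
    {l : List I | (l.map D.root).sum = β}.Finite := by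
  rcases Set.eq_empty_or_nonempty {l : List I | (l.map D.root).sum = β} with h | ⟨l₀, h₀⟩
  · rw [h]; exact Set.finite_empty
  · exact (List.finite_length_eq I l₀.length).subset fun l hl => D.length_eq (hl.trans h₀.symm)

theorem IsHighestWeight.finite_weightSubmodule [Finite I] [IsNoetherianRing R] {lam : X} {x : V}
    (h : IsHighestWeight D ε R lam x) (μ : X) : Module.Finite R (weightSubmodule D ε R V μ) := by
  have := isNoetherian_span_of_finite R ((D.finite_words (lam - μ)).image (fWord D ε R x))
  have := isNoetherian_of_le (h.weightSubmodule_le μ)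
  infer_instance

/-- The empty word is the only word whose roots sum to zero. -/
theorem IsHighestWeight.exists_eq_smul {lam : X} {x v : V} (h : IsHighestWeight D ε R lam x)
    (hv : v ∈ weightSpace D ε R V lam) : ∃ c : R, v = c • x := by
  have h1 := h.weightSubmodule_le lam hv
  have h2 : {l : List I | (l.map D.root).sum = lam - lam} = {[]} := by
    ext l
    rw [sub_self, Set.mem_ofPred_eq, Set.mem_singleton_iff, ← List.length_eq_zero_iff]
    exact ⟨fun hl => D.length_eq (l' := []) hl, fun hl => by
      rw [List.length_eq_zero_iff.mp hl]; rfl⟩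
  rw [h2, Set.image_singleton, Submodule.mem_span_singleton] at h1
  obtain ⟨c, hc⟩ := h1
  exact ⟨c, hc.symm⟩

end HighestWeight

/-! ### Verma modules and their simple quotients -/

section SimpleModules

variable {I : Type u₁} {Y : Type u₂} {X : Type u₃} [AddCommGroup Y] [AddCommGroup X]
variable {D : SuperRootDatum I Y X} {ε : ℤˣ} {R : Type u₄} [CommRing R] [Algebra Qv R]
variable {V : Type*} [AddCommGroup V] [Module (SpecU D ε R) V]
variable {V' : Type*} [AddCommGroup V'] [Module (SpecU D ε R) V']

theorem IsHighestWeight.map {lam : X} {x : V} (h : IsHighestWeight D ε R lam x)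
    {g : V →ₗ[SpecU D ε R] V'} (hg : Function.Surjective g) : IsHighestWeight D ε R lam (g x) where
  mem := map_mem_weightSpace g h.mem
  E_smul i := by rw [← map_smul, h.E_smul, map_zero]
  span_eq := by
    rw [← Set.image_singleton, ← Submodule.map_span, h.span_eq, Submodule.map_top,
      LinearMap.range_eq_top.mpr hg]

theorem vermaIdeal_le {lam : X} {N : Submodule (SpecU D ε R) (SpecU D ε R)}
    (hE : ∀ i, SpecU.of D ε R (.E i) ∈ N)
    (hK : ∀ ν, SpecU.of D ε R (.K ν) - algebraMap QvPi (SpecU D ε R)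
      ((vUnit QvPi ^ D.pairing ν lam : QvPiˣ) : QvPi) ∈ N)
    (hJ : ∀ ν, SpecU.of D ε R (.J ν) - algebraMap QvPi (SpecU D ε R)
      ((piUnit ^ D.pairing ν lam : QvPiˣ) : QvPi) ∈ N) : vermaIdeal D ε R lam ≤ N := by
  refine Submodule.span_le.mpr ?_
  rintro _ ((⟨i, rfl⟩ | ⟨ν, rfl⟩) | ⟨ν, rfl⟩)
  exacts [hE i, hK ν, hJ ν]

variable (D ε R) in
/-- The generator of the Verma module. -/
noncomputable def vermaGen (lam : X) : Verma D ε R lam := Submodule.Quotient.mk 1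

variable (D ε R) in
theorem isHighestWeight_vermaGen (lam : X) : IsHighestWeight D ε R lam (vermaGen D ε R lam) := by
  have hsmul : ∀ u, u • vermaGen D ε R lam = Submodule.Quotient.mk u := fun u => by
    rw [vermaGen, ← Submodule.Quotient.mk_smul, smul_eq_mul, mul_one]
  refine ⟨fun ν => ⟨?_, ?_⟩, fun i => ?_, ?_⟩
  · rw [hsmul, hsmul, Submodule.Quotient.eq]
    exact Submodule.subset_span (Or.inl (Or.inr ⟨ν, rfl⟩))
  · rw [hsmul, hsmul, Submodule.Quotient.eq]
    exact Submodule.subset_span (Or.inr ⟨ν, rfl⟩)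
  · rw [hsmul, Submodule.Quotient.mk_eq_zero]
    exact Submodule.subset_span (Or.inl (Or.inl ⟨i, rfl⟩))
  · rw [eq_top_iff]
    rintro v -
    obtain ⟨u, rfl⟩ := Submodule.Quotient.mk_surjective _ v
    exact Submodule.mem_span_singleton.mpr ⟨u, hsmul u⟩

variable (D ε) in
/-- The highest weight vector of `V(lam)`. -/
noncomputable def simpleGen (lam : X) : SimpleV D ε lam :=
  (vermaRadical D ε Qv lam).mkQ (vermaGen D ε Qv lam)

variable (D ε) in
theorem isHighestWeight_simpleGen (lam : X) : IsHighestWeight D ε Qv lam (simpleGen D ε lam) :=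
  (isHighestWeight_vermaGen D ε Qv lam).map (Submodule.mkQ_surjective _)

/-- A proper submodule has proper preimage in the Verma module, and this preimage lies in the sum of
all proper submodules, which has been divided out. -/
theorem SimpleV.eq_bot {lam : X} {N : Submodule (SpecU D ε Qv) (SimpleV D ε lam)} (hN : N ≠ ⊤) :
    N = ⊥ := by
  have h1 : N.comap (vermaRadical D ε Qv lam).mkQ ≤ vermaRadical D ε Qv lam := by
    refine le_sSup fun h => hN ?_
    rw [← Submodule.map_comap_eq_of_surjective (Submodule.mkQ_surjective _) N, h, Submodule.map_top,
      Submodule.range_mkQ]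
  rw [← Submodule.map_comap_eq_of_surjective (Submodule.mkQ_surjective _) N, eq_bot_iff]
  refine (Submodule.map_mono h1).trans ?_
  rw [Submodule.mkQ_map_self]

/-- A submodule on which the projection to the highest weight space vanishes is zero. -/
theorem SimpleV.eq_bot_of_weightProj {lam : X} {N : Submodule (SpecU D ε Qv) (SimpleV D ε lam)}
    (h : IsWeightModule D ε Qv (SimpleV D ε lam))
    (hN : ∀ v ∈ N, weightProj D ε Qv (SimpleV D ε lam) lam v = 0) : N = ⊥ := by
  -- If `N = ⊤`, the generator equals its own projection, hence is zero, and the whole module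
  -- vanishes. Thus the argument does not depend on `V(lam) ≠ 0`.
  by_cases ht : N = ⊤
  · have hx := isHighestWeight_simpleGen D ε lam
    have h0 : simpleGen D ε lam = 0 := by
      rw [← h.weightProj_apply_self hx.mem]
      exact hN _ (by rw [ht]; trivial)
    rw [ht, ← hx.span_eq, h0, Submodule.span_zero_singleton]
  · exact SimpleV.eq_bot ht

variable (D ε R V) in
/-- The `R`-module structure of a module over `R_ε ⊗ 𝐔`. -/
noncomputable abbrev scalarModule : Module R V := Module.compHom V (SpecU.scalarHom D ε R)

variable (D ε R V) in
theorem scalarModule_compatible :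
    letI := scalarModule D ε R V
    ScalarCompatible D ε R V :=
  letI := scalarModule D ε R V
  ⟨fun _ _ => rfl⟩

theorem isWeightModule_verma (lam : X) : IsWeightModule D ε R (Verma D ε R lam) :=
  letI := scalarModule D ε R (Verma D ε R lam)
  haveI := scalarModule_compatible D ε R (Verma D ε R lam)
  (isHighestWeight_vermaGen D ε R lam).isWeightModule

theorem isWeightModule_simpleV (lam : X) : IsWeightModule D ε Qv (SimpleV D ε lam) :=
  (isWeightModule_verma lam).of_surjective (Submodule.mkQ_surjective _)

/-- The projection to the highest weight space vanishes on the proper submodules of a Verma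
module over a field. -/
theorem weightProj_eq_zero_of_ne_top {lam : X} {N : Submodule (SpecU D ε Qv) (Verma D ε Qv lam)}
    (hN : N ≠ ⊤) {v : Verma D ε Qv lam} (hv : v ∈ N) :
    weightProj D ε Qv (Verma D ε Qv lam) lam v = 0 := by
  let := scalarModule D ε Qv (Verma D ε Qv lam)
  have := scalarModule_compatible D ε Qv (Verma D ε Qv lam)
  have hw := isWeightModule_verma (D := D) (ε := ε) (R := Qv) lam
  have hx := isHighestWeight_vermaGen D ε Qv lam
  obtain ⟨c, hc⟩ := hx.exists_eq_smul (hw.weightProj_mem lam v)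
  by_cases h0 : c = 0
  · rw [hc, h0, zero_smul]
  -- A nonzero component `c • x` of `v` lies in `N`; inverting `c` puts the generator into `N`.
  · refine absurd (hx.eq_top_of_mem (N := N) ?_) hN
    have h1 : c • vermaGen D ε Qv lam ∈ N := hc ▸ hw.diag_mem N _ hv
    have h2 := N.smul_mem (SpecU.scalar D ε Qv c⁻¹) h1
    rwa [scalar_smul, smul_smul, inv_mul_cancel₀ h0, one_smul] at h2

theorem finite_simpleVWeightSpace [Finite I] (lam μ : X) :
    Module.Finite (SpecAt ε Qv) (simpleVWeightSpace D ε lam μ) := by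
  let := scalarModule D ε Qv (SimpleV D ε lam)
  have := scalarModule_compatible D ε Qv (SimpleV D ε lam)
  have := (isHighestWeight_simpleGen D ε lam).finite_weightSubmodule μ
  have hσ : RingHomSurjective (SpecAt.of ε Qv).toRingHom := ⟨(SpecAt.of ε Qv).surjective⟩
  let f : weightSubmodule D ε Qv (SimpleV D ε lam) μ →ₛₗ[(SpecAt.of ε Qv).toRingHom]
      simpleVWeightSpace D ε lam μ :=
    { toFun := fun v => ⟨v.1, v.2⟩
      map_add' := fun _ _ => rfl
      map_smul' := fun c v => Subtype.ext (algebraMap_smul (SpecU D ε Qv) (SpecAt.of ε Qv c) v.1) }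
  exact Module.Finite.of_surjective f fun v => ⟨⟨v.1, v.2⟩, rfl⟩

/-- This exchanges the scalars `SpecAt ε Qv` for `Qv`, so that both signs can be compared over one
field. -/
theorem character_eq (lam μ : X) :
    letI := scalarModule D ε Qv (SimpleV D ε lam)
    haveI := scalarModule_compatible D ε Qv (SimpleV D ε lam)
    character D ε lam μ = Module.finrank Qv (weightSubmodule D ε Qv (SimpleV D ε lam) μ) := by
  let := scalarModule D ε Qv (SimpleV D ε lam)
  have := scalarModule_compatible D ε Qv (SimpleV D ε lam)
  let e : weightSubmodule D ε Qv (SimpleV D ε lam) μ ≃+ simpleVWeightSpace D ε lam μ :=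
    { toFun := fun v => ⟨v.1, v.2⟩
      invFun := fun v => ⟨v.1, v.2⟩
      map_add' := fun _ _ => rfl }
  exact (congrArg Cardinal.toNat (rank_eq_of_equiv_equiv (SpecAt.of ε Qv) e
    (SpecAt.of ε Qv).bijective fun c v =>
      Subtype.ext (algebraMap_smul (SpecU D ε Qv) (SpecAt.of ε Qv c) v.1))).symm

end SimpleModules

/-! ### Base change -/

section BaseChange

variable {I : Type u₁} {Y : Type u₂} {X : Type u₃} [AddCommGroup Y] [AddCommGroup X]
variable (D : SuperRootDatum I Y X) (ε : ℤˣ)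
variable (K : Type*) [CommRing K] [Algebra Qv K]

/-- The homomorphism `𝐔|_{π = ε} → K ⊗ 𝐔|_{π = ε}`. -/
noncomputable def extendScalars : SpecU D ε Qv →+* SpecU D ε K :=
  SpecU.lift (ρ := (SpecU.scalarHom D ε K).comp (algebraMap Qv K)) (x := SpecU.of D ε K)
    (by
      have h := SpecU.covRel D ε K
      have he : ((SpecU.scalarHom D ε K).comp (algebraMap Qv K)).comp (spec ε Qv) =
          algebraMap QvPi (SpecU D ε K) := by
        rw [RingHom.comp_assoc, spec_comp ε (algebraMap Qv K) (by ext; rfl)]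
        exact RingHom.ext fun a => (SpecU.algebraMap_eq D ε K a).symm
      rwa [he])
    (fun c y => SpecU.scalar_commute D ε K _ _)

theorem extendScalars_scalar (c : Qv) :
    extendScalars D ε K (SpecU.scalar D ε Qv c) = SpecU.scalar D ε K (algebraMap Qv K c) :=
  SpecU.lift_scalar _ _ c

theorem extendScalars_of (y : Gen I Y) :
    extendScalars D ε K (SpecU.of D ε Qv y) = SpecU.of D ε K y :=
  SpecU.lift_of _ _ y

theorem extendScalars_algebraMap (a : QvPi) :
    extendScalars D ε K (algebraMap QvPi (SpecU D ε Qv) a) = algebraMap QvPi (SpecU D ε K) a := by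
  rw [SpecU.algebraMap_eq, extendScalars_scalar, SpecU.algebraMap_eq,
    ← RingHom.comp_apply, spec_comp ε (algebraMap Qv K) (by ext; rfl)]

variable {D ε K}
variable {V : Type*} [AddCommGroup V] [Module (SpecU D ε Qv) V]
variable {T : Type*} [AddCommGroup T] [Module (SpecU D ε K) T]

theorem map_mem_weightSpace_of_extendScalars (g : V →ₛₗ[extendScalars D ε K] T) {μ : X} {v : V}
    (hv : v ∈ weightSpace D ε Qv V μ) : g v ∈ weightSpace D ε K T μ := fun ν => by
  constructor
  · rw [← extendScalars_of D ε K, ← g.map_smulₛₗ, (hv ν).1, g.map_smulₛₗ, extendScalars_algebraMap]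
  · rw [← extendScalars_of D ε K, ← g.map_smulₛₗ, (hv ν).2, g.map_smulₛₗ, extendScalars_algebraMap]

theorem map_weightProj_of_extendScalars (g : V →ₛₗ[extendScalars D ε K] T)
    (h : IsWeightModule D ε Qv V) (h' : IsWeightModule D ε K T) (μ : X) (v : V) :
    g (weightProj D ε Qv V μ v) = weightProj D ε K T μ (g v) := by
  classical
  refine h.map_diag h' g.toAddMonoidHom (fun _ _ hm => map_mem_weightSpace_of_extendScalars g hm)
    (fun lam m hm => ?_) v
  refine (g.map_smulₛₗ _ _).trans ?_
  rw [extendScalars_scalar]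
  by_cases hμ : lam = μ
  · subst hμ; rw [Pi.single_eq_same, map_one, Pi.single_eq_same]; rfl
  · rw [Pi.single_eq_of_ne hμ, map_zero, Pi.single_eq_of_ne hμ]; rfl

/-- The `K`-span of the image of a submodule is a submodule. -/
theorem mem_closure_of_mem_span (g : V →ₛₗ[extendScalars D ε K] T)
    (N : Submodule (SpecU D ε Qv) V) {z : T} (hz : z ∈ Submodule.span (SpecU D ε K) (g '' N)) :
    z ∈ AddSubgroup.closure {z | ∃ c : K, ∃ v ∈ N, z = SpecU.scalar D ε K c • g v} := by
  induction hz using Submodule.span_induction with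
  | mem z hz =>
    obtain ⟨v, hv, rfl⟩ := hz
    exact AddSubgroup.subset_closure ⟨1, v, hv, (scalar_one_smul _).symm⟩
  | zero => exact zero_mem _
  | add z z' _ _ h h' => exact add_mem h h'
  | smul u z _ h =>
    refine mem_of_stable _ (fun c z hz => ?_) (fun y z hz => ?_) u h
    · induction hz using AddSubgroup.closure_induction with
      | mem z hz =>
        obtain ⟨c', v, hv, rfl⟩ := hz
        exact AddSubgroup.subset_closure ⟨c * c', v, hv, scalar_smul_smul _ _ _⟩
      | zero => rw [smul_zero]; exact zero_mem _
      | add z z' _ _ h h' => rw [smul_add]; exact add_mem h h'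
      | neg z _ h => rw [smul_neg]; exact neg_mem h
    · induction hz using AddSubgroup.closure_induction with
      | mem z hz =>
        obtain ⟨c', v, hv, rfl⟩ := hz
        refine AddSubgroup.subset_closure ⟨c', SpecU.of D ε Qv y • v, N.smul_mem _ hv, ?_⟩
        rw [smul_scalar_smul, g.map_smulₛₗ, extendScalars_of]
      | zero => rw [smul_zero]; exact zero_mem _
      | add z z' _ _ h h' => rw [smul_add]; exact add_mem h h'
      | neg z _ h => rw [smul_neg]; exact neg_mem h

/-- The homomorphism from a Verma module given by a vector of the highest weight. -/
theorem exists_vermaHom {lam : X} {z : T} (hz : z ∈ weightSpace D ε K T lam)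
    (hE : ∀ i, SpecU.of D ε K (.E i) • z = 0) :
    ∃ g : Verma D ε Qv lam →ₛₗ[extendScalars D ε K] T, g (vermaGen D ε Qv lam) = z := by
  let g : SpecU D ε Qv →ₛₗ[extendScalars D ε K] T :=
    { toFun := fun u => extendScalars D ε K u • z
      map_add' := fun u u' => by rw [map_add, add_smul]
      map_smul' := fun u u' => by rw [smul_eq_mul, map_mul, mul_smul] }
  refine ⟨(vermaIdeal D ε Qv lam).liftQ g (vermaIdeal_le (fun i => ?_) (fun ν => ?_) fun ν => ?_),
    ?_⟩
  · change extendScalars D ε K _ • z = 0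
    rw [extendScalars_of, hE]
  · change extendScalars D ε K _ • z = 0
    rw [map_sub, extendScalars_of, extendScalars_algebraMap, sub_smul, (hz ν).1, sub_self]
  · change extendScalars D ε K _ • z = 0
    rw [map_sub, extendScalars_of, extendScalars_algebraMap, sub_smul, (hz ν).2, sub_self]
  · change extendScalars D ε K 1 • z = z
    rw [map_one, one_smul]

end BaseChange

/-! ### The module `K ⊗ V` and its coordinates in `V` -/

section BaseChangeModule

variable {I : Type u₁} {Y : Type u₂} {X : Type u₃} [AddCommGroup Y] [AddCommGroup X]
variable (D : SuperRootDatum I Y X) (ε : ℤˣ)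
variable (K : Type*) [CommRing K] [Algebra Qv K]
variable (V : Type*) [AddCommGroup V] [Module (SpecU D ε Qv) V]
variable [Module Qv V] [ScalarCompatible D ε Qv V]

/-- The action on a module by `ℚ(v)`-linear endomorphisms. -/
noncomputable def actionHom : SpecU D ε Qv →+* Module.End Qv V where
  toFun u :=
    { toFun := fun v => u • v
      map_add' := smul_add u
      map_smul' := fun c v => smul_smul_comm_scalar u c v }
  map_one' := LinearMap.ext fun v => one_smul _ v
  map_mul' u u' := LinearMap.ext fun v => mul_smul u u' v
  map_zero' := LinearMap.ext fun v => zero_smul _ v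
  map_add' u u' := LinearMap.ext fun v => add_smul u u' v

/-- The relations on `V` are pushed forward along `u ↦ id ⊗ u`. Their coefficients act on `V`
through `ℚ(v)`, hence on `K ⊗ V` through its image in `K`. -/
theorem baseChange_covRel :
    CovRel D ((algebraMap K (Module.End K (K ⊗[Qv] V))).comp (spec ε K))
      (fun y => Module.End.baseChangeHom Qv K V (actionHom D ε V (SpecU.of D ε Qv y))) := by
  have h := (SpecU.covRel D ε Qv).map (B := Module.End K (K ⊗[Qv] V))
    ((Module.End.baseChangeHom Qv K V).toRingHom.comp (actionHom D ε V))
  have he : ((Module.End.baseChangeHom Qv K V).toRingHom.comp (actionHom D ε V)).comp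
      (algebraMap QvPi (SpecU D ε Qv)) =
      (algebraMap K (Module.End K (K ⊗[Qv] V))).comp (spec ε K) := by
    rw [← spec_comp ε (algebraMap Qv K) (by ext; rfl)]
    refine RingHom.ext fun a => ?_
    have h1 : actionHom D ε V (algebraMap QvPi (SpecU D ε Qv) a) =
        algebraMap Qv (Module.End Qv V) (spec ε Qv a) :=
      LinearMap.ext fun v => algebraMap_smul_eq a v
    refine (congrArg (Module.End.baseChangeHom Qv K V) h1).trans ?_
    rw [AlgHom.commutes, IsScalarTower.algebraMap_apply Qv K]
    rfl
  rw [he] at h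
  exact h

/-- The action of `K ⊗ 𝐔|_{π = ε}` on `K ⊗ V`. -/
noncomputable def baseChangeAction : SpecU D ε K →+* Module.End K (K ⊗[Qv] V) :=
  SpecU.lift (baseChange_covRel D ε K V) fun c _ => Algebra.commutes c _

noncomputable instance : Module (SpecU D ε K) (K ⊗[Qv] V) :=
  Module.compHom (K ⊗[Qv] V) (baseChangeAction D ε K V)

instance : ScalarCompatible D ε K (K ⊗[Qv] V) where
  scalar_smul c z := LinearMap.congr_fun
    (SpecU.lift_scalar (baseChange_covRel D ε K V) (fun c _ => Algebra.commutes c _) c) z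

variable {D ε K V}

theorem of_smul_tmul (y : Gen I Y) (c : K) (v : V) :
    SpecU.of D ε K y • (c ⊗ₜ[Qv] v) = c ⊗ₜ[Qv] (SpecU.of D ε Qv y • v) :=
  LinearMap.congr_fun
    (SpecU.lift_of (baseChange_covRel D ε K V) (fun c _ => Algebra.commutes c _) y) (c ⊗ₜ[Qv] v)

theorem extendScalars_smul_tmul (u : SpecU D ε Qv) (c : K) (v : V) :
    extendScalars D ε K u • (c ⊗ₜ[Qv] v) = c ⊗ₜ[Qv] (u • v) := by
  induction u using SpecU.induction generalizing v with
  | hs a =>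
    rw [extendScalars_scalar, scalar_smul, scalar_smul, algebraMap_smul, TensorProduct.tmul_smul]
  | ho y => rw [extendScalars_of, of_smul_tmul]
  | ha u u' h h' => rw [map_add, add_smul, add_smul, h, h', TensorProduct.tmul_add]
  | hm u u' h h' => rw [map_mul, mul_smul, mul_smul, h', h]

variable (D ε K V) in
/-- The map `v ↦ 1 ⊗ v`. -/
noncomputable def toBaseChange : V →ₛₗ[extendScalars D ε K] K ⊗[Qv] V where
  toFun v := 1 ⊗ₜ[Qv] v
  map_add' := TensorProduct.tmul_add 1
  map_smul' u v := (extendScalars_smul_tmul u 1 v).symm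

theorem tmul_eq (c : K) (v : V) :
    c ⊗ₜ[Qv] v = SpecU.scalar D ε K c • toBaseChange D ε K V v := by
  rw [scalar_smul]
  change _ = c • ((1 : K) ⊗ₜ[Qv] v)
  rw [TensorProduct.smul_tmul', smul_eq_mul, mul_one]

variable (K) in
theorem IsWeightModule.baseChange (h : IsWeightModule D ε Qv V) :
    IsWeightModule D ε K (K ⊗[Qv] V) := by
  rw [isWeightModule_iff, eq_top_iff]
  rintro z -
  induction z using TensorProduct.induction_on with
  | zero => exact zero_mem _
  | add z z' h h' => exact add_mem h h'
  | tmul c v =>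
    induction v using h.induction with
    | h0 => rw [TensorProduct.tmul_zero]; exact zero_mem _
    | ha v v' h h' => rw [TensorProduct.tmul_add]; exact add_mem h h'
    | hw μ v hv =>
      rw [tmul_eq (D := D) (ε := ε)]
      exact AddSubgroup.mem_iSup_of_mem μ
        (scalar_smul_mem c (map_mem_weightSpace_of_extendScalars _ hv))

theorem eq_top_of_toBaseChange_mem {lam : X} {x : V} (h : IsHighestWeight D ε Qv lam x)
    {S : Submodule (SpecU D ε K) (K ⊗[Qv] V)} (hx : toBaseChange D ε K V x ∈ S) : S = ⊤ := by
  rw [eq_top_iff]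
  rintro z -
  induction z using TensorProduct.induction_on with
  | zero => exact zero_mem _
  | add z z' h h' => exact add_mem h h'
  | tmul c v =>
    have hv : v ∈ Submodule.span (SpecU D ε Qv) {x} := by rw [h.span_eq]; trivial
    obtain ⟨u, rfl⟩ := Submodule.mem_span_singleton.mp hv
    rw [tmul_eq (D := D) (ε := ε), LinearMap.map_smulₛₗ]
    exact S.smul_mem _ (S.smul_mem _ hx)

/-- The coordinate on `K ⊗ V` given by a linear form on `K`. -/
noncomputable def tensorCoord (f : K →ₗ[Qv] Qv) : K ⊗[Qv] V →ₗ[Qv] V :=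
  (TensorProduct.lid Qv V).toLinearMap ∘ₗ f.rTensor V

theorem tensorCoord_tmul (f : K →ₗ[Qv] Qv) (c : K) (v : V) :
    tensorCoord f (c ⊗ₜ[Qv] v) = f c • v := rfl

/-- Elements coming from the algebra over `ℚ(v)` act on the factor `V` alone, so a linear form on
`K` does not interfere with them. -/
theorem tensorCoord_smul (f : K →ₗ[Qv] Qv) (u : SpecU D ε Qv) (z : K ⊗[Qv] V) :
    tensorCoord f (extendScalars D ε K u • z) = u • tensorCoord f z := by
  induction z using TensorProduct.induction_on with
  | zero => simp only [smul_zero, map_zero]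
  | add z z' h h' => rw [smul_add, map_add, map_add, smul_add, h, h']
  | tmul c v =>
    rw [extendScalars_smul_tmul, tensorCoord_tmul, tensorCoord_tmul, smul_smul_comm_scalar]

theorem eq_zero_of_tensorCoord {z : K ⊗[Qv] V} (h : ∀ f : K →ₗ[Qv] Qv, tensorCoord f z = 0) :
    z = 0 := by
  let b := Module.Free.chooseBasis Qv K
  refine (TensorProduct.equivFinsuppOfBasisLeft b).injective ?_
  ext i
  rw [TensorProduct.equivFinsuppOfBasisLeft_apply, map_zero]
  exact h (b.coord i)

theorem tensorCoord_weightProj (h : IsWeightModule D ε Qv V) (f : K →ₗ[Qv] Qv) (μ : X)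
    (z : K ⊗[Qv] V) :
    tensorCoord f (weightProj D ε K (K ⊗[Qv] V) μ z) = weightProj D ε Qv V μ (tensorCoord f z) := by
  classical
  refine (h.baseChange K).map_diag h (tensorCoord f).toAddMonoidHom
    (fun lam z hz ν => ?_) (fun lam z hz => ?_) z
  · change SpecU.of D ε Qv (.K ν) • tensorCoord f z = _ • tensorCoord f z ∧
      SpecU.of D ε Qv (.J ν) • tensorCoord f z = _ • tensorCoord f z
    rw [← tensorCoord_smul, ← tensorCoord_smul, ← tensorCoord_smul, ← tensorCoord_smul,
      extendScalars_of, extendScalars_of, extendScalars_algebraMap, extendScalars_algebraMap,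
      (hz ν).1, (hz ν).2]
    exact ⟨rfl, rfl⟩
  · have h1 : SpecU.scalar D ε K ((Pi.single μ 1 : X → K) lam) =
        extendScalars D ε K (SpecU.scalar D ε Qv ((Pi.single μ 1 : X → Qv) lam)) := by
      rw [extendScalars_scalar]
      by_cases hμ : lam = μ
      · subst hμ; rw [Pi.single_eq_same, Pi.single_eq_same, map_one]
      · rw [Pi.single_eq_of_ne hμ, Pi.single_eq_of_ne hμ, map_zero]
    rw [h1]
    exact tensorCoord_smul f _ z

/-- This is the part of simplicity that is needed after base change. It descends to `V` coordinate
by coordinate, which avoids proving `K ⊗ V` simple. -/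
theorem eq_bot_of_weightProj_baseChange (h : IsWeightModule D ε Qv V) {lam : X}
    (hV : ∀ N : Submodule (SpecU D ε Qv) V, (∀ v ∈ N, weightProj D ε Qv V lam v = 0) → N = ⊥)
    {S : Submodule (SpecU D ε K) (K ⊗[Qv] V)}
    (hS : ∀ z ∈ S, weightProj D ε K (K ⊗[Qv] V) lam z = 0) : S = ⊥ := by
  rw [Submodule.eq_bot_iff]
  refine fun z hz => eq_zero_of_tensorCoord fun f => ?_
  -- The image of `S` under one coordinate is a submodule of `V`, and its projection to weight `lam`
  -- vanishes because coordinates commute with weight projections.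
  let N : Submodule (SpecU D ε Qv) V :=
    { carrier := {v | ∃ z ∈ S, tensorCoord f z = v}
      add_mem' := by
        rintro _ _ ⟨z, hz, rfl⟩ ⟨z', hz', rfl⟩
        exact ⟨z + z', add_mem hz hz', map_add _ _ _⟩
      zero_mem' := ⟨0, zero_mem _, map_zero _⟩
      smul_mem' := by
        rintro u _ ⟨z, hz, rfl⟩
        exact ⟨_, S.smul_mem (extendScalars D ε K u) hz, tensorCoord_smul f u z⟩ }
  have hN : N = ⊥ := hV N (by
    rintro _ ⟨z, hz, rfl⟩
    rw [← tensorCoord_weightProj h, hS z hz, map_zero])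
  exact (Submodule.eq_bot_iff N).mp hN _ ⟨z, hz, rfl⟩

end BaseChangeModule

/-! ### Comparison of characters -/

section Untwist

variable {I : Type u₁} {Y : Type u₂} {X : Type u₃} [AddCommGroup Y] [AddCommGroup X]
variable {D : SuperRootDatum I Y X} {T : TwistDatum D} {ε ε' : ℤˣ} {hε : ε' = -ε}
variable {M : Type w} [AddCommGroup M] [Module (SpecU D ε Qvt) M] (h : IsWeightModule D ε Qvt M)

theorem toTwist_of_smul_diagonal {y : Gen I Y} {c : X → QvPi}
    (hc : ∀ lam, ∀ m ∈ weightSpace D ε Qvt M lam,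
      SpecU.of D ε Qvt y • m = algebraMap QvPi (SpecU D ε Qvt) (c lam) • m) (m : M) :
    toTwist T hε tUnit_sq h (SpecU.of D ε Qvt y • m) =
      diag D ε' Qvt (TwistMod T hε tUnit_sq h) (fun lam => twistorAut (spec ε Qvt (c lam)))
        (toTwist T hε tUnit_sq h m) := by
  have h2 : IsWeightModule D ε' Qvt (TwistMod T hε tUnit_sq h) := isWeightModule_twist h
  induction m using h.induction with
  | h0 => rw [smul_zero, map_zero, map_zero]
  | ha m m' h1 h2 => rw [smul_add, map_add, map_add, map_add, h1, h2]
  | hw lam m hm =>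
    rw [hc lam m hm, SpecU.algebraMap_eq, toTwist_scalar, h2.diag_apply _ (toTwist_mem h hm)]

theorem toTwist_of_smul_shifted {y : Gen I Y} {n : X → ℤ}
    (hn : ∀ lam, ∀ m ∈ weightSpace D ε Qvt M lam,
      toTwist T hε tUnit_sq h (SpecU.of D ε Qvt y • m) =
        SpecU.scalar D ε' Qvt ((tUnit ^ n lam : Qvtˣ) : Qvt) •
          SpecU.of D ε' Qvt y • toTwist T hε tUnit_sq h m) (m : M) :
    toTwist T hε tUnit_sq h (SpecU.of D ε Qvt y • m) = SpecU.of D ε' Qvt y •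
      diag D ε' Qvt (TwistMod T hε tUnit_sq h) (fun lam => ((tUnit ^ n lam : Qvtˣ) : Qvt))
        (toTwist T hε tUnit_sq h m) := by
  have h2 : IsWeightModule D ε' Qvt (TwistMod T hε tUnit_sq h) := isWeightModule_twist h
  induction m using h.induction with
  | h0 => rw [smul_zero, map_zero, map_zero, smul_zero]
  | ha m m' h1 h2 => rw [smul_add, map_add, map_add, map_add, smul_add, h1, h2]
  | hw lam m hm =>
    rw [hn lam m hm, h2.diag_apply _ (toTwist_mem h hm), smul_scalar_smul]

/-- Seen in the twist, an old generator is a diagonal operator, possibly followed by the new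
generator. Submodules of weight modules are stable under both. -/
theorem toTwist_of_smul_mem {S : Submodule (SpecU D ε' Qvt) (TwistMod T hε tUnit_sq h)}
    (y : Gen I Y) {m : M} (hm : toTwist T hε tUnit_sq h m ∈ S) :
    toTwist T hε tUnit_sq h (SpecU.of D ε Qvt y • m) ∈ S := by
  have h2 : IsWeightModule D ε' Qvt (TwistMod T hε tUnit_sq h) := isWeightModule_twist h
  cases y with
  | E i =>
    rw [toTwist_of_smul_shifted h (fun lam m hm => toTwist_E h i hm)]
    exact S.smul_mem _ (h2.diag_mem S _ hm)
  | F i =>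
    rw [toTwist_of_smul_shifted h (fun lam m hm => toTwist_F h i hm)]
    exact S.smul_mem _ (h2.diag_mem S _ hm)
  | K ν =>
    rw [toTwist_of_smul_diagonal h (c := fun lam => ((vUnit QvPi ^ D.pairing ν lam : QvPiˣ) : QvPi))
      (fun lam m hm => (hm ν).1)]
    exact h2.diag_mem S _ hm
  | J ν =>
    rw [toTwist_of_smul_diagonal h (c := fun lam => ((piUnit ^ D.pairing ν lam : QvPiˣ) : QvPi))
      (fun lam m hm => (hm ν).2)]
    exact h2.diag_mem S _ hm

theorem toTwist_smul_mem {S : Submodule (SpecU D ε' Qvt) (TwistMod T hε tUnit_sq h)}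
    (u : SpecU D ε Qvt) {m : M} (hm : toTwist T hε tUnit_sq h m ∈ S) :
    toTwist T hε tUnit_sq h (u • m) ∈ S := by
  induction u using SpecU.induction generalizing m with
  | hs c => rw [toTwist_scalar]; exact S.smul_mem _ hm
  | ho y => exact toTwist_of_smul_mem h y hm
  | ha u u' h1 h2 => rw [add_smul, map_add]; exact add_mem (h1 hm) (h2 hm)
  | hm u u' h1 h2 => rw [mul_smul]; exact h1 (h2 hm)

/-- A submodule of the twist, as a submodule of the original module. -/
noncomputable def untwist (S : Submodule (SpecU D ε' Qvt) (TwistMod T hε tUnit_sq h)) :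
    Submodule (SpecU D ε Qvt) M where
  carrier := {m | toTwist T hε tUnit_sq h m ∈ S}
  add_mem' {m m'} hm hm' := by
    rw [Set.mem_ofPred_eq, map_add]; exact add_mem hm hm'
  zero_mem' := by rw [Set.mem_ofPred_eq, map_zero]; exact zero_mem _
  smul_mem' u m hm := toTwist_smul_mem h u hm

theorem mem_untwist {S : Submodule (SpecU D ε' Qvt) (TwistMod T hε tUnit_sq h)} {m : M} :
    m ∈ untwist h S ↔ toTwist T hε tUnit_sq h m ∈ S := by
  rw [untwist, Submodule.mem_mk]
  exact Set.mem_ofPred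

end Untwist

section Characters

variable {I : Type u₁} {Y : Type u₂} {X : Type u₃} [AddCommGroup Y] [AddCommGroup X]
variable {D : SuperRootDatum I Y X} {T : TwistDatum D} {ε ε' : ℤˣ} {hε : ε' = -ε}
variable {V : Type w} [AddCommGroup V] [Module (SpecU D ε Qv) V]
variable [Module Qv V] [ScalarCompatible D ε Qv V] (h : IsWeightModule D ε Qv V)

/-- The twisted highest weight vector defines a map from the Verma module at `ε'`. Each proper
submodule `N` must be killed: the `K`-span of its image has no component of weight `lam`, so its
untwist is a submodule of `K ⊗ V` that vanishes by the hypothesis on `V`. -/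
theorem exists_hom_of_twist {lam : X} {x : V} (hx : IsHighestWeight D ε Qv lam x)
    (hV : ∀ N : Submodule (SpecU D ε Qv) V, (∀ v ∈ N, weightProj D ε Qv V lam v = 0) → N = ⊥) :
    ∃ g : SimpleV D ε' lam →ₛₗ[extendScalars D ε' Qvt]
        TwistMod T hε tUnit_sq (h.baseChange Qvt),
      g (simpleGen D ε' lam) = toTwist T hε tUnit_sq _ (toBaseChange D ε Qvt V x) := by
  have hM : IsWeightModule D ε Qvt (Qvt ⊗[Qv] V) := h.baseChange Qvt
  have h2 : IsWeightModule D ε' Qvt (TwistMod T hε tUnit_sq hM) := isWeightModule_twist hM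
  have hx' : toBaseChange D ε Qvt V x ∈ weightSpace D ε Qvt (Qvt ⊗[Qv] V) lam :=
    map_mem_weightSpace_of_extendScalars _ hx.mem
  obtain ⟨g, hg⟩ := exists_vermaHom (D := D) (ε := ε') (K := Qvt)
    (toTwist_mem (T := T) (hε := hε) (hs := tUnit_sq) hM hx') (fun i => by
      rw [toTwist_E_smul hM i hx', ← extendScalars_of D ε Qvt, ← LinearMap.map_smulₛₗ, hx.E_smul,
        map_zero, smul_zero, map_zero])
  refine ⟨(vermaRadical D ε' Qv lam).liftQ g (sSup_le fun N hN v hv => ?_),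
    (Submodule.liftQ_apply _ g _).trans hg⟩
  let S := Submodule.span (SpecU D ε' Qvt) (g '' N)
  have hS : ∀ z ∈ S, weightProj D ε' Qvt (TwistMod T hε tUnit_sq hM) lam z = 0 := fun z hz => by
    replace hz := mem_closure_of_mem_span g N hz
    induction hz using AddSubgroup.closure_induction with
    | mem z hz =>
      obtain ⟨c, v, hv, rfl⟩ := hz
      have h3 : weightProj D ε' Qvt (TwistMod T hε tUnit_sq hM) lam
          (SpecU.scalar D ε' Qvt c • g v) = SpecU.scalar D ε' Qvt c •
          weightProj D ε' Qvt (TwistMod T hε tUnit_sq hM) lam (g v) := (h2.scalar_diag c _ _).symm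
      rw [h3, ← map_weightProj_of_extendScalars g (isWeightModule_verma lam) h2,
        weightProj_eq_zero_of_ne_top hN hv, map_zero, smul_zero]
    | zero => exact map_zero _
    | add z z' _ _ h h' => rw [map_add, h, h', add_zero]
    | neg z _ h => rw [map_neg, h, neg_zero]
  have hP : untwist hM S = ⊥ := eq_bot_of_weightProj_baseChange h hV fun m hm => by
    refine (toTwist T hε tUnit_sq hM).injective ?_
    rw [toTwist_weightProj, hS _ ((mem_untwist hM).mp hm), map_zero]
  obtain ⟨m, hm⟩ := (toTwist T hε tUnit_sq hM).surjective (g v)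
  have h4 : m ∈ untwist hM S := by
    rw [mem_untwist, hm]
    exact Submodule.subset_span ⟨v, hv, rfl⟩
  rw [hP, Submodule.mem_bot] at h4
  rw [LinearMap.mem_ker, ← hm, h4, map_zero]

end Characters

/-! ### Inequality of weight multiplicities -/

section CharacterBound

variable {I : Type u₁} {Y : Type u₂} {X : Type u₃} [AddCommGroup Y] [AddCommGroup X]
variable {D : SuperRootDatum I Y X} {T : TwistDatum D} {ε ε' : ℤˣ} {hε : ε' = -ε}

theorem toTwist_symm_scalar_smul {M : Type w} [AddCommGroup M] [Module (SpecU D ε Qvt) M]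
    (h : IsWeightModule D ε Qvt M) (c : Qvt) (z : TwistMod T hε tUnit_sq h) :
    (toTwist T hε tUnit_sq h).symm (SpecU.scalar D ε' Qvt c • z) =
      SpecU.scalar D ε Qvt (rescale tUnit tUnit_sq c) • (toTwist T hε tUnit_sq h).symm z := by
  obtain ⟨m, rfl⟩ := (toTwist T hε tUnit_sq h).surjective z
  rw [toTwist_scalar_smul, AddEquiv.symm_apply_apply, AddEquiv.symm_apply_apply]

variable {V : Type w} [AddCommGroup V] [Module (SpecU D ε Qv) V]
variable [Module Qv V] [ScalarCompatible D ε Qv V]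
variable {V' : Type*} [AddCommGroup V'] [Module (SpecU D ε' Qv) V']
variable [Module Qv V'] [ScalarCompatible D ε' Qv V']

/-- The `K`-span of the image of `V'` has its `μ`-component spanned by the image of a `ℚ(v)`-basis
of `V'_μ`. Pulling back to `K ⊗ V` rescales the coefficients by an endomorphism of `K`, so spanning
survives although linearity does not. -/
theorem toTwist_symm_mem_span (hM : IsWeightModule D ε Qvt (Qvt ⊗[Qv] V))
    (h' : IsWeightModule D ε' Qv V')
    (g : V' →ₛₗ[extendScalars D ε' Qvt] TwistMod T hε tUnit_sq hM) {μ : X} {ι : Type*}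
    (b : Module.Basis ι Qv (weightSubmodule D ε' Qv V' μ)) {z : TwistMod T hε tUnit_sq hM}
    (hz : z ∈ Submodule.span (SpecU D ε' Qvt) (g '' (⊤ : Submodule (SpecU D ε' Qv) V'))) :
    (toTwist T hε tUnit_sq hM).symm (weightProj D ε' Qvt (TwistMod T hε tUnit_sq hM) μ z) ∈
      Submodule.span Qvt (Set.range fun i => (toTwist T hε tUnit_sq hM).symm (g (b i).1)) := by
  have h2 : IsWeightModule D ε' Qvt (TwistMod T hε tUnit_sq hM) := isWeightModule_twist hM
  have hb : ∀ v : weightSubmodule D ε' Qv V' μ, (toTwist T hε tUnit_sq hM).symm (g v.1) ∈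
      Submodule.span Qvt (Set.range fun i => (toTwist T hε tUnit_sq hM).symm (g (b i).1)) := by
    intro v
    have hv : v ∈ Submodule.span Qv (Set.range b) := by rw [b.span_eq]; trivial
    induction hv using Submodule.span_induction with
    | mem v hv =>
      obtain ⟨i, rfl⟩ := hv
      exact Submodule.subset_span ⟨i, rfl⟩
    | zero => rw [Submodule.coe_zero, map_zero, map_zero]; exact zero_mem _
    | add v w _ _ h h' => rw [Submodule.coe_add, map_add, map_add]; exact add_mem h h'
    | smul a v _ h =>
      rw [Submodule.coe_smul, ← scalar_smul (D := D) (ε := ε'), g.map_smulₛₗ, extendScalars_scalar,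
        toTwist_symm_scalar_smul, scalar_smul]
      exact Submodule.smul_mem _ _ h
  replace hz := mem_closure_of_mem_span g ⊤ hz
  induction hz using AddSubgroup.closure_induction with
  | mem z hz =>
    obtain ⟨c, v, -, rfl⟩ := hz
    have h3 : weightProj D ε' Qvt (TwistMod T hε tUnit_sq hM) μ
        (SpecU.scalar D ε' Qvt c • g v) = SpecU.scalar D ε' Qvt c •
        weightProj D ε' Qvt (TwistMod T hε tUnit_sq hM) μ (g v) := (h2.scalar_diag c _ _).symm
    rw [h3, ← map_weightProj_of_extendScalars g h' h2, toTwist_symm_scalar_smul, scalar_smul]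
    exact Submodule.smul_mem _ _ (hb ⟨_, h'.weightProj_mem μ v⟩)
  | zero => rw [map_zero, map_zero]; exact zero_mem _
  | add z z' _ _ h h' => rw [map_add, map_add]; exact add_mem h h'
  | neg z _ h => rw [map_neg, map_neg]; exact neg_mem h

/-- Because the image of `g` contains the generator, its `K`-span is the whole twist. Hence `dim
V'_μ` vectors span a subspace containing `1 ⊗ V_μ`, where a basis of `V_μ` stays independent over
`K`. -/
theorem finrank_weightSubmodule_le (hM : IsWeightModule D ε Qvt (Qvt ⊗[Qv] V))
    (h' : IsWeightModule D ε' Qv V')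
    (g : V' →ₛₗ[extendScalars D ε' Qvt] TwistMod T hε tUnit_sq hM) {lam : X} {x : V} {x' : V'}
    (hx : IsHighestWeight D ε Qv lam x)
    (hg : g x' = toTwist T hε tUnit_sq hM (toBaseChange D ε Qvt V x)) (μ : X)
    [Module.Finite Qv (weightSubmodule D ε Qv V μ)]
    [Module.Finite Qv (weightSubmodule D ε' Qv V' μ)] :
    Module.finrank Qv (weightSubmodule D ε Qv V μ) ≤
      Module.finrank Qv (weightSubmodule D ε' Qv V' μ) := by
  have h2 : IsWeightModule D ε' Qvt (TwistMod T hε tUnit_sq hM) := isWeightModule_twist hM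
  let b := Module.finBasis Qv (weightSubmodule D ε Qv V μ)
  let b' := Module.finBasis Qv (weightSubmodule D ε' Qv V' μ)
  have htop : untwist hM
      (Submodule.span (SpecU D ε' Qvt) (g '' (⊤ : Submodule (SpecU D ε' Qv) V'))) = ⊤ := by
    refine eq_top_of_toBaseChange_mem hx ?_
    rw [mem_untwist, ← hg]
    exact Submodule.subset_span ⟨x', trivial, rfl⟩
  have hmem : ∀ v ∈ weightSubmodule D ε Qv V μ, toBaseChange D ε Qvt V v ∈
      Submodule.span Qvt (Set.range fun i => (toTwist T hε tUnit_sq hM).symm (g (b' i).1)) := by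
    intro v hv
    have h3 : toBaseChange D ε Qvt V v ∈ weightSpace D ε Qvt (Qvt ⊗[Qv] V) μ :=
      map_mem_weightSpace_of_extendScalars _ hv
    have h4 : toBaseChange D ε Qvt V v ∈ untwist hM
        (Submodule.span (SpecU D ε' Qvt) (g '' (⊤ : Submodule (SpecU D ε' Qv) V'))) := by
      rw [htop]; trivial
    have h5 := toTwist_symm_mem_span hM h' g b' ((mem_untwist hM).mp h4)
    rwa [h2.weightProj_apply_self (toTwist_mem hM h3), AddEquiv.symm_apply_apply] at h5
  -- Flatness over `ℚ(v)` turns independence in `V` over `ℚ(v)` into independence in `K ⊗ V` over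
  -- `K`.
  have hli : LinearIndependent Qvt fun j => (1 : Qvt) ⊗ₜ[Qv] (b j).1 :=
    Module.Flat.linearIndependent_one_tmul
      (b.linearIndependent.map' (weightSubmodule D ε Qv V μ).subtype (Submodule.ker_subtype _))
  classical
  have hcard := linearIndependent_le_span_aux' _ hli
    (Set.range fun i => (toTwist T hε tUnit_sq hM).symm (g (b' i).1)) (by
      rintro _ ⟨j, rfl⟩
      exact hmem _ (b j).2)
  have h6 := hcard.trans (Fintype.card_range_le _)
  rwa [Fintype.card_fin, Fintype.card_fin] at h6

theorem character_le [Finite I] (T : TwistDatum D) (hε : ε' = -ε) (lam μ : X) :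
    character D ε lam μ ≤ character D ε' lam μ := by
  let := scalarModule D ε Qv (SimpleV D ε lam)
  have := scalarModule_compatible D ε Qv (SimpleV D ε lam)
  let := scalarModule D ε' Qv (SimpleV D ε' lam)
  have := scalarModule_compatible D ε' Qv (SimpleV D ε' lam)
  have hx := isHighestWeight_simpleGen D ε lam
  have := hx.finite_weightSubmodule μ
  have := (isHighestWeight_simpleGen D ε' lam).finite_weightSubmodule μ
  have h := isWeightModule_simpleV (D := D) (ε := ε) lam
  obtain ⟨g, hg⟩ := exists_hom_of_twist (T := T) (hε := hε) h hx
    fun N hN => SimpleV.eq_bot_of_weightProj h hN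
  rw [character_eq, character_eq]
  exact finrank_weightSubmodule_le (h.baseChange Qvt) (isWeightModule_simpleV lam) g hx hg μ

theorem character_neg_one_eq [Finite I] (D : SuperRootDatum I Y X) (lam : X) :
    character D (-1) lam = character D 1 lam := by
  obtain ⟨T⟩ := nonempty_twistDatum D
  exact funext fun μ => le_antisymm (character_le T (neg_neg 1).symm lam μ)
    (character_le T rfl lam μ)

end CharacterBound

end CoveringQG

theorem proposition4p6 {I : Type u₁} {Y : Type u₂} {X : Type u₃} [Finite I]
    [AddCommGroup Y] [Module.Free ℤ Y] [Module.Finite ℤ Y]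
    [AddCommGroup X] [Module.Free ℤ X] [Module.Finite ℤ X]
    (D : SuperRootDatum I Y X) :
    Nonempty (WeightModCat.{w} D 1 Qvt ≌ WeightModCat.{w} D (-1) Qvt) ∧
    (∀ (_ : LinearOrder I) (C : Set X) (hC : IsTransversal D C),
      ∃ Θ : WeightModCat.{w} D 1 Qvt ≌ WeightModCat.{w} D (-1) Qvt,
        IsInducedByTwistor D hC Θ) ∧
    (∀ lam ∈ D.dominant,
      (∀ ε : ℤˣ, IsWeightModule D ε Qv (SimpleV D ε lam) ∧
        ∀ μ : X, Module.Finite (SpecAt ε Qv) (simpleVWeightSpace D ε lam μ)) ∧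
      character D (-1) lam = character D 1 lam) := by
  refine ⟨?_, fun _ C hC => ⟨_, isInducedByTwistor_twistEquivalence hC⟩, fun lam _ =>
    ⟨fun ε => ⟨isWeightModule_simpleV lam, fun μ => finite_simpleVWeightSpace lam μ⟩,
      character_neg_one_eq D lam⟩⟩
  obtain ⟨T⟩ := nonempty_twistDatum D
  exact ⟨twistEquivalence T⟩
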